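/- Let $N\ge 3$, let $q\in\mathbb C^\times$ be not a root of unity, fix a square root $s=(-q)^{1/2}$ of $-q$, and put $(-q)^{m/2}:=s^m$ for $m\in\mathbb Z$ and $\tilde q:=(-q)^{N/2}$. Let $E_{ij}$ be the matrix units of size $N$, $\bar\imath:=N+1-i$, and let $w$ be the transposition $E_{ij}\mapsto E_{\bar\jmath\,\bar\imath}$. Let $P=\sum_{i,j}E_{ij}\otimes E_{ji}$, $$R_q=\sum_{i,j}\big(q^{\delta_{ij}}E_{ii}\otimes E_{jj}+\delta_{i<j}(q-q^{-1})E_{ij}\otimes E_{ji}\big),\qquad f_q(u)=\frac1{q-q^{-1}u},$$ $$R(u)=f_q(u)R_q+f_{q^{-1}}(u^{-1})\,P R_{q^{-1}}P,\qquad C=\sum_i(-q)^iE_{\bar\imath i},\qquad R^\vee(u)=C_2^{-1}R^{t_1}(\tilde q^{\,2}u^{-1})C_2,$$ where $t_1$ is the transposition in the first tensor factor, $K_1=K\otimes 1$, $K_2=1\otimes K$ and $M_{21}=PMP$. For an $N\times N$ matrix $K$ of rational functions of one complex variable, consider the charge-conjugated twisted reflection equation $$R_{21}(\tfrac uv)K_1(u)R^\vee(uv)K_2(v)=K_2(v)R^\vee_{21}(uv)K_1(u)R(\tfrac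 uv)\quad\text{for generic }u,v.\qquad(\ast)$$ Consider the following transformations. (i) $K(u)\mapsto K(-u)$; (ii) $K(u)\mapsto g(u)K(u)$ with $g$ a nonzero rational function; (iii) $K(u)\mapsto Z(\eta/u)^w\,K(u)\,Z(\eta u)$, with $\eta\in\mathbb C^\times$ and $Z$ a generically invertible matrix of rational functions such that $R(u/v)$ commutes with $Z(u)\otimes Z(v)$ for generic $u,v$; (iv) $K(u)\mapsto K(u^{-1})^w$ together with the change of parameter $(-q)^{1/2}\mapsto(-q)^{-1/2}$, passing from $(\ast)$ for $s$ to $(\ast)$ for $s^{-1}$. Two matrices $K,M$, both considered for the parameter $s$, are called equivalent if the pair $(s,K)$ is obtained from the pair $(s,M)$ by a composition of such transformations. Theorem. A generically invertible $K$ satisfies $(\ast)$ if and only if it is equivalent to one of the matrices $$\sum_{1\le i\le N}E_{i\bar\imath}+\sum_{1\le i<j\le N}\frac{1+q}{\tilde q+qu}\Big((-q)^{\frac{j-i}2}u\,E_{i\bar\jmath}+(-q)^{\frac{i-j}2}\tilde q\,E_{j\bar\imath}\Big),$$ $$\sum_{1\le i\le N}E_{i\bar\imath},$$ $$\sum_{1\le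 i\le N/2}\big(E_{2i-1,\overline{2i}}+E_{2i,\overline{2i}+1}\big),$$ $$\sum_{1\le i\le N/2}\big(u\,E_{i,\bar\imath-N/2}+E_{i+N/2,\bar\imath}\big),$$ where the last two are allowed only if $N$ is even. -/

import Mathlib

/-!
Indices `1, …, N` are represented by `Fin N` (so `0, …, N - 1`); the reflected index
`N - i + 1` is `Fin.rev i`.  The deformation parameter is `q = - s ^ 2`, where `s` is the chosen
square root of `-q`.
-/

open scoped Kronecker

noncomputable section

namespace ReflectionEquation

/-- Matrices of size `N` whose entries are rational functions of one complex variable. -/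
abbrev RatMatrix (N : ℕ) : Type := Matrix (Fin N) (Fin N) (RatFunc ℂ)

/-- Operators on `ℂ^N ⊗ ℂ^N`. -/
abbrev TensorMatrix (N : ℕ) : Type := Matrix (Fin N × Fin N) (Fin N × Fin N) ℂ

/-- The value `K(u)` at a complex number `u` (the true value whenever `u` is not a pole,
hence for all but finitely many `u`). -/
def valueAt {N : ℕ} (K : RatMatrix N) (u : ℂ) : Matrix (Fin N) (Fin N) ℂ :=
  K.map (RatFunc.eval (RingHom.id ℂ) u)

/-- The rational matrix `u ↦ K(x(u))`, for a nonconstant rational function `x`. -/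
def substitute {N : ℕ} (x : RatFunc ℂ) (K : RatMatrix N) : RatMatrix N :=
  K.map (RatFunc.eval RatFunc.C x)

/-- `P u v` holds for generic `u`, `v`: for all but finitely many `u` it holds for all but finitely
many `v`.  If `P u v` is an equality of two rational functions of `(u, v)`, then this says exactly
that the two rational functions are equal in `ℂ(u, v)`. -/
def Generically (P : ℂ → ℂ → Prop) : Prop :=
  ∀ᶠ u in Filter.cofinite, ∀ᶠ v in Filter.cofinite, P u v

/-- The matrix unit `E_{ij}`. -/
abbrev E {N : ℕ} {A : Type*} [Zero A] [One A] (i j : Fin N) : Matrix (Fin N) (Fin N) A :=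
  Matrix.single i j 1

/-- Transposition with respect to the main antidiagonal, `E_{ij} ↦ E_{rev j, rev i}`. -/
def antiTranspose {N : ℕ} {A : Type*} (M : Matrix (Fin N) (Fin N) A) :
    Matrix (Fin N) (Fin N) A :=
  Matrix.of fun a b => M b.rev a.rev

/-- `K_1 = K ⊗ 1`. -/
def leg1 {N : ℕ} (M : Matrix (Fin N) (Fin N) ℂ) : TensorMatrix N :=
  M ⊗ₖ (1 : Matrix (Fin N) (Fin N) ℂ)

/-- `K_2 = 1 ⊗ K`. -/
def leg2 {N : ℕ} (M : Matrix (Fin N) (Fin N) ℂ) : TensorMatrix N :=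
  (1 : Matrix (Fin N) (Fin N) ℂ) ⊗ₖ M

/-- The permutation operator. -/
def permOp (N : ℕ) : TensorMatrix N :=
  ∑ i : Fin N, ∑ j : Fin N, E i j ⊗ₖ E j i

/-- `M_{21} = P M P`. -/
def flip21 {N : ℕ} (M : TensorMatrix N) : TensorMatrix N :=
  permOp N * M * permOp N

/-- Transposition in the first tensor factor. -/
def partialTranspose1 {N : ℕ} (M : TensorMatrix N) : TensorMatrix N :=
  Matrix.of fun a b => M (b.1, a.2) (a.1, b.2)

/-- The constant R-matrix `R_q`. -/
def constR (N : ℕ) (q : ℂ) : TensorMatrix N :=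
  ∑ i : Fin N, ∑ j : Fin N,
    ((if i = j then q else 1) • (E i i ⊗ₖ E j j)
      + (if i < j then q - q⁻¹ else 0) • (E i j ⊗ₖ E j i))

/-- `f_q(u) = 1 / (q - q⁻¹ u)`. -/
def fCoeff (q u : ℂ) : ℂ := 1 / (q - q⁻¹ * u)

/-- The Bazhanov–Jimbo R-matrix `R(u) = f_q(u) R_q + f_{q⁻¹}(u⁻¹) P R_{q⁻¹} P`. -/
def RMatrix (N : ℕ) (q u : ℂ) : TensorMatrix N :=
  fCoeff q u • constR N q + fCoeff q⁻¹ u⁻¹ • (permOp N * constR N q⁻¹ * permOp N)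

/-- The matrix `C = ∑ᵢ (-q)^i E_{rev i, i}` (with `i` counted from `1`). -/
def chargeConj (N : ℕ) (q : ℂ) : Matrix (Fin N) (Fin N) ℂ :=
  ∑ i : Fin N, (-q) ^ ((i : ℕ) + 1) • E i.rev i

/-- `q = - s ^ 2`. -/
def qOf (s : ℂ) : ℂ := -s ^ 2

/-- `(-q)^{N/2}`, that is, `s ^ N`. -/
def qTilde (N : ℕ) (s : ℂ) : ℂ := s ^ N

/-- The C-conjugated R-matrix `C₂⁻¹ R^{t₁}(q̃² u⁻¹) C₂`, with `q̃ = (-q)^{N/2}`. -/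
def conjR (N : ℕ) (s u : ℂ) : TensorMatrix N :=
  leg2 (chargeConj N (qOf s))⁻¹
    * partialTranspose1 (RMatrix N (qOf s) (qTilde N s ^ 2 * u⁻¹))
    * leg2 (chargeConj N (qOf s))

/-- The charge-conjugated twisted reflection equation
`R₂₁(u/v) K₁(u) Rᶜ(uv) K₂(v) = K₂(v) Rᶜ₂₁(uv) K₁(u) R(u/v)`. -/
def SolvesCtRE {N : ℕ} (s : ℂ) (K : RatMatrix N) : Prop :=
  Generically fun u v =>
    flip21 (RMatrix N (qOf s) (u / v)) * leg1 (valueAt K u) * conjR N s (u * v)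
        * leg2 (valueAt K v)
      = leg2 (valueAt K v) * flip21 (conjR N s (u * v)) * leg1 (valueAt K u)
        * RMatrix N (qOf s) (u / v)

/-- `Z` is a symmetry of `R`: it is generically invertible and `[R(u/v), Z(u) ⊗ Z(v)] = 0`. -/
def IsSymmetry {N : ℕ} (q : ℂ) (Z : RatMatrix N) : Prop :=
  Z.det ≠ 0 ∧ Generically fun u v =>
    RMatrix N q (u / v) * (valueAt Z u ⊗ₖ valueAt Z v)
      = (valueAt Z u ⊗ₖ valueAt Z v) * RMatrix N q (u / v)

/-- The elementary transformations of solutions.  A pair `(s, K)` stands for a rational matrix `K`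
considered with the equation whose parameter is `s = (-q)^{1/2}`; only the last transformation,
which includes `(-q)^{1/2} ↦ (-q)^{-1/2}`, changes the parameter. -/
inductive Transformation {N : ℕ} : ℂ × RatMatrix N → ℂ × RatMatrix N → Prop
  /-- `u ↦ K(-u)` -/
  | negate (s : ℂ) (K : RatMatrix N) :
      Transformation (s, K) (s, substitute (-RatFunc.X) K)
  /-- `u ↦ g(u) K(u)` with `g ≠ 0` -/
  | scale (s : ℂ) (K : RatMatrix N) (g : RatFunc ℂ) (hg : g ≠ 0) :
      Transformation (s, K) (s, g • K)
  /-- `u ↦ w(Z(η/u)) K(u) Z(η u)` with `Z` a symmetry of `R` -/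
  | dress (s : ℂ) (K : RatMatrix N) (η : ℂ) (hη : η ≠ 0) (Z : RatMatrix N)
      (hZ : IsSymmetry (qOf s) Z) :
      Transformation (s, K)
        (s, antiTranspose (substitute (RatFunc.C η * RatFunc.X⁻¹) Z) * K
              * substitute (RatFunc.C η * RatFunc.X) Z)
  /-- `u ↦ w(K(u⁻¹))`, together with `(-q)^{1/2} ↦ (-q)^{-1/2}` -/
  | invert (s : ℂ) (K : RatMatrix N) :
      Transformation (s, K) (s⁻¹, antiTranspose (substitute RatFunc.X⁻¹ K))

/-- `K` is equivalent to `M` (both considered with the parameter `s`): it is obtained from `M` by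
a composition of elementary transformations. -/
def EquivalentTo {N : ℕ} (s : ℂ) (K M : RatMatrix N) : Prop :=
  Relation.ReflTransGen Transformation (s, M) (s, K)

/-- The dense matrix
`∑ᵢ E_{i, rev i} + ∑_{i<j} (1+q)/(q̃+q u) ((-q)^{(j-i)/2} u E_{i, rev j} + (-q)^{(i-j)/2} q̃ E_{j, rev i})`. -/
def denseK (N : ℕ) (s : ℂ) : RatMatrix N :=
  ∑ i : Fin N, E i i.rev
    + ∑ i : Fin N, ∑ j : Fin N,
        if i < j then
          (RatFunc.C (1 + qOf s)
              / (RatFunc.C (qTilde N s) + RatFunc.C (qOf s) * RatFunc.X)) •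
            ((RatFunc.C (s ^ ((j : ℤ) - (i : ℤ))) * RatFunc.X) • E i j.rev
              + RatFunc.C (s ^ ((i : ℤ) - (j : ℤ)) * qTilde N s) • E j i.rev)
        else 0

/-- The antidiagonal matrix `∑ᵢ E_{i, rev i}`. -/
def antidiagonalK (N : ℕ) : RatMatrix N := ∑ i : Fin N, E i i.rev

/-- For even `N`, the matrix `∑_{i ≤ N/2} (E_{2i-1, rev (2i)} + E_{2i, rev (2i-1)})`, where
`rev (2i) + 1 = rev (2i-1)`; counting from `0`, the pair `(2i-1, 2i)` becomes `(2i, 2i+1)`. -/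
def pairedK (N : ℕ) : RatMatrix N :=
  ∑ i : Fin (N / 2),
    let a : Fin N := ⟨2 * i, by omega⟩
    let b : Fin N := ⟨2 * i + 1, by omega⟩
    (E a b.rev + E b a.rev)

/-- For even `N`, the matrix `∑_{i ≤ N/2} (u E_{i, rev i - N/2} + E_{i+N/2, rev i})`, where
`rev i - N/2 = rev (i + N/2)`. -/
def halfShiftK (N : ℕ) : RatMatrix N :=
  ∑ i : Fin (N / 2),
    let a : Fin N := ⟨i, by omega⟩
    let b : Fin N := ⟨i + N / 2, by omega⟩
    (RatFunc.X (K := ℂ) • E a b.rev + E b a.rev)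

end ReflectionEquation

end

/-! Put `H(u) = C K(q̃ u)`. In terms of `H` both `C` and `q̃` disappear from the equation, and since
`R(x)` is a scalar times a six-vertex operator with diagonal weights `wt` and exchange weights `ex`,
what remains is one scalar identity `TwistedEq` for each `(i, j, k, l)`, in `q`, `x = u/v` and `y =
1/(uv)` (`solvesCtRE_iff`). Everything is done with these components.

Sufficiency. A symmetry `Z` of `R` is monomial: a scalar function times a constant diagonal matrix
times a cyclic rotation in which wrapped indices carry a factor `u` (`IsSymmetry.exists_rotation`).
Dressing therefore multiplies all terms of a component by one common factor, and the other
transformations preserve the equation because they respect `x`, `y` and the weights. The four normal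
forms are checked directly.

Necessity splits on the diagonal of `H`.

If the diagonal vanishes, each row has one nonzero entry and `H` is supported on a fixed-point free
involution `τ` (`RatSol.exists_involution`), a chord diagram on the indices. Entries of different
chords have ratio a constant times a power of `u`; going from `i` to `τ i` through another chord,
the exponent counts the endpoints of that chord lying between `i` and `τ i`. It cannot depend on the
chord used, so either all chords cross (`τ` is the shift by `N/2`), or all join neighbours, or one
chord joins the first index to the last and the others join neighbours, which is a rotation of the
previous case. The component inside a chord fixes the remaining constants.

If some diagonal entry is nonzero, all diagonal entries are constant multiples of it and may be
taken constant. A zero off-diagonal entry in a row with nonzero diagonal entry forces `H` to be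
diagonal (`DiagData.offdiag_eq_zero`). Otherwise the diagonal can be normalised to `1`; each
off-diagonal entry is then an affine function over `q²u² - 1`, and the equations for triples of
indices cancel the same factor `δ q u - 1`, `δ = ±1`, everywhere and leave only signs `c i * c j`
(`DiagData.matches_dense`).

In all cases `H` agrees with a model up to scalar, diagonal gauge, rotation and `u ↦ -u`, and
`Realizes.equivalentTo` turns such an agreement into explicit transformations. The inversion (iv) is
not needed for this direction. -/

open scoped Kronecker

noncomputable section

namespace ReflectionEquation

open Filter

variable {N : ℕ}

/-! ### Generic values of rational functions -/

section
open Polynomial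

/-- The value of a rational function at a complex number. -/
abbrev ev (f : RatFunc ℂ) (u : ℂ) : ℂ := RatFunc.eval (RingHom.id ℂ) u f

lemma eventually_eval_ne_zero {p : ℂ[X]} (hp : p ≠ 0) : ∀ᶠ u in cofinite, p.eval u ≠ 0 := by
  rw [eventually_cofinite]
  simpa using (p.finite_setOfPred_isRoot hp)

lemma eventually_denom_ne_zero (f : RatFunc ℂ) :
    ∀ᶠ u in cofinite, f.denom.eval₂ (RingHom.id ℂ) u ≠ 0 := by
  simpa [Polynomial.eval₂_id] using eventually_eval_ne_zero f.denom_ne_zero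

lemma ev_add (f g : RatFunc ℂ) : ∀ᶠ u in cofinite, ev (f + g) u = ev f u + ev g u := by
  filter_upwards [eventually_denom_ne_zero f, eventually_denom_ne_zero g] with u h1 h2
  exact RatFunc.eval_add _ _ h1 h2

lemma ev_mul (f g : RatFunc ℂ) : ∀ᶠ u in cofinite, ev (f * g) u = ev f u * ev g u := by
  filter_upwards [eventually_denom_ne_zero f, eventually_denom_ne_zero g] with u h1 h2
  exact RatFunc.eval_mul _ _ h1 h2

lemma ev_inv (f : RatFunc ℂ) : ∀ᶠ u in cofinite, ev f⁻¹ u = (ev f u)⁻¹ := by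
  by_cases hf : f = 0
  · simp [hf]
  · filter_upwards [ev_mul f f⁻¹] with u hu
    rw [mul_inv_cancel₀ hf] at hu
    simp only [ev, RatFunc.eval_one] at hu
    exact eq_inv_of_mul_eq_one_right hu.symm

lemma ev_div (f g : RatFunc ℂ) : ∀ᶠ u in cofinite, ev (f / g) u = ev f u / ev g u := by
  filter_upwards [ev_mul f g⁻¹, ev_inv g] with u h1 h2
  rw [div_eq_mul_inv, h1, h2, div_eq_mul_inv]

lemma ev_ne_zero {f : RatFunc ℂ} (hf : f ≠ 0) : ∀ᶠ u in cofinite, ev f u ≠ 0 := by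
  filter_upwards [ev_mul f f⁻¹] with u hu h0
  rw [mul_inv_cancel₀ hf, h0] at hu
  simp [ev] at hu

lemma ev_neg (f : RatFunc ℂ) : ∀ᶠ u in cofinite, ev (-f) u = -ev f u := by
  filter_upwards [ev_add f (-f)] with u hu
  rw [add_neg_cancel] at hu
  simp only [ev, RatFunc.eval_zero] at hu
  linear_combination -hu

lemma ev_sum {ι : Type*} (t : Finset ι) (f : ι → RatFunc ℂ) :
    ∀ᶠ u in cofinite, ev (∑ i ∈ t, f i) u = ∑ i ∈ t, ev (f i) u := by
  classical
  induction t using Finset.induction_on with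
  | empty => simp [ev]
  | insert a t ha ih =>
    filter_upwards [ih, ev_add (f a) (∑ i ∈ t, f i)] with u h1 h2
    rw [Finset.sum_insert ha, Finset.sum_insert ha, h2, h1]

lemma ev_pow (f : RatFunc ℂ) (n : ℕ) : ∀ᶠ u in cofinite, ev (f ^ n) u = ev f u ^ n := by
  induction n with
  | zero => simp [ev]
  | succ n ih =>
    filter_upwards [ih, ev_mul (f ^ n) f] with u h1 h2
    rw [pow_succ, h2, h1, pow_succ]

/-- A nonzero rational function has finitely many zeros, so generic values determine it. This
converts every pointwise computation back into an identity in `ℂ(u)`. -/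
lemma ratFunc_ext {f g : RatFunc ℂ} (h : ∀ᶠ u in cofinite, ev f u = ev g u) : f = g := by
  by_contra hne
  have h1 := ev_ne_zero (sub_ne_zero.mpr hne)
  have : ∀ᶠ u in (cofinite : Filter ℂ), False := by
    filter_upwards [h, h1, ev_add f (-g), ev_neg g] with u h2 h3 h4 h5
    rw [sub_eq_add_neg, h4, h5, h2] at h3
    simp at h3
  exact this.exists.choose_spec

lemma ev_eval₂ (x : RatFunc ℂ) (p : ℂ[X]) :
    ∀ᶠ u in cofinite, ev (p.eval₂ RatFunc.C x) u = p.eval₂ (RingHom.id ℂ) (ev x u) := by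
  induction p using Polynomial.induction_on' with
  | add p r hp hr =>
    filter_upwards [hp, hr, ev_add (p.eval₂ RatFunc.C x) (r.eval₂ RatFunc.C x)] with u h1 h2 h3
    rw [Polynomial.eval₂_add, Polynomial.eval₂_add, h3, h1, h2]
  | monomial n a =>
    filter_upwards [ev_mul (RatFunc.C a) (x ^ n), ev_pow x n] with u h1 h2
    rw [Polynomial.eval₂_monomial, Polynomial.eval₂_monomial, h1, h2]
    simp [ev]

/-- Substitution of a rational function is generically composition. -/
lemma ev_comp (x f : RatFunc ℂ) :
    ∀ᶠ u in cofinite, ev (RatFunc.eval RatFunc.C x f) u = ev f (ev x u) := by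
  filter_upwards [ev_eval₂ x f.num, ev_eval₂ x f.denom,
    ev_div (f.num.eval₂ RatFunc.C x) (f.denom.eval₂ RatFunc.C x)] with u h1 h2 h3
  rw [RatFunc.eval, h3, h1, h2]
  rfl

lemma eventually_comp_mul {P : ℂ → Prop} (h : ∀ᶠ u in cofinite, P u) {c : ℂ} (hc : c ≠ 0) :
    ∀ᶠ u in cofinite, P (c * u) :=
  (mul_right_injective₀ hc).tendsto_cofinite.eventually h

lemma eventually_comp_inv {P : ℂ → Prop} (h : ∀ᶠ u in cofinite, P u) :
    ∀ᶠ u in cofinite, P u⁻¹ :=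
  (inv_injective (G := ℂ)).tendsto_cofinite.eventually h

lemma eventually_ne (c : ℂ) : ∀ᶠ u in cofinite, u ≠ c :=
  (Set.finite_singleton c).compl_mem_cofinite

end

/-! ### The twisted reflection equation in components -/



/-- The diagonal weights of the R-matrix `(q - q⁻¹ x) R(x)`. -/
def wt (q x : ℂ) (i j : Fin N) : ℂ := if i = j then q - q⁻¹ * x else 1 - x

/-- The exchange weights of the R-matrix `(q - q⁻¹ x) R(x)`. -/
def ex (q x : ℂ) (i j : Fin N) : ℂ :=
  if i < j then q - q⁻¹ else if j < i then (q - q⁻¹) * x else 0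

/-- The twisted reflection equation for `K`-matrices with values `A`, `B`, in components. -/
def TwistedEq (q x y : ℂ) (A B : Fin N → Fin N → ℂ) : Prop := ∀ i j k l,
  wt q x i j * (wt q y j k * (A i k * B j l) + ex q y k j * (A i j * B k l))
      + ex q x i j * (wt q y i k * (A j k * B i l) + ex q y k i * (A j i * B k l))
    = wt q x k l * (wt q y i l * (A i k * B j l) + ex q y l i * (A l k * B j i))
      + ex q x l k * (wt q y i k * (A i l * B j k) + ex q y k i * (A k l * B j i))

/-- The operator with diagonal entries `r` and exchange entries `c`. -/
def sixVertex (r c : Fin N → Fin N → ℂ) : TensorMatrix N :=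
  Matrix.of fun p p' =>
    (if p = p' then r p.1 p.2 else 0) + (if p.swap = p' then c p.1 p.2 else 0)

lemma sixVertex_mul_apply (r c : Fin N → Fin N → ℂ) (M : TensorMatrix N) (i j : Fin N)
    (p : Fin N × Fin N) :
    (sixVertex r c * M) (i, j) p = r i j * M (i, j) p + c i j * M (j, i) p := by
  simp [Matrix.mul_apply, sixVertex, add_mul, Finset.sum_add_distrib]

lemma mul_sixVertex_apply (r c : Fin N → Fin N → ℂ) (M : TensorMatrix N) (k l : Fin N)
    (p : Fin N × Fin N) :
    (M * sixVertex r c) p (k, l) = M p (k, l) * r k l + M p (l, k) * c l k := by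
  have h : ∀ p' : Fin N × Fin N, p'.swap = (k, l) ↔ p' = (l, k) := by
    rintro ⟨a, b⟩; simp [and_comm]
  simp [Matrix.mul_apply, sixVertex, mul_add, Finset.sum_add_distrib, h]

lemma permOp_apply (p p' : Fin N × Fin N) :
    permOp N p p' = if p.swap = p' then 1 else 0 := by
  obtain ⟨i, j⟩ := p
  obtain ⟨k, l⟩ := p'
  simp only [permOp, Matrix.sum_apply, Matrix.kroneckerMap_apply, Matrix.single_apply]
  rw [Finset.sum_eq_single i, Finset.sum_eq_single j]
  · by_cases h1 : j = k <;> by_cases h2 : i = l <;> simp [h1, h2]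
  · intro b _ hb; simp [hb]
  · simp
  · intro b _ hb; simp [hb]
  · simp

lemma permOp_eq : permOp N = sixVertex 0 1 := by
  ext p p'
  simp [permOp_apply, sixVertex]

lemma flip21_apply (M : TensorMatrix N) (i j k l : Fin N) :
    flip21 M (i, j) (k, l) = M (j, i) (l, k) := by
  rw [flip21, permOp_eq, mul_sixVertex_apply, sixVertex_mul_apply]
  simp [sixVertex_mul_apply]

lemma constR_eq (q : ℂ) :
    constR N q = sixVertex (fun i j => if i = j then q else 1)
      (fun i j => if i < j then q - q⁻¹ else 0) := by
  ext ⟨i, j⟩ ⟨k, l⟩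
  simp only [constR, Matrix.sum_apply, Matrix.add_apply, Matrix.smul_apply,
    Matrix.kroneckerMap_apply, Matrix.single_apply, sixVertex, Matrix.of_apply, Prod.swap_prod_mk]
  rw [Finset.sum_eq_single i, Finset.sum_eq_single j]
  · by_cases h1 : i = k <;> by_cases h2 : j = l <;> by_cases h3 : i = l <;> by_cases h4 : j = k <;>
      simp_all
  · intro b _ hb; simp [hb]
  · simp
  · intro b _ hb; simp [hb]
  · simp

/-- Since `f_{q⁻¹}(x⁻¹) = -x f_q(x)`, both summands of `R(x)` have the common factor `f_q(x)`,
leaving six-vertex weights that are linear in `x`. -/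
lemma RMatrix_eq (q : ℂ) {x : ℂ} (hq : q ≠ 0) (hx : x ≠ 0) :
    RMatrix N q x = fCoeff q x • sixVertex (wt q x) (ex q x) := by
  have hf : fCoeff q⁻¹ x⁻¹ = -x * fCoeff q x := by
    rw [fCoeff, fCoeff, inv_inv, show q⁻¹ - q * x⁻¹ = -(x⁻¹ * (q - q⁻¹ * x)) by field_simp; ring]
    simp [mul_comm]
  ext ⟨i, j⟩ ⟨k, l⟩
  have hflip : (permOp N * constR N q⁻¹ * permOp N) (i, j) (k, l)
      = constR N q⁻¹ (j, i) (l, k) := flip21_apply _ i j k l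
  rw [RMatrix, hf, Matrix.add_apply, Matrix.smul_apply, Matrix.smul_apply, Matrix.smul_apply,
    hflip, constR_eq, constR_eq]
  simp only [sixVertex, wt, ex, Matrix.of_apply, smul_eq_mul, Prod.mk.injEq, Prod.swap_prod_mk,
    inv_inv]
  have e1 : (j = l ∧ i = k) = (i = k ∧ j = l) := by rw [and_comm]
  have e2 : (i = l ∧ j = k) = (j = k ∧ i = l) := by rw [and_comm]
  simp only [e1, e2]
  rcases lt_trichotomy i j with h | rfl | h
  · simp only [h, h.ne, h.ne', h.not_gt, if_true, if_false]
    split_ifs <;> ring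
  · simp only [lt_self_iff_false, if_true, if_false]
    split_ifs <;> ring
  · simp only [h, h.ne, h.ne', h.not_gt, if_true, if_false]
    split_ifs <;> ring

lemma wt_comm (q x : ℂ) (i j : Fin N) : wt q x i j = wt q x j i := by
  simp [wt, eq_comm]

lemma wt_rev (q x : ℂ) (i j : Fin N) : wt q x i.rev j.rev = wt q x i j := by
  simp [wt]

lemma ex_rev (q x : ℂ) (i j : Fin N) : ex q x i.rev j.rev = ex q x j i := by
  simp [ex]

@[simp] lemma ex_self (q x : ℂ) (i : Fin N) : ex q x i i = 0 := by
  simp [ex]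

@[simp] lemma wt_self (q x : ℂ) (i : Fin N) : wt q x i i = q - q⁻¹ * x := by
  simp [wt]

lemma leg1_mul_apply (M : Matrix (Fin N) (Fin N) ℂ) (T : TensorMatrix N) (i j : Fin N)
    (p : Fin N × Fin N) : (leg1 M * T) (i, j) p = ∑ m, M i m * T (m, j) p := by
  simp [leg1, Matrix.mul_apply, Fintype.sum_prod_type, Matrix.kroneckerMap_apply, Matrix.one_apply]

lemma leg2_mul_apply (M : Matrix (Fin N) (Fin N) ℂ) (T : TensorMatrix N) (i j : Fin N)
    (p : Fin N × Fin N) : (leg2 M * T) (i, j) p = ∑ m, M j m * T (i, m) p := by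
  simp [leg2, Matrix.mul_apply, Fintype.sum_prod_type, Matrix.kroneckerMap_apply, Matrix.one_apply]

lemma mul_leg1_apply (M : Matrix (Fin N) (Fin N) ℂ) (T : TensorMatrix N) (k l : Fin N)
    (p : Fin N × Fin N) : (T * leg1 M) p (k, l) = ∑ m, T p (m, l) * M m k := by
  simp [leg1, Matrix.mul_apply, Fintype.sum_prod_type, Matrix.kroneckerMap_apply, Matrix.one_apply]

lemma mul_leg2_apply (M : Matrix (Fin N) (Fin N) ℂ) (T : TensorMatrix N) (k l : Fin N)
    (p : Fin N × Fin N) : (T * leg2 M) p (k, l) = ∑ m, T p (k, m) * M m l := by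
  simp [leg2, Matrix.mul_apply, Fintype.sum_prod_type, Matrix.kroneckerMap_apply, Matrix.one_apply]

lemma chargeConj_apply (q : ℂ) (a b : Fin N) :
    chargeConj N q a b = if a = b.rev then (-q) ^ ((b : ℕ) + 1) else 0 := by
  simp only [chargeConj, Matrix.sum_apply, Matrix.smul_apply, Matrix.single_apply]
  rw [Finset.sum_eq_single b]
  · simp [eq_comm]
  · intro c _ hc; simp [hc]
  · simp

lemma chargeConj_inv {q : ℂ} (hq : q ≠ 0) :
    (chargeConj N q)⁻¹
      = Matrix.of fun a b : Fin N => if b = a.rev then ((-q) ^ ((a : ℕ) + 1))⁻¹ else 0 := by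
  apply Matrix.inv_eq_left_inv
  ext a b
  have : (-q) ^ ((a : ℕ) + 1) ≠ 0 := pow_ne_zero _ (neg_ne_zero.mpr hq)
  simp only [Matrix.mul_apply, Matrix.of_apply, chargeConj_apply, ite_mul, zero_mul,
    Finset.sum_ite_eq', Finset.mem_univ, if_true, Fin.rev_inj, Matrix.one_apply]
  by_cases h : a = b
  · subst h; simp [this]
  · simp [h]

/-- Partial transposition followed by conjugation with the antidiagonal `C` reverses the second
index: the weights of `R^∨` are those of `R` at `(k, j.rev)`, and the exchange term acquires a
quotient of two entries of `C`. -/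
lemma conjR_apply {s : ℂ} {w : ℂ} (hs : s ≠ 0) (hw : w ≠ 0) (m j k n : Fin N) :
    conjR N s w (m, j) (k, n)
      = fCoeff (qOf s) (qTilde N s ^ 2 * w⁻¹)
        * ((if m = k ∧ n = j then wt (qOf s) (qTilde N s ^ 2 * w⁻¹) k j.rev else 0)
          + (if m = j.rev ∧ n = k.rev then ((-qOf s) ^ ((j : ℕ) + 1))⁻¹
              * (-qOf s) ^ ((k.rev : ℕ) + 1) * ex (qOf s) (qTilde N s ^ 2 * w⁻¹) k j.rev
              else 0)) := by
  have hq : qOf s ≠ 0 := by simp [qOf, hs]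
  have hz : qTilde N s ^ 2 * w⁻¹ ≠ 0 := by simp [qTilde, hs, hw]
  set q := qOf s with hqd
  have hqj : (-q) ^ ((j : ℕ) + 1) ≠ 0 := pow_ne_zero _ (neg_ne_zero.mpr hq)
  rw [conjR, mul_leg2_apply]
  simp only [leg2_mul_apply, chargeConj_inv hq, chargeConj_apply, Matrix.of_apply, ite_mul,
    zero_mul, mul_ite, mul_zero, Finset.sum_ite_eq', Finset.mem_univ, if_true, ← hqd]
  rw [partialTranspose1, Matrix.of_apply, RMatrix_eq q hq hz]
  simp only [Matrix.smul_apply, sixVertex, Matrix.of_apply, Prod.mk.injEq, Prod.swap_prod_mk,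
    smul_eq_mul, Fin.rev_inj]
  have e1 : (k = m ∧ j = n) = (m = k ∧ n = j) := 
    propext (and_congr eq_comm eq_comm)
  have e2 : (j.rev = m ∧ k = n.rev) = (m = j.rev ∧ n = k.rev) :=
    propext (and_congr eq_comm (by rw [← Fin.rev_eq_iff, eq_comm]))
  simp only [e1, e2]
  by_cases h1 : m = k ∧ n = j
  · obtain ⟨rfl, rfl⟩ := h1
    simp only [and_self, if_true]
    by_cases h2 : m = n.rev ∧ n = m.rev
    · rw [if_pos h2, if_pos h2]
      obtain ⟨-, h2⟩ := h2
      rw [← h2]; field_simp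
    · rw [if_neg h2, if_neg h2]; field_simp
  · rw [if_neg h1]
    by_cases h2 : m = j.rev ∧ n = k.rev
    · rw [if_pos h2, if_pos h2, h2.2]; ring
    · rw [if_neg h2, if_neg h2]; ring

/-- The values `(-q)^{rev a} K(u)_{rev a, b}` at an unshifted point, that is, the matrix `C K(u)`. -/
def conjVal (q : ℂ) (M : Matrix (Fin N) (Fin N) ℂ) (a b : Fin N) : ℂ :=
  (-q) ^ ((a.rev : ℕ) + 1) * M a.rev b

/-- In reversed row indices every term carries the same factor `f(x) f(y)` times two inverse powers
of `-q`; the powers of `-q` are absorbed into `C K`. Cancelling the factor gives the components. -/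
lemma matrixEq_iff {s u v : ℂ} (hs : s ≠ 0) (hu : u ≠ 0) (hv : v ≠ 0)
    (hf : fCoeff (qOf s) (u / v) ≠ 0) (hf' : fCoeff (qOf s) (qTilde N s ^ 2 * (u * v)⁻¹) ≠ 0)
    (A B : Matrix (Fin N) (Fin N) ℂ) :
    flip21 (RMatrix N (qOf s) (u / v)) * leg1 A * conjR N s (u * v) * leg2 B
        = leg2 B * flip21 (conjR N s (u * v)) * leg1 A * RMatrix N (qOf s) (u / v)
      ↔ TwistedEq (qOf s) (u / v) (qTilde N s ^ 2 * (u * v)⁻¹)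
          (conjVal (qOf s) A) (conjVal (qOf s) B) := by
  have hq : qOf s ≠ 0 := by simp [qOf, hs]
  set q := qOf s with hqd
  set x := u / v with hx
  set y := qTilde N s ^ 2 * (u * v)⁻¹ with hy
  have hx0 : x ≠ 0 := by simp [hx, hu, hv]
  have hpow : ∀ n : ℕ, (-q) ^ n ≠ 0 := fun n => pow_ne_zero _ (neg_ne_zero.mpr hq)
  have hS : ∀ i j k l : Fin N, (leg1 A * (conjR N s (u * v) * leg2 B)) (i, j) (k, l)
      = fCoeff q y * ((-q) ^ ((i : ℕ) + 1))⁻¹ * ((-q) ^ ((j : ℕ) + 1))⁻¹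
        * (wt q y j.rev k * (conjVal q A i.rev k * conjVal q B j.rev l)
          + ex q y k j.rev * (conjVal q A i.rev j.rev * conjVal q B k l)) := by
    intro i j k l
    rw [leg1_mul_apply]
    simp only [mul_leg2_apply, conjR_apply hs (mul_ne_zero hu hv), ← hqd, ← hy]
    simp only [ite_and, mul_add, add_mul, mul_ite, ite_mul, mul_zero, zero_mul,
      Finset.sum_add_distrib, Finset.sum_ite_eq', Finset.mem_univ, if_true,
      Finset.sum_ite_irrel, Finset.sum_const_zero]
    simp only [conjVal, Fin.rev_rev]
    rw [wt_comm]
    have h1 := hpow (i + 1)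
    have h2 := hpow (j + 1)
    field_simp
  have hT : ∀ i j k l : Fin N, (leg2 B * flip21 (conjR N s (u * v)) * leg1 A) (i, j) (k, l)
      = fCoeff q y * ((-q) ^ ((i : ℕ) + 1))⁻¹ * ((-q) ^ ((j : ℕ) + 1))⁻¹
        * (wt q y i.rev l * (conjVal q A i.rev k * conjVal q B j.rev l)
          + ex q y l i.rev * (conjVal q A l k * conjVal q B j.rev i.rev)) := by
    intro i j k l
    rw [mul_leg1_apply]
    simp only [leg2_mul_apply, flip21_apply, conjR_apply hs (mul_ne_zero hu hv), ← hqd, ← hy]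
    simp only [and_comm (a := _ = l), and_comm (a := _ = i.rev)]
    simp only [ite_and, mul_add, add_mul, mul_ite, ite_mul, mul_zero, zero_mul,
      Finset.sum_add_distrib, Finset.sum_ite_eq', Finset.mem_univ, if_true,
      Finset.sum_ite_irrel, Finset.sum_const_zero]
    simp only [conjVal, Fin.rev_rev]
    rw [wt_comm]
    have h1 := hpow (i + 1)
    have h2 := hpow (j + 1)
    field_simp
  have hflip : flip21 (RMatrix N q x) = fCoeff q x • sixVertex (wt q x) (fun i j => ex q x j i) := by
    ext ⟨i, j⟩ ⟨k, l⟩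
    rw [flip21_apply, RMatrix_eq q hq hx0]
    simp only [Matrix.smul_apply, sixVertex, Matrix.of_apply, Prod.mk.injEq, Prod.swap_prod_mk,
      smul_eq_mul, wt_comm q x j i, and_comm]
  have hne : ∀ i j : Fin N, fCoeff q x * (fCoeff q y * ((-q) ^ ((i : ℕ) + 1))⁻¹
      * ((-q) ^ ((j : ℕ) + 1))⁻¹) ≠ 0 := fun i j =>
    mul_ne_zero hf (mul_ne_zero (mul_ne_zero hf' (inv_ne_zero (hpow _))) (inv_ne_zero (hpow _)))
  have key : ∀ i j k l : Fin N,
      (flip21 (RMatrix N q x) * leg1 A * conjR N s (u * v) * leg2 B) (i.rev, j.rev) (k, l)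
        = (leg2 B * flip21 (conjR N s (u * v)) * leg1 A * RMatrix N q x) (i.rev, j.rev) (k, l)
      ↔ wt q x i j * (wt q y j k * (conjVal q A i k * conjVal q B j l)
            + ex q y k j * (conjVal q A i j * conjVal q B k l))
          + ex q x i j * (wt q y i k * (conjVal q A j k * conjVal q B i l)
            + ex q y k i * (conjVal q A j i * conjVal q B k l))
        = wt q x k l * (wt q y i l * (conjVal q A i k * conjVal q B j l)
            + ex q y l i * (conjVal q A l k * conjVal q B j i))
          + ex q x l k * (wt q y i k * (conjVal q A i l * conjVal q B j k)
            + ex q y k i * (conjVal q A k l * conjVal q B j i)) := by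
    intro i j k l
    rw [hflip, RMatrix_eq q hq hx0, Matrix.mul_assoc, Matrix.mul_assoc, Matrix.smul_mul,
      Matrix.mul_smul, Matrix.smul_apply, Matrix.smul_apply, sixVertex_mul_apply,
      mul_sixVertex_apply, hS, hS, hT, hT]
    refine Iff.trans ?_ (mul_right_inj' (hne i.rev j.rev))
    simp only [Fin.rev_rev, ex_rev, wt_rev, smul_eq_mul]
    constructor <;> intro h <;> linear_combination h
  constructor
  · intro h i j k l
    exact (key i j k l).mp (by rw [h])
  · intro h
    ext ⟨i, j⟩ ⟨k, l⟩
    have := (key i.rev j.rev k l).mpr (h i.rev j.rev k l)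
    simpa only [Fin.rev_rev] using this

/-- The functions `u ↦ (C K(q̃ u))_{ab}`. -/
def hfun (s : ℂ) (K : RatMatrix N) (a b : Fin N) (u : ℂ) : ℂ :=
  (-qOf s) ^ ((a.rev : ℕ) + 1) * ev (K a.rev b) (qTilde N s * u)

/-- The twisted reflection equation for a matrix of functions. -/
def TwistedSol (q : ℂ) (h : Fin N → Fin N → ℂ → ℂ) : Prop :=
  Generically fun u v =>
    TwistedEq q (u / v) (u * v)⁻¹ (fun i j => h i j u) (fun i j => h i j v)

lemma fCoeff_ne_zero {q x : ℂ} (h : q - q⁻¹ * x ≠ 0) : fCoeff q x ≠ 0 := by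
  simpa [fCoeff] using h

/-- Replacing `u`, `v` by `q̃ u`, `q̃ v` leaves `u/v` unchanged and turns `q̃²/(uv)` into `1/(uv)`.
-/
lemma solvesCtRE_iff {s : ℂ} (hs : s ≠ 0) (K : RatMatrix N) :
    SolvesCtRE s K ↔ TwistedSol (qOf s) (hfun s K) := by
  have hq : qOf s ≠ 0 := by simp [qOf, hs]
  have ht : qTilde N s ≠ 0 := by simp [qTilde, hs]
  -- Because `1 / 0 = 0`, the factor `f_q` takes the value `0` exactly at its pole. These finitely
  -- many `v` are discarded.
  have hgen : ∀ u : ℂ, u ≠ 0 → ∀ᶠ v in cofinite, v ≠ 0 ∧ fCoeff (qOf s) (u / v) ≠ 0 ∧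
      fCoeff (qOf s) (qTilde N s ^ 2 * (u * v)⁻¹) ≠ 0 := by
    intro u hu
    filter_upwards [eventually_ne 0, eventually_ne (u / qOf s ^ 2),
      eventually_ne (qTilde N s ^ 2 / (qOf s ^ 2 * u))] with v h0 h1 h2
    refine ⟨h0, fCoeff_ne_zero fun h => h1 ?_, fCoeff_ne_zero fun h => h2 ?_⟩
    · field_simp at h ⊢
      linear_combination h
    · field_simp at h ⊢
      linear_combination h
  have h1 : SolvesCtRE s K ↔ Generically fun u v =>
      TwistedEq (qOf s) (u / v) (qTilde N s ^ 2 * (u * v)⁻¹)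
        (conjVal (qOf s) (valueAt K u)) (conjVal (qOf s) (valueAt K v)) := by
    unfold SolvesCtRE Generically
    refine eventually_congr ?_
    filter_upwards [eventually_ne 0] with u hu
    refine eventually_congr ?_
    filter_upwards [hgen u hu] with v hv
    exact matrixEq_iff hs hu hv.1 hv.2.1 hv.2.2 _ _
  rw [h1]
  have h2 : ∀ u v : ℂ, TwistedEq (qOf s) (u / v) (u * v)⁻¹ (fun i j => hfun s K i j u)
      (fun i j => hfun s K i j v) ↔ TwistedEq (qOf s) ((qTilde N s * u) / (qTilde N s * v))
        (qTilde N s ^ 2 * ((qTilde N s * u) * (qTilde N s * v))⁻¹)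
        (conjVal (qOf s) (valueAt K (qTilde N s * u)))
        (conjVal (qOf s) (valueAt K (qTilde N s * v))) := by
    intro u v
    rw [mul_div_mul_left _ _ ht, show qTilde N s ^ 2 * ((qTilde N s * u) * (qTilde N s * v))⁻¹
      = (u * v)⁻¹ by rw [mul_mul_mul_comm, ← sq, mul_inv, mul_inv_cancel_left₀ (pow_ne_zero 2 ht)]]
    rfl
  unfold TwistedSol Generically
  simp only [h2]
  constructor
  · intro h
    filter_upwards [eventually_comp_mul h ht] with u hu
    exact eventually_comp_mul hu ht
  · intro h
    filter_upwards [eventually_comp_mul h (inv_ne_zero ht)] with u hu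
    filter_upwards [eventually_comp_mul hu (inv_ne_zero ht)] with v hv
    simpa only [mul_inv_cancel_left₀ ht] using hv

/-! ### Invariance of the twisted reflection equation -/


/-- A permutation that is a rotation, with `d` recording the indices that wrap around. -/
def IsRotation (σ : Equiv.Perm (Fin N)) (d : Fin N → ℕ) : Prop :=
  ∀ i j, i < j → d j = d i + if σ j < σ i then 1 else 0

/-- The exchange weight is `q - q⁻¹` times `1` or `x` according to the order of the indices, and a
rotation changes that order exactly when the wrap counts `d i`, `d j` differ. -/
lemma IsRotation.ex_mul {σ : Equiv.Perm (Fin N)} {d : Fin N → ℕ} (h : IsRotation σ d) (q x : ℂ)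
    (i j : Fin N) : ex q x (σ i) (σ j) * x ^ d i = ex q x i j * x ^ d j := by
  rcases lt_trichotomy i j with hij | rfl | hij
  · have h1 := h i j hij
    by_cases h2 : σ j < σ i
    · simp only [h1, h2, ex, hij, if_true, h2.not_gt, if_false]; ring
    · have h3 : σ i < σ j := lt_of_le_of_ne (not_lt.mp h2) (by simpa using hij.ne)
      simp [h1, h2, ex, hij, h3]
  · simp
  · have h1 := h j i hij
    by_cases h2 : σ i < σ j
    · simp only [h1, h2, ex, hij, if_true, hij.not_gt, if_false]; ring
    · have h3 : σ j < σ i := lt_of_le_of_ne (not_lt.mp h2) (by simpa using hij.ne)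
      simp [h1, h2, ex, hij, h3, hij.not_gt]

lemma IsRotation.ex_eq {σ : Equiv.Perm (Fin N)} {d : Fin N → ℕ} (h : IsRotation σ d) (q : ℂ)
    {x : ℂ} (hx : x ≠ 0) (i j : Fin N) :
    ex q x (σ i) (σ j) = ex q x i j * x ^ d j * (x ^ d i)⁻¹ := by
  rw [← h.ex_mul]
  field_simp

lemma wt_perm (σ : Equiv.Perm (Fin N)) (q x : ℂ) (i j : Fin N) :
    wt q x (σ i) (σ j) = wt q x i j := by
  simp [wt]

/-- By `IsRotation.ex_eq`, all terms of the component `(σ i, σ j, σ k, σ l)` are those of `(i, j, k,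
l)` times one and the same monomial. -/
lemma TwistedSol.dress {q : ℂ} {h h' : Fin N → Fin N → ℂ → ℂ} (hsol : TwistedSol q h)
    {σ : Equiv.Perm (Fin N)} {d : Fin N → ℕ} (hσ : IsRotation σ d) (γ : Fin N → ℂ) (g : ℂ → ℂ)
    (hh : ∀ᶠ u in cofinite, ∀ i j,
      h' (σ i) (σ j) u = g u * (γ i * γ j * (u ^ d j * (u ^ d i)⁻¹)) * h i j u) :
    TwistedSol q h' := by
  unfold TwistedSol Generically at *
  filter_upwards [hsol, hh, eventually_ne 0] with u hu hu' hu0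
  filter_upwards [hu, hh, eventually_ne 0] with v hv hv' hv0
  intro i j k l
  obtain ⟨i, rfl⟩ := σ.surjective i
  obtain ⟨j, rfl⟩ := σ.surjective j
  obtain ⟨k, rfl⟩ := σ.surjective k
  obtain ⟨l, rfl⟩ := σ.surjective l
  have hx0 : u / v ≠ 0 := div_ne_zero hu0 hv0
  have hy0 : (u * v)⁻¹ ≠ 0 := inv_ne_zero (mul_ne_zero hu0 hv0)
  have key := hv i j k l
  simp only [wt_perm, hσ.ex_eq q hx0, hσ.ex_eq q hy0, hu', hv']
  generalize ex q (u / v) i j = e1 at *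
  generalize ex q (u / v) l k = e2 at *
  generalize ex q (u * v)⁻¹ k j = e3 at *
  generalize ex q (u * v)⁻¹ k i = e4 at *
  generalize ex q (u * v)⁻¹ l i = e5 at *
  simp only [div_pow, inv_pow, mul_pow]
  have hU : ∀ m, u ^ d m ≠ 0 := fun m => pow_ne_zero _ hu0
  have hV : ∀ m, v ^ d m ≠ 0 := fun m => pow_ne_zero _ hv0
  have hUi := hU i; have hUj := hU j; have hUk := hU k; have hUl := hU l
  have hVi := hV i; have hVj := hV j; have hVk := hV k; have hVl := hV l
  generalize u ^ d i = Ui at *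
  generalize u ^ d j = Uj at *
  generalize u ^ d k = Uk at *
  generalize u ^ d l = Ul at *
  generalize v ^ d i = Vi at *
  generalize v ^ d j = Vj at *
  generalize v ^ d k = Vk at *
  generalize v ^ d l = Vl at *
  have key2 := congrArg (fun z => g u * g v * (γ i * γ j * γ k * γ l) * (Uk * Vl / (Ui * Vj)) * z) key
  simp only at key2
  convert key2 using 1
  · field_simp
  · field_simp

lemma wt_inv (q : ℂ) {x : ℂ} (hx : x ≠ 0) (i j : Fin N) :
    wt q⁻¹ x⁻¹ i j = -x⁻¹ * wt q x i j := by
  simp only [wt, inv_inv]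
  split_ifs <;> field_simp <;> ring

lemma ex_inv (q : ℂ) {x : ℂ} (hx : x ≠ 0) (i j : Fin N) :
    ex q⁻¹ x⁻¹ i j = -x⁻¹ * ex q x j i := by
  simp only [ex, inv_inv]
  rcases lt_trichotomy i j with h | rfl | h
  · simp [h, h.not_gt]; field_simp; ring
  · simp
  · simp [h, h.not_gt]; field_simp; ring

/-- The weights at `(q⁻¹, x⁻¹)` are those at `(q, x)` times `-x⁻¹`, with the exchange indices
swapped. Hence the component `(i, j, k, l)` of the transposed solution is the component `(k, l, i,
j)` of the original one, with its sides interchanged. -/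
lemma TwistedSol.invert {q : ℂ} {h h' : Fin N → Fin N → ℂ → ℂ} (hsol : TwistedSol q h)
    (γ : Fin N → ℂ) (hh : ∀ᶠ u in cofinite, ∀ i j, h' i j u = γ i * γ j * h j i u⁻¹) :
    TwistedSol q⁻¹ h' := by
  unfold TwistedSol Generically at *
  filter_upwards [eventually_comp_inv hsol, hh, eventually_ne 0] with u hu hu' hu0
  filter_upwards [eventually_comp_inv hu, hh, eventually_ne 0] with v hv hv' hv0
  intro i j k l
  have hx0 : u⁻¹ / v⁻¹ ≠ 0 := div_ne_zero (inv_ne_zero hu0) (inv_ne_zero hv0)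
  have hy0 : (u⁻¹ * v⁻¹)⁻¹ ≠ 0 :=
    inv_ne_zero (mul_ne_zero (inv_ne_zero hu0) (inv_ne_zero hv0))
  have key := hv k l i j
  simp only [show u / v = (u⁻¹ / v⁻¹)⁻¹ by field_simp,
    show (u * v)⁻¹ = ((u⁻¹ * v⁻¹)⁻¹)⁻¹ by field_simp, wt_inv q hx0, wt_inv q hy0, ex_inv q hx0,
    ex_inv q hy0, hu', hv']
  simp only [wt_comm _ _ l i, wt_comm _ _ k j, wt_comm _ _ k i] at key
  linear_combination -((u⁻¹ / v⁻¹)⁻¹ * ((u⁻¹ * v⁻¹)⁻¹)⁻¹ * (γ i * γ j * γ k * γ l)) * key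

lemma TwistedSol.comp_neg {q : ℂ} {h h' : Fin N → Fin N → ℂ → ℂ} (hsol : TwistedSol q h)
    (hh : ∀ᶠ u in cofinite, ∀ i j, h' i j u = h i j (-u)) : TwistedSol q h' := by
  have hneg : ∀ {P : ℂ → Prop}, (∀ᶠ u in cofinite, P u) → ∀ᶠ u in cofinite, P (-u) := fun h =>
    (neg_injective (G := ℂ)).tendsto_cofinite.eventually h
  unfold TwistedSol Generically at *
  filter_upwards [hneg hsol, hh] with u hu hu'
  filter_upwards [hneg hu, hh] with v hv hv'
  simpa only [neg_div_neg_eq, neg_mul_neg, hu', hv'] using hv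

/-! ### Symmetries of the R-matrix -/

open Polynomial in
lemma quartic_coeffs_zero {a b c d e : ℂ}
    (h : ∀ᶠ v in cofinite, a + b * v + c * v ^ 2 + d * v ^ 3 + e * v ^ 4 = 0) :
    a = 0 ∧ b = 0 ∧ c = 0 ∧ d = 0 ∧ e = 0 := by
  set p : ℂ[X] := C a + C b * X + C c * X ^ 2 + C d * X ^ 3 + C e * X ^ 4 with hp
  have h0 : p = 0 := by
    by_contra hne
    have : ∀ᶠ u in (cofinite : Filter ℂ), False := by
      filter_upwards [h, eventually_eval_ne_zero hne] with v h1 h2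
      exact h2 (by simpa [hp] using h1)
    exact this.exists.choose_spec
  have hc : ∀ n, p.coeff n = 0 := by simp [h0]
  refine ⟨?_, ?_, ?_, ?_, ?_⟩
  · simpa [hp, coeff_X, coeff_C, coeff_X_pow] using hc 0
  · simpa [hp, coeff_X, coeff_C, coeff_X_pow] using hc 1
  · simpa [hp, coeff_X, coeff_C, coeff_X_pow] using hc 2
  · simpa [hp, coeff_X, coeff_C, coeff_X_pow] using hc 3
  · simpa [hp, coeff_X, coeff_C, coeff_X_pow] using hc 4

lemma linear_coeffs_zero {a b : ℂ} (h : ∀ᶠ v in cofinite, a + b * v = 0) : a = 0 ∧ b = 0 := by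
  have := quartic_coeffs_zero (a := a) (b := b) (c := 0) (d := 0) (e := 0) (by simpa using h)
  exact ⟨this.1, this.2.1⟩

/-- Two entries of one row cannot both be nonzero if they are interchanged by the exchange
terms. -/
lemma not_both_ne_zero {q : ℂ} (hq : q ≠ 0) (hq1 : q ≠ 1) {f g : ℂ → ℂ} {k l : Fin N}
    (hkl : k ≠ l) (hf : ∀ᶠ u in cofinite, f u ≠ 0) (hg : ∀ᶠ u in cofinite, g u ≠ 0)
    (h : ∀ᶠ u in cofinite, ∀ᶠ v in cofinite,
      ((q - q⁻¹ * (u / v)) - (1 - u / v)) * (f u * g v) = ex q (u / v) l k * (g u * f v)) :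
    False := by
  -- After division by `q - 1` the relation is `(q v + u) f(u) g(v) = (q + 1) w g(u) f(v)`, where
  -- `w` is `u` if `k < l` and `v` if `l < k`. Thus `f/g` would vanish at `v = -u/q`, a point that
  -- moves with `u`. Two values of `u` make this precise after elimination of `f(v)`.
  have h' := (h.and (hf.and (hg.and (eventually_ne 0))))
  obtain ⟨u₀, h₀, f₀, g₀, n₀⟩ := h'.exists
  obtain ⟨u₁, ⟨h₁, f₁, g₁, n₁⟩, hne⟩ := (h'.and (eventually_ne u₀)).exists
  have hq1' : q - 1 ≠ 0 := sub_ne_zero.mpr hq1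
  rcases lt_or_gt_of_ne hkl with hlt | hlt
  · have : ∀ᶠ v in cofinite, (u₀ * (f u₀ * (u₁ * g u₁)) - u₁ * (f u₁ * (u₀ * g u₀)))
        + q * (f u₀ * (u₁ * g u₁) - f u₁ * (u₀ * g u₀)) * v = 0 := by
      filter_upwards [h₀, h₁, hg, eventually_ne 0] with v e₀ e₁ gv hv
      simp only [ex, hlt, hlt.not_gt, if_true, if_false] at e₀ e₁
      have : (q - 1) * g v ≠ 0 := mul_ne_zero hq1' gv
      refine (mul_right_inj' this).mp ?_
      field_simp at e₀ e₁
      linear_combination u₁ * g u₁ * e₀ - u₀ * g u₀ * e₁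
    obtain ⟨h1, h2⟩ := linear_coeffs_zero this
    have h3 : f u₀ * (u₁ * g u₁) - f u₁ * (u₀ * g u₀) = 0 := by simpa [hq] using h2
    have h4 : (u₀ - u₁) * (f u₀ * (u₁ * g u₁)) = 0 := by linear_combination h1 - u₁ * h3
    simp [sub_eq_zero, hne.symm, f₀, n₁, g₁] at h4
  · have : ∀ᶠ v in cofinite, (u₀ * (f u₀ * g u₁) - u₁ * (f u₁ * g u₀))
        + q * (f u₀ * g u₁ - f u₁ * g u₀) * v = 0 := by
      filter_upwards [h₀, h₁, hg, eventually_ne 0] with v e₀ e₁ gv hv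
      simp only [ex, hlt, if_true] at e₀ e₁
      have : (q - 1) * g v ≠ 0 := mul_ne_zero hq1' gv
      refine (mul_right_inj' this).mp ?_
      field_simp at e₀ e₁
      linear_combination g u₁ * e₀ - g u₀ * e₁
    obtain ⟨h1, h2⟩ := linear_coeffs_zero this
    have h3 : f u₀ * g u₁ - f u₁ * g u₀ = 0 := by simpa [hq] using h2
    have h4 : (u₀ - u₁) * (f u₀ * g u₁) = 0 := by linear_combination h1 - u₁ * h3
    simp [sub_eq_zero, hne.symm, f₀, g₁] at h4

lemma sub_le_of_strictMono {f : Fin N → ℤ} (hf : StrictMono f) {i j : Fin N} (hij : i ≤ j) :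
    ((j : ℕ) : ℤ) - (i : ℕ) ≤ f j - f i := by
  obtain ⟨i, hi⟩ := i
  obtain ⟨j, hj⟩ := j
  simp only [Fin.mk_le_mk] at hij
  obtain ⟨k, rfl⟩ := Nat.exists_eq_add_of_le hij
  clear hij
  induction k with
  | zero => simp
  | succ k ih =>
    have h1 := ih (by omega)
    have h2 : f ⟨i + k, by omega⟩ < f ⟨i + (k + 1), hj⟩ := hf (by simp [Fin.lt_def])
    push_cast at h1 ⊢
    linarith

/-- The integers `σ i + N * d i` increase strictly with `i` and spread over at most `N - 1`, so they
are consecutive. -/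
lemma IsRotation.val_eq (hN : 0 < N) {σ : Equiv.Perm (Fin N)} {d : Fin N → ℕ}
    (h : IsRotation σ d) :
    ∃ c : ℤ, ∀ i : Fin N, ((i : ℕ) : ℤ) = c + ((σ i : ℕ) : ℤ) + N * d i := by
  set τ : Fin N → ℤ := fun i => ((σ i : ℕ) : ℤ) + N * d i with hτ
  have hmono : StrictMono τ := by
    intro i j hij
    have h1 := h i j hij
    have h2 := (σ i).isLt
    by_cases h3 : σ j < σ i
    · simp only [hτ, h1, h3, if_true]; push_cast; nlinarith
    · have h4 : σ i < σ j := lt_of_le_of_ne (not_lt.mp h3) (by simpa using hij.ne)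
      simp only [hτ, h1, h3, if_false]
      have : (σ i : ℕ) < σ j := h4
      push_cast; linarith
  let a : Fin N := ⟨0, hN⟩
  let b : Fin N := ⟨N - 1, by omega⟩
  have hspread : τ b - τ a ≤ (N : ℤ) - 1 := by
    have h2 := (σ b).isLt
    rcases (show a ≤ b from Nat.zero_le _).eq_or_lt with hab | hab
    · rw [← hab]; simp; omega
    · have h1 := h a b hab
      by_cases h3 : σ b < σ a
      · simp only [hτ, h1, h3, if_true]
        have : (σ b : ℕ) < σ a := h3
        push_cast; linarith
      · simp only [hτ, h1, h3, if_false, add_zero]; omega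
  refine ⟨-τ a, fun i => ?_⟩
  have h1 := sub_le_of_strictMono hmono (show a ≤ i from Nat.zero_le _)
  have h2 := sub_le_of_strictMono hmono (show i ≤ b from Fin.le_def.mpr (Nat.le_sub_one_of_lt i.isLt))
  have h3 : ((b : ℕ) : ℤ) = N - 1 := by simp only [b]; omega
  have h4 : ((a : ℕ) : ℤ) = 0 := by simp [a]
  have h5 : τ i = ((σ i : ℕ) : ℤ) + N * d i := rfl
  linarith

lemma isSymmetry_iff {q : ℂ} (hq : q ≠ 0) (Z : RatMatrix N) :
    IsSymmetry q Z ↔ Z.det ≠ 0 ∧ ∀ᶠ u in cofinite, ∀ᶠ v in cofinite, ∀ i j k l,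
      wt q (u / v) i j * (ev (Z i k) u * ev (Z j l) v)
          + ex q (u / v) i j * (ev (Z j k) u * ev (Z i l) v)
        = wt q (u / v) k l * (ev (Z i k) u * ev (Z j l) v)
          + ex q (u / v) l k * (ev (Z i l) u * ev (Z j k) v) := by
  refine and_congr_right fun _ => ?_
  unfold Generically
  refine eventually_congr ?_
  filter_upwards [eventually_ne 0] with u hu
  refine eventually_congr ?_
  filter_upwards [eventually_ne 0, eventually_ne (u / q ^ 2)] with v hv hv'
  have hx : u / v ≠ 0 := div_ne_zero hu hv
  have hf : fCoeff q (u / v) ≠ 0 := fCoeff_ne_zero fun h => hv' (by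
    field_simp at h ⊢
    linear_combination h)
  rw [RMatrix_eq q hq hx, Matrix.smul_mul, Matrix.mul_smul, (smul_right_injective _ hf).eq_iff]
  constructor
  · intro h i j k l
    have := congrFun (congrFun h (i, j)) (k, l)
    rw [sixVertex_mul_apply, mul_sixVertex_apply] at this
    simp only [Matrix.kroneckerMap_apply, valueAt, Matrix.map_apply] at this
    linear_combination this
  · intro h
    ext ⟨i, j⟩ ⟨k, l⟩
    rw [sixVertex_mul_apply, mul_sixVertex_apply]
    simp only [Matrix.kroneckerMap_apply, valueAt, Matrix.map_apply]
    linear_combination h i j k l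

lemma exists_ne_zero_of_det_ne_zero {Z : RatMatrix N} (h : Z.det ≠ 0) (i : Fin N) :
    ∃ j, Z i j ≠ 0 := by
  by_contra! hc
  exact h (Matrix.det_eq_zero_of_row_eq_zero i hc)

lemma pow_eq_const_mul_pow {a b : ℂ} (ha : a ≠ 0) {m n : ℕ}
    (h : ∀ᶠ u in (cofinite : Filter ℂ), a * u ^ m = b * u ^ n) : m = n := by
  have h1 : (Polynomial.C a * Polynomial.X ^ m : Polynomial ℂ)
      = Polynomial.C b * Polynomial.X ^ n := by
    by_contra hne
    have : ∀ᶠ u in (cofinite : Filter ℂ), False := by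
      filter_upwards [h, eventually_eval_ne_zero (sub_ne_zero.mpr hne)] with u h1 h2
      exact h2 (by simp [h1])
    exact this.exists.choose_spec
  have h2 := congrArg (fun p => Polynomial.coeff p m) h1
  simp only [Polynomial.coeff_C_mul_X_pow, if_true] at h2
  by_contra hmn
  rw [if_neg hmn] at h2
  exact ha h2

/-- A symmetry of the R-matrix is a rotation up to a diagonal matrix. -/
lemma IsSymmetry.exists_rotation {q : ℂ} (hq : q ≠ 0) (hq1 : q ^ 2 ≠ 1) (hN : 0 < N)
    {Z : RatMatrix N} (hZ : IsSymmetry q Z) :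
    ∃ (σ : Equiv.Perm (Fin N)) (d : Fin N → ℕ) (c : Fin N → ℂ) (g : ℂ → ℂ), IsRotation σ d ∧
      ∀ᶠ u in cofinite, ∀ i j, ev (Z i j) u = if j = σ i then c i * u ^ d i * g u else 0 := by
  obtain ⟨hdet, hcomm⟩ := (isSymmetry_iff hq Z).mp hZ
  have hq1' : q ≠ 1 := fun h => hq1 (by simp [h])
  have huniq : ∀ i k l, Z i k ≠ 0 → Z i l ≠ 0 → k = l := by
    intro i k l hk hl
    by_contra hkl
    refine not_both_ne_zero hq hq1' hkl (ev_ne_zero hk) (ev_ne_zero hl) ?_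
    filter_upwards [hcomm] with u hu
    filter_upwards [hu] with v hv
    have := hv i i k l
    simp only [ex_self, wt, hkl, if_false, if_true] at this
    linear_combination this
  choose f hf using exists_ne_zero_of_det_ne_zero hdet
  have hfsurj : Function.Surjective f := by
    intro j
    have hdet' : Z.transpose.det ≠ 0 := by rwa [Matrix.det_transpose]
    obtain ⟨i, hi⟩ := exists_ne_zero_of_det_ne_zero hdet' j
    exact ⟨i, huniq i _ _ (hf i) hi⟩
  let σ : Equiv.Perm (Fin N) := Equiv.ofBijective f (Finite.surjective_iff_bijective.mp hfsurj)
  have hσ : ∀ i, Z i (σ i) ≠ 0 := hf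
  have hZ0 : ∀ i j, j ≠ σ i → Z i j = 0 := fun i j hj => by
    by_contra h
    exact hj (huniq i _ _ h (hσ i))
  let z : Fin N → ℂ → ℂ := fun i => ev (Z i (σ i))
  have hz : ∀ i, ∀ᶠ u in cofinite, z i u ≠ 0 := fun i => ev_ne_zero (hσ i)
  have hκ : q - q⁻¹ ≠ 0 := by
    intro h
    apply hq1
    field_simp at h
    linear_combination h
  -- the ratio of two entries is a constant or a constant times `u`
  have hratio : ∀ i j, i < j → ∃ c : ℂ, c ≠ 0 ∧
      ∀ᶠ u in cofinite, z j u = c * u ^ (if σ j < σ i then 1 else 0) * z i u := by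
    intro i j hij
    have hcm : ∀ᶠ u in cofinite, ∀ᶠ v in cofinite,
        ex q (u / v) i j * (z j u * z i v) = ex q (u / v) (σ i) (σ j) * (z i u * z j v) := by
      filter_upwards [hcomm] with u hu
      filter_upwards [hu] with v hv
      have := hv i j (σ j) (σ i)
      simpa [hZ0 i (σ j) (by simpa using hij.ne'), hZ0 j (σ i) (by simpa using hij.ne), ev] using this
    obtain ⟨u₀, h₀, hi, hj, n₀⟩ := (hcm.and ((hz i).and ((hz j).and (eventually_ne 0)))).exists
    by_cases h3 : σ j < σ i
    · refine ⟨z j u₀ / z i u₀ / u₀, by simp [hi, hj, n₀], ?_⟩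
      filter_upwards [h₀, eventually_ne 0] with v hv hv0
      simp only [ex, hij, h3, h3.not_gt, if_true, if_false] at hv
      have hv' : z j u₀ * z i v = u₀ / v * (z i u₀ * z j v) :=
        mul_left_cancel₀ hκ (by linear_combination hv)
      simp only [h3, if_true]
      field_simp at hv' ⊢
      linear_combination -hv'
    · have h4 : σ i < σ j := lt_of_le_of_ne (not_lt.mp h3) (by simpa using hij.ne)
      refine ⟨z j u₀ / z i u₀, by simp [hi, hj], ?_⟩
      filter_upwards [h₀] with v hv
      simp only [ex, hij, h4, if_true] at hv
      have hv' : z j u₀ * z i v = z i u₀ * z j v := mul_left_cancel₀ hκ hv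
      simp only [h3, if_false]
      field_simp
      linear_combination -hv'
  let a : Fin N := ⟨0, hN⟩
  -- Exponents are measured from the first row, so they are `0` or `1`. Comparing the exponent of `z
  -- j` obtained through row `i` with the one obtained directly from the first row yields the
  -- rotation identity.
  let d : Fin N → ℕ := fun j => if σ j < σ a then 1 else 0
  have hbase : ∀ j, ∃ c : ℂ, c ≠ 0 ∧ ∀ᶠ u in cofinite, z j u = c * u ^ d j * z a u := by
    intro j
    rcases (show a ≤ j from Nat.zero_le _).eq_or_lt with rfl | h
    · exact ⟨1, one_ne_zero, by simp [d]⟩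
    · exact hratio a j h
  choose c hc hzc using hbase
  refine ⟨σ, d, c, z a, ?_, ?_⟩
  · intro i j hij
    obtain ⟨c', hc', hr⟩ := hratio i j hij
    refine pow_eq_const_mul_pow (a := c j) (b := c' * c i) (hc j) ?_
    filter_upwards [hr, hzc i, hzc j, hz a] with u h1 h2 h3 h4
    rw [h2, h3] at h1
    apply mul_right_cancel₀ h4
    rw [h1]; ring
  · filter_upwards [eventually_all.mpr hzc] with u hu i j
    split_ifs with h
    · rw [h]; exact hu i
    · rw [hZ0 i j h]; simp [ev]

/-- The matrix of a rotation dressed by a diagonal matrix. -/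
def rotationMatrix (σ : Equiv.Perm (Fin N)) (d : Fin N → ℕ) (c : Fin N → ℂ) : RatMatrix N :=
  Matrix.of fun i j => if j = σ i then RatFunc.C (c i) * RatFunc.X ^ d i else 0

lemma ev_rotationMatrix (σ : Equiv.Perm (Fin N)) (d : Fin N → ℕ) (c : Fin N → ℂ) :
    ∀ᶠ u in cofinite, ∀ i j, ev (rotationMatrix σ d c i j) u
      = if j = σ i then c i * u ^ d i else 0 := by
  refine eventually_all.mpr fun i => eventually_all.mpr fun j => ?_
  simp only [rotationMatrix, Matrix.of_apply]
  split_ifs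
  · filter_upwards [ev_mul (RatFunc.C (c i)) (RatFunc.X ^ d i), ev_pow RatFunc.X (d i)]
      with u h1 h2
    rw [h1, h2]; simp [ev]
  · simp [ev]

lemma IsRotation.isSymmetry {q : ℂ} (hq : q ≠ 0) {σ : Equiv.Perm (Fin N)} {d : Fin N → ℕ}
    (h : IsRotation σ d) {c : Fin N → ℂ} (hc : ∀ i, c i ≠ 0) :
    IsSymmetry q (rotationMatrix σ d c) := by
  rw [isSymmetry_iff hq]
  constructor
  · let W : RatMatrix N := Matrix.of fun i j =>
      if i = σ j then (RatFunc.C (c j) * RatFunc.X ^ d j)⁻¹ else 0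
    apply Matrix.det_ne_zero_of_right_inverse (B := W)
    ext i j
    have hne : RatFunc.C (c i) * RatFunc.X ^ d i ≠ 0 :=
      mul_ne_zero (by simpa using hc i) (pow_ne_zero _ RatFunc.X_ne_zero)
    simp only [Matrix.mul_apply, rotationMatrix, W, Matrix.of_apply, ite_mul, zero_mul,
      Finset.sum_ite_eq', Finset.mem_univ, if_true, EmbeddingLike.apply_eq_iff_eq,
      Matrix.one_apply]
    split_ifs with hij
    · subst hij; exact mul_inv_cancel₀ hne
    · simp
  · have hev := ev_rotationMatrix σ d c
    filter_upwards [hev, eventually_ne 0] with u hu hu0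
    filter_upwards [hev, eventually_ne 0] with v hv hv0 i j k l
    have hx : u / v ≠ 0 := div_ne_zero hu0 hv0
    simp only [hu, hv]
    have e1 : wt q (u / v) i j * ((if k = σ i then c i * u ^ d i else 0)
        * if l = σ j then c j * v ^ d j else 0)
        = wt q (u / v) k l * ((if k = σ i then c i * u ^ d i else 0)
        * if l = σ j then c j * v ^ d j else 0) := by
      by_cases h1 : k = σ i
      · by_cases h2 : l = σ j
        · rw [h1, h2, wt_perm]
        · simp [h2]
      · simp [h1]
    have e2 : ex q (u / v) i j * ((if k = σ j then c j * u ^ d j else 0)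
        * if l = σ i then c i * v ^ d i else 0)
        = ex q (u / v) l k * ((if l = σ i then c i * u ^ d i else 0)
        * if k = σ j then c j * v ^ d j else 0) := by
      by_cases h1 : l = σ i
      · by_cases h2 : k = σ j
        · rw [h1, h2, h.ex_eq q hx]
          simp only [if_true, div_pow]
          field_simp
        · simp [h2]
      · simp [h1]
    rw [e1, e2]

/-! ### The transformations preserve solutions -/


lemma qTilde_ne_zero {s : ℂ} (hs : s ≠ 0) : qTilde N s ≠ 0 := pow_ne_zero _ hs

lemma qOf_ne_zero {s : ℂ} (hs : s ≠ 0) : qOf s ≠ 0 := by simp [qOf, hs]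

lemma qOf_inv (s : ℂ) : qOf s⁻¹ = (qOf s)⁻¹ := by simp [qOf, inv_neg]

lemma ev_C_mul_X (c : ℂ) : ∀ᶠ u in cofinite, ev (RatFunc.C c * RatFunc.X) u = c * u := by
  filter_upwards [ev_mul (RatFunc.C c) RatFunc.X] with u hu
  rw [hu]; simp [ev]

lemma ev_C_mul_X_inv (c : ℂ) : ∀ᶠ u in cofinite, ev (RatFunc.C c * RatFunc.X⁻¹) u = c * u⁻¹ := by
  filter_upwards [ev_mul (RatFunc.C c) RatFunc.X⁻¹, ev_inv RatFunc.X] with u hu hu'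
  rw [hu, hu']; simp [ev]

lemma ev_X_inv : ∀ᶠ u in cofinite, ev (RatFunc.X⁻¹ : RatFunc ℂ) u = u⁻¹ := by
  filter_upwards [ev_inv RatFunc.X] with u hu
  rw [hu]; simp [ev]

lemma ev_substitute {x : RatFunc ℂ} {f : ℂ → ℂ} (hx : ∀ᶠ u in cofinite, ev x u = f u)
    (K : RatMatrix N) :
    ∀ᶠ u in cofinite, ∀ i j, ev (substitute x K i j) u = ev (K i j) (f u) := by
  refine eventually_all.mpr fun i => eventually_all.mpr fun j => ?_
  filter_upwards [ev_comp x (K i j), hx] with u h1 h2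
  rw [← h2, ← h1]; rfl

lemma SolvesCtRE.negate {s : ℂ} (hs : s ≠ 0) {K : RatMatrix N} (h : SolvesCtRE s K) :
    SolvesCtRE s (substitute (-RatFunc.X) K) := by
  rw [solvesCtRE_iff hs] at h ⊢
  refine h.comp_neg ?_
  have hx : ∀ᶠ u in cofinite, ev (-RatFunc.X : RatFunc ℂ) u = -u := by
    filter_upwards [ev_neg RatFunc.X] with u hu
    rw [hu]; simp [ev]
  filter_upwards [eventually_comp_mul (ev_substitute hx K) (qTilde_ne_zero (N := N) hs)] with u hu i j
  rw [hfun, hfun, hu, mul_neg]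

lemma isRotation_one : IsRotation (1 : Equiv.Perm (Fin N)) 0 := by
  intro i j hij
  simp [hij.not_gt]

lemma TwistedSol.gauge {q : ℂ} {h h' : Fin N → Fin N → ℂ → ℂ} (hsol : TwistedSol q h)
    (γ : Fin N → ℂ) (g : ℂ → ℂ)
    (hh : ∀ᶠ u in cofinite, ∀ i j, h' i j u = g u * (γ i * γ j) * h i j u) :
    TwistedSol q h' := by
  refine hsol.dress isRotation_one γ g ?_
  simpa using hh

lemma SolvesCtRE.scale {s : ℂ} (hs : s ≠ 0) {K : RatMatrix N} (h : SolvesCtRE s K)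
    (g : RatFunc ℂ) : SolvesCtRE s (g • K) := by
  rw [solvesCtRE_iff hs] at h ⊢
  refine h.gauge 1 (fun u => ev g (qTilde N s * u)) ?_
  have : ∀ᶠ u in cofinite, ∀ i j, ev ((g • K) i j) u = ev g u * ev (K i j) u :=
    eventually_all.mpr fun i => eventually_all.mpr fun j => ev_mul _ _
  filter_upwards [eventually_comp_mul this (qTilde_ne_zero (N := N) hs)] with u hu i j
  simp only [hfun, hu, Pi.one_apply]
  ring

lemma SolvesCtRE.invert {s : ℂ} (hs : s ≠ 0) {K : RatMatrix N} (h : SolvesCtRE s K) :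
    SolvesCtRE s⁻¹ (antiTranspose (substitute RatFunc.X⁻¹ K)) := by
  rw [solvesCtRE_iff hs] at h
  rw [solvesCtRE_iff (inv_ne_zero hs), qOf_inv]
  refine h.invert (fun a => ((-qOf s) ^ ((a.rev : ℕ) + 1))⁻¹) ?_
  have hp : ∀ n : ℕ, (-qOf s) ^ n ≠ 0 := fun n => pow_ne_zero _ (neg_ne_zero.mpr (qOf_ne_zero hs))
  filter_upwards [eventually_comp_mul (ev_substitute ev_X_inv K)
    (qTilde_ne_zero (N := N) (inv_ne_zero hs))] with u hu i j
  have ht : (qTilde N s⁻¹ * u)⁻¹ = qTilde N s * u⁻¹ := by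
    simp [qTilde, mul_comm]
  simp only [hfun, antiTranspose, Matrix.of_apply, hu, Fin.rev_rev, ht, qOf_inv]
  have h1 := hp ((i.rev : ℕ) + 1)
  have h2 := hp ((j.rev : ℕ) + 1)
  rw [← inv_neg, inv_pow]
  field_simp

lemma ev_matrix_mul (A B : RatMatrix N) :
    ∀ᶠ u in cofinite, ∀ i j, ev ((A * B) i j) u = ∑ m, ev (A i m) u * ev (B m j) u := by
  refine eventually_all.mpr fun i => eventually_all.mpr fun j => ?_
  have : ∀ᶠ u in cofinite, ∀ m, ev (A i m * B m j) u = ev (A i m) u * ev (B m j) u :=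
    eventually_all.mpr fun m => ev_mul _ _
  filter_upwards [ev_sum Finset.univ fun m => A i m * B m j, this] with u h1 h2
  rw [Matrix.mul_apply, h1]
  simp [h2]

/-- Compatibility of `C` with rotations: by `IsRotation.val_eq` a wrap changes the exponent of `-q`
by `N`, and `(-q)^N = q̃²`. -/
lemma IsRotation.neg_qOf_pow_rev (hN : 0 < N) {σ : Equiv.Perm (Fin N)} {d : Fin N → ℕ}
    (hσ : IsRotation σ d) {s : ℂ} (hs : s ≠ 0) : ∃ e : ℤ, ∀ i, (-qOf s) ^ (((σ i).rev : ℕ) + 1)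
      = (-qOf s) ^ e * (qTilde N s ^ 2) ^ d i * (-qOf s) ^ ((i.rev : ℕ) + 1) := by
  obtain ⟨e, he⟩ := hσ.val_eq hN
  refine ⟨e, fun i => ?_⟩
  have hnq : -qOf s ≠ 0 := neg_ne_zero.mpr (qOf_ne_zero hs)
  have ht2 : qTilde N s ^ 2 = (-qOf s) ^ N := by
    simp [qTilde, qOf, ← pow_mul, mul_comm]
  rw [ht2, ← pow_mul, ← zpow_natCast, ← zpow_natCast, ← zpow_natCast, ← zpow_add₀ hnq,
    ← zpow_add₀ hnq]
  congr 1
  have h1 := he i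
  have h2 := i.isLt
  have h3 := (σ i).isLt
  simp only [Fin.val_rev]
  push_cast [Nat.cast_sub (show (σ i : ℕ) + 1 ≤ N from h3),
    Nat.cast_sub (show (i : ℕ) + 1 ≤ N from h2)]
  linarith

lemma ev_dress {Z : RatMatrix N} {σ : Equiv.Perm (Fin N)} {d : Fin N → ℕ} {c : Fin N → ℂ}
    {g : ℂ → ℂ} (hZ : ∀ᶠ u in cofinite, ∀ i j,
      ev (Z i j) u = if j = σ i then c i * u ^ d i * g u else 0)
    (K : RatMatrix N) {η : ℂ} (hη : η ≠ 0) : ∀ᶠ u in cofinite, ∀ i j,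
      ev ((antiTranspose (substitute (RatFunc.C η * RatFunc.X⁻¹) Z) * K
        * substitute (RatFunc.C η * RatFunc.X) Z) (σ i).rev (σ j)) u
      = c i * (η * u⁻¹) ^ d i * g (η * u⁻¹) * ev (K i.rev j) u
        * (c j * (η * u) ^ d j * g (η * u)) := by
  set Z₁ := antiTranspose (substitute (RatFunc.C η * RatFunc.X⁻¹) Z)
  set Z₂ := substitute (RatFunc.C η * RatFunc.X) Z
  have hZ₁ : ∀ᶠ u in cofinite, ∀ i j, ev (Z₁ (σ i).rev j) u
      = if j = i.rev then c i * (η * u⁻¹) ^ d i * g (η * u⁻¹) else 0 := by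
    filter_upwards [ev_substitute (ev_C_mul_X_inv η) Z,
      eventually_comp_inv (eventually_comp_mul hZ hη)] with u h1 h2 i j
    simp only [Z₁, antiTranspose, Matrix.of_apply, h1, h2, Fin.rev_rev]
    by_cases hij : j = i.rev
    · simp [hij]
    · rw [if_neg hij, if_neg]
      intro h
      exact hij (by rw [σ.injective h, Fin.rev_rev])
  have hZ₂ : ∀ᶠ u in cofinite, ∀ i j, ev (Z₂ i (σ j)) u
      = if i = j then c j * (η * u) ^ d j * g (η * u) else 0 := by
    filter_upwards [ev_substitute (ev_C_mul_X η) Z, eventually_comp_mul hZ hη] with u h1 h2 i j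
    simp only [Z₂, h1, h2, EmbeddingLike.apply_eq_iff_eq]
    by_cases hij : i = j
    · simp [hij]
    · rw [if_neg hij, if_neg (Ne.symm hij)]
  filter_upwards [hZ₁, hZ₂, ev_matrix_mul (Z₁ * K) Z₂, ev_matrix_mul Z₁ K] with u h1 h2 h3 h4 i j
  rw [h3]
  simp only [h4, h1, h2, ite_mul, zero_mul, mul_ite, mul_zero, Finset.sum_ite_eq',
    Finset.mem_univ, if_true]

/-- The factor `q̃^{2 d i}` coming from `C`, together with `q̃^{d j - d i}` from rescaling the
variable, is `q̃^{d i} q̃^{d j}`. So it is a symmetric gauge factor, as `TwistedSol.dress` requires.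
-/
lemma SolvesCtRE.dress {s : ℂ} (hs : s ≠ 0) (hq : qOf s ^ 2 ≠ 1) (hN : 0 < N) {K : RatMatrix N}
    (h : SolvesCtRE s K) {η : ℂ} (hη : η ≠ 0) {Z : RatMatrix N} (hZ : IsSymmetry (qOf s) Z) :
    SolvesCtRE s (antiTranspose (substitute (RatFunc.C η * RatFunc.X⁻¹) Z) * K
      * substitute (RatFunc.C η * RatFunc.X) Z) := by
  obtain ⟨σ, d, c, g, hσ, hZe⟩ := hZ.exists_rotation (qOf_ne_zero hs) hq hN
  rw [solvesCtRE_iff hs] at h ⊢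
  obtain ⟨e, hrev⟩ := hσ.neg_qOf_pow_rev hN hs
  have ht := qTilde_ne_zero (N := N) hs
  refine h.dress hσ (fun i => c i * η ^ d i * qTilde N s ^ d i)
    (fun u => (-qOf s) ^ e * g (η * (qTilde N s * u)⁻¹) * g (η * (qTilde N s * u))) ?_
  filter_upwards [eventually_comp_mul (ev_dress hZe K hη) ht, eventually_ne 0] with u hu hu0 i j
  simp only [hfun, hu, hrev]
  simp only [mul_pow, inv_pow]
  field_simp
  ring

lemma SolvesCtRE.transformation {s : ℂ} (hs : s ≠ 0) (hq : qOf s ^ 2 ≠ 1) (hN : 0 < N)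
    {s' : ℂ} {K K' : RatMatrix N} (h : SolvesCtRE s K) (ht : Transformation (s, K) (s', K')) :
    SolvesCtRE s' K' := by
  cases ht with
  | negate => exact h.negate hs
  | scale _ _ g _ => exact h.scale hs g
  | dress _ _ η hη Z hZ => exact h.dress hs hq hN hη hZ
  | invert => exact h.invert hs

lemma SolvesCtRE.equivalentTo {s : ℂ} (hs : s ≠ 0) (hq : qOf s ^ 2 ≠ 1) (hN : 0 < N)
    {K M : RatMatrix N} (hM : SolvesCtRE s M) (hKM : EquivalentTo s K M) : SolvesCtRE s K := by
  -- Inversions alternate the parameter between `s` and `s⁻¹`, and `q² ≠ 1` is stable under `q ↦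
  -- q⁻¹`.
  have key : ∀ p : ℂ × RatMatrix N, Relation.ReflTransGen Transformation (s, M) p →
      (p.1 = s ∨ p.1 = s⁻¹) ∧ SolvesCtRE p.1 p.2 := by
    intro p hp
    induction hp with
    | refl => exact ⟨Or.inl rfl, hM⟩
    | @tail b c hab hbc ih =>
      obtain ⟨s₁, K₁⟩ := b
      obtain ⟨s₂, K₂⟩ := c
      obtain ⟨h1, h2⟩ := ih
      simp only at h1 h2
      have hs₁ : s₁ ≠ 0 := by
        rcases h1 with rfl | rfl
        · exact hs
        · exact inv_ne_zero hs
      have hq₁ : qOf s₁ ^ 2 ≠ 1 := by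
        rcases h1 with rfl | rfl
        · exact hq
        · rwa [qOf_inv, inv_pow, Ne, inv_eq_one]
      refine ⟨?_, h2.transformation hs₁ hq₁ hN hbc⟩
      cases hbc with
      | negate => exact h1
      | scale => exact h1
      | dress => exact h1
      | invert =>
        rcases h1 with rfl | rfl
        · exact Or.inr rfl
        · exact Or.inl (inv_inv _)
  exact (key (s, K) hKM).2

/-! ### The model solutions -/


lemma ex_of_lt (q x : ℂ) {i j : Fin N} (h : (i : ℕ) < j) : ex q x i j = q - q⁻¹ := by
  simp [ex, Fin.lt_def, h]

lemma ex_of_gt (q x : ℂ) {i j : Fin N} (h : (j : ℕ) < i) : ex q x i j = (q - q⁻¹) * x := by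
  simp [ex, Fin.lt_def, h, h.not_gt]

lemma wt_of_ne (q x : ℂ) {i j : Fin N} (h : i ≠ j) : wt q x i j = 1 - x := by
  simp [wt, h]

lemma tri (i j : Fin N) : (i < j ∧ ¬ j < i ∧ ¬ i = j ∧ ¬ j = i) ∨ i = j ∨
    (j < i ∧ ¬ i < j ∧ ¬ i = j ∧ ¬ j = i) := by
  rcases lt_trichotomy i j with h | h | h
  · exact Or.inl ⟨h, h.not_gt, h.ne, h.ne'⟩
  · exact Or.inr (Or.inl h)
  · exact Or.inr (Or.inr ⟨h, h.not_gt, h.ne', h.ne⟩)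

/-- The polynomial form of the dense solution. -/
def denseModel (q : ℂ) (i j : Fin N) (u : ℂ) : ℂ :=
  if i = j then 1 + q * u else if i < j then 1 + q else (1 + q) * u

-- The weights and the entries depend only on the relative order of `i, j, k, l`, so each weak
-- ordering of the four indices gives one rational identity in `q, u, v`. `tri` supplies each
-- comparison in the forms `simp` needs, and `order` discards inconsistent orderings.
set_option maxHeartbeats 4000000 in
lemma denseModel_sol {q : ℂ} (hq : q ≠ 0) : TwistedSol q (denseModel (N := N) q) := by
  unfold TwistedSol Generically
  filter_upwards [eventually_ne 0] with u hu
  filter_upwards [eventually_ne 0] with v hv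
  intro i j k l
  rcases tri i j with ⟨a1, a2, a3, a4⟩ | a0 | ⟨a1, a2, a3, a4⟩ <;>
  rcases tri j k with ⟨b1, b2, b3, b4⟩ | b0 | ⟨b1, b2, b3, b4⟩ <;>
  rcases tri i k with ⟨c1, c2, c3, c4⟩ | c0 | ⟨c1, c2, c3, c4⟩ <;>
  first
  | (exfalso; order)
  | (rcases tri k l with ⟨d1, d2, d3, d4⟩ | d0 | ⟨d1, d2, d3, d4⟩ <;>
     rcases tri j l with ⟨e1, e2, e3, e4⟩ | e0 | ⟨e1, e2, e3, e4⟩ <;>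
     first
     | (exfalso; order)
     | (rcases tri i l with ⟨f1, f2, f3, f4⟩ | f0 | ⟨f1, f2, f3, f4⟩ <;>
        first
        | (exfalso; order)
        | (simp only [wt, ex, denseModel, if_true, if_false, lt_self_iff_false, *]
           try field_simp
           try ring)))

/-- The diagonal solution. -/
def diagModel (i j : Fin N) (_ : ℂ) : ℂ := if i = j then 1 else 0

lemma diagModel_sol (q : ℂ) : TwistedSol q (diagModel (N := N)) := by
  refine Eventually.of_forall fun u => Eventually.of_forall fun v => ?_
  intro i j k l
  simp only [diagModel]
  by_cases h1 : i = j
  · subst h1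
    by_cases h2 : k = l
    · subst h2
      by_cases h3 : i = k
      · subst h3; simp
      · simp [h3, mul_comm]
    · by_cases h3 : i = k
      · subst h3; simp [h2, Ne.symm h2]
      · simp [h3, h2, Ne.symm h2]
  · by_cases h2 : i = k
    · subst h2
      by_cases h3 : j = l
      · subst h3
        simp [h1, Ne.symm h1, wt_comm _ _ j i]
      · simp [h1, h3, Ne.symm h1]
    · by_cases h3 : i = l
      · subst h3
        by_cases h4 : j = k
        · subst h4; simp [h1, Ne.symm h1]
        · simp [h1, h2, h4, Ne.symm h1, Ne.symm h2]
      · simp [h1, h2, h3, Ne.symm h1]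

/-- For matrices supported on a fixed-point free involution, the twisted reflection equation
reduces to three families of equations. -/
lemma twistedEq_of_involution {q x y : ℂ} {A B : Fin N → Fin N → ℂ} {τ : Fin N → Fin N}
    (hτ : ∀ i, τ (τ i) = i) (hfix : ∀ i, τ i ≠ i) (hA : ∀ i j, j ≠ τ i → A i j = 0)
    (hB : ∀ i j, j ≠ τ i → B i j = 0)
    (hself : ∀ i, (1 - x) * (ex q y i (τ i) * (A i (τ i) * B i (τ i)))
        + ex q x i (τ i) * ((q - q⁻¹ * y) * (A (τ i) i * B i (τ i)))
      = (1 - x) * (ex q y (τ i) i * (A (τ i) i * B (τ i) i))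
        + ex q x (τ i) i * ((q - q⁻¹ * y) * (A i (τ i) * B (τ i) i)))
    (hcross : ∀ i j, j ≠ i → j ≠ τ i →
      ex q x i j * (A j (τ j) * B i (τ i)) = ex q x (τ i) (τ j) * (A i (τ i) * B j (τ j)))
    (hmix : ∀ i k, k ≠ i → k ≠ τ i →
      (1 - x) * (ex q y k (τ i) * (A i (τ i) * B k (τ k)))
        + ex q x i (τ i) * (ex q y k i * (A (τ i) i * B k (τ k)))
      = (1 - x) * (ex q y (τ k) i * (A (τ k) k * B (τ i) i))
        + ex q x (τ k) k * (ex q y k i * (A k (τ k) * B (τ i) i))) :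
    TwistedEq q x y A B := by
  have hinj : ∀ i j, τ i = τ j → i = j := fun i j h => by rw [← hτ i, h, hτ]
  have hw : ∀ i, wt q x i (τ i) = 1 - x := fun i => wt_of_ne q x (hfix i).symm
  intro i j k l
  -- The terms with `A i j`, `A j i` or `B j i` survive only if `j = τ i`. In that case `hself` and
  -- `hmix` occur, otherwise only `hcross`.
  by_cases hj : j = τ i
  · subst hj
    by_cases hl : l = τ k
    · subst hl
      by_cases hki : k = i
      · subst hki
        have h1 : A k k = 0 := hA _ _ (hfix k).symm
        have h3 : B (τ k) (τ k) = 0 := hB _ _ (hfix _).symm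
        simp only [h1, h3, hw, wt_self, ex_self]
        linear_combination hself k
      · by_cases hkj : k = τ i
        · subst hkj
          have h1 : A (τ i) (τ i) = 0 := hA _ _ (hfix _).symm
          have h3 : B (τ i) (τ i) = 0 := hB _ _ (hfix _).symm
          simp only [h1, h3, hτ, wt_comm q x (τ i) i, ex_self, wt_self]
          ring
        · have h1 : A i k = 0 := hA _ _ hkj
          have h2 : A (τ i) k = 0 := hA _ _ (by rwa [hτ])
          have h3 : A i (τ k) = 0 := hA _ _ fun h => hki (hinj _ _ h)
          simp only [h1, h2, h3, hw]
          linear_combination hmix i k hki hkj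
    · have h1 : B k l = 0 := hB _ _ hl
      have h2 : A k l = 0 := hA _ _ hl
      have h3 : A l k = 0 := hA _ _ fun h => hl (by rw [h, hτ])
      have h4 : A i k * B (τ i) l = 0 := by
        by_cases h : k = τ i
        · rw [hB (τ i) l (by rwa [← h]), mul_zero]
        · rw [hA _ _ h, zero_mul]
      have h5 : A (τ i) k * B i l = 0 := by
        by_cases h : k = i
        · rw [hB i l (by rwa [← h]), mul_zero]
        · rw [hA _ _ (by rwa [hτ]), zero_mul]
      have h6 : A i l * B (τ i) k = 0 := by
        by_cases h : k = i
        · rw [hA i l (by rwa [← h]), zero_mul]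
        · rw [hB _ _ (by rwa [hτ]), mul_zero]
      simp only [h1, h2, h3, h4, h5, h6]
      ring
  · have h1 : A i j = 0 := hA _ _ hj
    have h2 : B j i = 0 := hB _ _ fun h => hj (by rw [h, hτ])
    have h3 : A j i = 0 := hA _ _ fun h => hj (by rw [h, hτ])
    simp only [h1, h2, h3]
    by_cases hij : i = j
    · subst hij
      by_cases hk : k = τ i
      · subst hk
        by_cases hl : l = τ i
        · subst hl
          simp
        · simp [hA _ _ hl, hB _ _ hl]
      · simp [hA _ _ hk, hB _ _ hk]
    · by_cases hk : k = τ i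
      · subst hk
        have h4 : A j (τ i) = 0 := hA _ _ fun h => hij (hinj _ _ h)
        have h5 : B j (τ i) = 0 := hB _ _ fun h => hij (hinj _ _ h)
        simp only [h4, h5]
        by_cases hl : l = τ j
        · subst hl
          rw [wt_of_ne q x hij, wt_of_ne q y hj, wt_of_ne q x fun h => hij (hinj _ _ h),
            wt_of_ne q y (show i ≠ τ j from fun h => hj (by rw [h, hτ]))]
          ring
        · rw [hB _ _ hl]; ring
      · rw [hA _ _ hk]
        by_cases hl : l = τ i
        · subst hl
          by_cases hkj : k = τ j
          · subst hkj
            linear_combination wt q y i (τ j) * hcross i j (Ne.symm hij) hj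
          · rw [hA j k hkj, hB j k hkj]; ring
        · rw [hA _ _ hl, hB _ _ hl]; ring

/-- The partner of an index in the pairing `(0, 1), (2, 3), …`. -/
def adjPartner (hN : Even N) (i : Fin N) : Fin N :=
  if h : (i : ℕ) % 2 = 0 then ⟨i + 1, by obtain ⟨m, rfl⟩ := hN; omega⟩ else ⟨i - 1, by omega⟩

lemma adjPartner_val (hN : Even N) (i : Fin N) :
    (adjPartner hN i : ℕ) = if (i : ℕ) % 2 = 0 then (i : ℕ) + 1 else i - 1 := by
  unfold adjPartner
  split_ifs <;> rfl

/-- The solution supported on adjacent pairs. -/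
def pairedModel (hN : Even N) (q : ℂ) (i j : Fin N) (_ : ℂ) : ℂ :=
  if j = adjPartner hN i then (if (i : ℕ) % 2 = 0 then -q else 1) else 0

lemma adjPartner_adjPartner (hN : Even N) (i : Fin N) : adjPartner hN (adjPartner hN i) = i := by
  ext
  rw [adjPartner_val, adjPartner_val]
  split_ifs <;> omega

lemma adjPartner_ne (hN : Even N) (i : Fin N) : adjPartner hN i ≠ i := by
  intro h
  have := congrArg Fin.val h
  rw [adjPartner_val] at this
  split_ifs at this <;> omega

lemma ex_congr {q x : ℂ} {i j k l : Fin N} (h1 : (i : ℕ) < j ↔ (k : ℕ) < l)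
    (h2 : (j : ℕ) < i ↔ (l : ℕ) < k) : ex q x i j = ex q x k l := by
  simp only [ex, Fin.lt_def, h1, h2]

/-- An index outside a pair of neighbours lies on the same side of both. Exchange weights between
different pairs are thus unchanged by passing to partners, and `-q` against `1` balances the
equation inside a pair. -/
lemma pairedModel_sol (hN : Even N) {q : ℂ} (hq : q ≠ 0) :
    TwistedSol q (pairedModel hN q) := by
  unfold TwistedSol Generically
  filter_upwards [eventually_ne 0] with u hu
  filter_upwards [eventually_ne 0] with v hv0
  have hp : ∀ i w, pairedModel hN q i (adjPartner hN i) w = if (i : ℕ) % 2 = 0 then -q else 1 := by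
    simp [pairedModel]
  have hp' : ∀ i w, pairedModel hN q (adjPartner hN i) i w = if (i : ℕ) % 2 = 0 then 1 else -q := by
    intro i w
    have := hp (adjPartner hN i) w
    rw [adjPartner_adjPartner, adjPartner_val] at this
    rw [this]
    split_ifs <;> first | rfl | omega
  have hv := adjPartner_val hN
  have hv' : ∀ i j : Fin N, j ≠ i ↔ (j : ℕ) ≠ i := fun i j => by rw [Ne, Fin.ext_iff]
  refine twistedEq_of_involution (adjPartner_adjPartner hN) (adjPartner_ne hN)
    (fun i j h => by simp [pairedModel, h]) (fun i j h => by simp [pairedModel, h]) ?_ ?_ ?_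
  · intro i
    simp only [hp, hp']
    have h := hv i
    split_ifs at h ⊢ with hi
    · rw [ex_of_lt _ _ (by omega), ex_of_lt _ _ (by omega), ex_of_gt _ _ (by omega),
        ex_of_gt _ _ (by omega)]
      field_simp; ring
    · rw [ex_of_gt _ _ (by omega), ex_of_gt _ _ (by omega), ex_of_lt _ _ (by omega),
        ex_of_lt _ _ (by omega)]
      field_simp; ring
  · intro i j hij hij'
    rw [hv'] at hij hij'
    have h1 := hv i
    have h2 := hv j
    have : ex q (u / v) i j = ex q (u / v) (adjPartner hN i) (adjPartner hN j) := by
      apply ex_congr <;> split_ifs at h1 h2 <;> omega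
    rw [hp, hp, this]
    simp only [hp]
    ring
  · intro i k hki hki'
    rw [hv'] at hki hki'
    have h1 := hv i
    have h2 := hv k
    have e1 : ex q (u * v)⁻¹ k (adjPartner hN i) = ex q (u * v)⁻¹ k i := by
      apply ex_congr <;> split_ifs at h1 h2 <;> omega
    have e2 : ex q (u * v)⁻¹ (adjPartner hN k) i = ex q (u * v)⁻¹ k i := by
      apply ex_congr <;> split_ifs at h1 h2 <;> omega
    simp only [hp, hp', e1, e2]
    generalize ex q (u * v)⁻¹ k i = e
    by_cases hi : (i : ℕ) % 2 = 0 <;> by_cases hk : (k : ℕ) % 2 = 0 <;>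
      simp only [hi, hk, if_true, if_false] at h1 h2 ⊢
    · rw [ex_of_lt _ _ (by omega), ex_of_gt _ _ (by omega)]
      field_simp; ring
    · rw [ex_of_lt _ _ (by omega), ex_of_lt _ _ (by omega)]
    · rw [ex_of_gt _ _ (by omega), ex_of_gt _ _ (by omega)]
    · rw [ex_of_gt _ _ (by omega), ex_of_lt _ _ (by omega)]
      field_simp; ring

/-- The partner of an index in the pairing of `i` with `i + N / 2`. -/
def halfPartner (_ : Even N) (i : Fin N) : Fin N :=
  if h : (i : ℕ) < N / 2 then ⟨i + N / 2, by omega⟩ else ⟨i - N / 2, by omega⟩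

lemma halfPartner_val (hN : Even N) (i : Fin N) :
    (halfPartner hN i : ℕ) = if (i : ℕ) < N / 2 then (i : ℕ) + N / 2 else i - N / 2 := by
  unfold halfPartner
  split_ifs <;> rfl

lemma halfPartner_halfPartner (hN : Even N) (i : Fin N) :
    halfPartner hN (halfPartner hN i) = i := by
  ext
  rw [halfPartner_val, halfPartner_val]
  obtain ⟨m, rfl⟩ := hN
  split_ifs <;> omega

lemma halfPartner_ne (hN : Even N) (i : Fin N) : halfPartner hN i ≠ i := by
  intro h
  have := congrArg Fin.val h
  rw [halfPartner_val] at this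
  have hN2 := Nat.div_add_mod N 2
  rw [Nat.even_iff.mp hN] at hN2
  split_ifs at this <;> omega

/-- The solution supported on the pairs `(i, i + N / 2)`. -/
def halfModel (hN : Even N) (i j : Fin N) (u : ℂ) : ℂ :=
  if j = halfPartner hN i then (if (i : ℕ) < N / 2 then 1 else u) else 0

/-- Swapping the halves preserves the order within a half and reverses it across halves; the
resulting factor `u/v` is compensated by the entries `u` of the second half. -/
lemma halfModel_sol (hN : Even N) {q : ℂ} (hq : q ≠ 0) :
    TwistedSol q (halfModel hN) := by
  unfold TwistedSol Generically
  filter_upwards [eventually_ne 0] with u hu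
  filter_upwards [eventually_ne 0] with v hv0
  have hp : ∀ i w, halfModel hN i (halfPartner hN i) w = if (i : ℕ) < N / 2 then 1 else w := by
    simp [halfModel]
  have hp' : ∀ i w, halfModel hN (halfPartner hN i) i w = if (i : ℕ) < N / 2 then w else 1 := by
    intro i w
    have := hp (halfPartner hN i) w
    rw [halfPartner_halfPartner, halfPartner_val] at this
    rw [this]
    obtain ⟨m, rfl⟩ := hN
    split_ifs <;> first | rfl | omega
  have hv := halfPartner_val hN
  have hN2 := Nat.div_add_mod N 2
  rw [Nat.even_iff.mp hN] at hN2
  have hv' : ∀ i j : Fin N, j ≠ i ↔ (j : ℕ) ≠ i := fun i j => by rw [Ne, Fin.ext_iff]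
  refine twistedEq_of_involution (halfPartner_halfPartner hN) (halfPartner_ne hN)
    (fun i j h => by simp [halfModel, h]) (fun i j h => by simp [halfModel, h]) ?_ ?_ ?_
  · intro i
    simp only [hp, hp']
    have h := hv i
    split_ifs at h ⊢ with hi
    · rw [ex_of_lt _ _ (by omega), ex_of_lt _ _ (by omega), ex_of_gt _ _ (by omega),
        ex_of_gt _ _ (by omega)]
      field_simp
    · rw [ex_of_gt _ _ (by omega), ex_of_gt _ _ (by omega), ex_of_lt _ _ (by omega),
        ex_of_lt _ _ (by omega)]
      field_simp
  · intro i j hij hij'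
    rw [hv'] at hij hij'
    have h1 := hv i
    have h2 := hv j
    rw [hp, hp, hp, hp]
    by_cases hi : (i : ℕ) < N / 2 <;> by_cases hj : (j : ℕ) < N / 2 <;>
      simp only [hi, hj, if_true, if_false] at h1 h2 hij' ⊢
    · rw [ex_congr (k := halfPartner hN i) (l := halfPartner hN j) (by omega) (by omega)]
    · rw [ex_of_lt _ _ (by omega), ex_of_gt _ _ (by omega)]
      field_simp
    · rw [ex_of_gt _ _ (by omega), ex_of_lt _ _ (by omega)]
      field_simp
    · rw [ex_congr (k := halfPartner hN i) (l := halfPartner hN j) (by omega) (by omega)]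
  · intro i k hki hki'
    rw [hv'] at hki hki'
    have h1 := hv i
    have h2 := hv k
    simp only [hp, hp']
    by_cases hi : (i : ℕ) < N / 2 <;> by_cases hk : (k : ℕ) < N / 2 <;>
      simp only [hi, hk, if_true, if_false] at h1 h2 hki' ⊢
    · rw [ex_of_lt q _ (show (k : ℕ) < halfPartner hN i by omega),
        ex_of_lt q _ (show (i : ℕ) < halfPartner hN i by omega),
        ex_of_gt q _ (show (i : ℕ) < halfPartner hN k by omega),
        ex_of_gt q _ (show (k : ℕ) < halfPartner hN k by omega)]
      generalize ex q (u * v)⁻¹ k i = e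
      field_simp
    · rw [ex_of_lt q _ (show (i : ℕ) < halfPartner hN i by omega),
        ex_of_lt q _ (show (halfPartner hN k : ℕ) < k by omega),
        ex_of_gt q _ (show (i : ℕ) < k by omega)]
      rcases lt_or_gt_of_ne hki' with h | h
      · rw [ex_of_lt q _ h, ex_of_lt q _ (show (halfPartner hN k : ℕ) < i by omega)]
      · rw [ex_of_gt q _ h, ex_of_gt q _ (show (i : ℕ) < halfPartner hN k by omega)]
    · rw [ex_of_gt q _ (show (halfPartner hN i : ℕ) < i by omega),
        ex_of_gt q _ (show (k : ℕ) < halfPartner hN k by omega),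
        ex_of_lt q _ (show (k : ℕ) < i by omega)]
      rcases lt_or_gt_of_ne hki' with h | h
      · rw [ex_of_lt q _ h, ex_of_lt q _ (show (halfPartner hN k : ℕ) < i by omega)]
      · rw [ex_of_gt q _ h, ex_of_gt q _ (show (i : ℕ) < halfPartner hN k by omega)]
    · rw [ex_of_gt q _ (show (halfPartner hN i : ℕ) < k by omega),
        ex_of_gt q _ (show (halfPartner hN i : ℕ) < i by omega),
        ex_of_lt q _ (show (halfPartner hN k : ℕ) < i by omega),
        ex_of_lt q _ (show (halfPartner hN k : ℕ) < k by omega)]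
      generalize ex q (u * v)⁻¹ k i = e
      field_simp

/-! ### Solutions with vanishing diagonal -/


/-- The twisted reflection equation for a matrix of rational functions. -/
def RatSol (q : ℂ) (H : RatMatrix N) : Prop := TwistedSol q fun i j => ev (H i j)

/-- `H` agrees with the model `m` up to a rotation, a diagonal gauge and a scalar. -/
def Matches (H : RatMatrix N) (m : Fin N → Fin N → ℂ → ℂ) : Prop :=
  ∃ (g : RatFunc ℂ) (σ : Equiv.Perm (Fin N)) (d : Fin N → ℕ) (γ : Fin N → ℂ), g ≠ 0 ∧
    IsRotation σ d ∧ (∀ i, γ i ≠ 0) ∧ ∀ᶠ u in cofinite, ∀ i j,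
      ev (H (σ i) (σ j)) u = ev g u * (γ i * γ j * (u ^ d j * (u ^ d i)⁻¹)) * m i j u

@[simp] lemma ev_zero (u : ℂ) : ev 0 u = 0 := by simp [ev]

/-- With `H i i = 0`, the component `(i, i, k, l)` reduces, after cancelling `1 - y`, to the
relation excluded by `not_both_ne_zero`. -/
lemma RatSol.row_unique {q : ℂ} (hq : q ≠ 0) (hq1 : q ≠ 1) {H : RatMatrix N} (hH : RatSol q H)
    {i k l : Fin N} (hi : H i i = 0) (hk : H i k ≠ 0) (hl : H i l ≠ 0) : k = l := by
  by_contra hkl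
  have hik : i ≠ k := by rintro rfl; exact hk hi
  have hil : i ≠ l := by rintro rfl; exact hl hi
  refine not_both_ne_zero hq hq1 hkl (ev_ne_zero hk) (ev_ne_zero hl) ?_
  filter_upwards [hH, eventually_ne 0] with u hu hu0
  filter_upwards [hu, eventually_ne 0, eventually_ne u⁻¹] with v hv hv0 hv1
  have hy : 1 - (u * v)⁻¹ ≠ 0 := by
    intro h
    apply hv1
    field_simp at h ⊢
    linear_combination h
  have := hv i i k l
  simp only [hi, ev_zero, wt_self, ex_self, wt_of_ne q _ hik, wt_of_ne q _ hil,
    wt_of_ne q _ hkl] at this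
  apply mul_left_cancel₀ hy
  linear_combination this

lemma RatSol.col_unique {q : ℂ} (hq : q ≠ 0) (hq1 : q ≠ 1) {H : RatMatrix N} (hH : RatSol q H)
    {i k l : Fin N} (hi : H i i = 0) (hk : H k i ≠ 0) (hl : H l i ≠ 0) : k = l := by
  by_contra hkl
  have hik : i ≠ k := by rintro rfl; exact hk hi
  have hil : i ≠ l := by rintro rfl; exact hl hi
  refine not_both_ne_zero hq hq1 (Ne.symm hkl) (ev_ne_zero hk) (ev_ne_zero hl) ?_
  filter_upwards [hH, eventually_ne 0] with u hu hu0
  filter_upwards [hu, eventually_ne 0, eventually_ne u⁻¹] with v hv hv0 hv1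
  have hy : 1 - (u * v)⁻¹ ≠ 0 := by
    intro h
    apply hv1
    field_simp at h ⊢
    linear_combination h
  have := hv k l i i
  simp only [hi, ev_zero, wt_self, ex_self, wt_of_ne q _ hik.symm, wt_of_ne q _ hil.symm,
    wt_of_ne q _ hkl] at this
  apply mul_left_cancel₀ hy
  linear_combination -this

lemma sub_inv_ne_zero {q : ℂ} (hq : q ≠ 0) (hq2 : q ^ 2 ≠ 1) : q - q⁻¹ ≠ 0 := by
  intro h
  apply hq2
  field_simp at h
  linear_combination h

/-- A solution with vanishing diagonal and nonzero rows is supported on a fixed-point free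
involution. -/
lemma RatSol.exists_involution {q : ℂ} (hq : q ≠ 0) (hq2 : q ^ 2 ≠ 1) {H : RatMatrix N}
    (hH : RatSol q H) (hrow : ∀ i, ∃ j, H i j ≠ 0) (hdiag : ∀ i, H i i = 0) :
    ∃ τ : Fin N → Fin N, (∀ i, τ (τ i) = i) ∧ (∀ i, τ i ≠ i) ∧ (∀ i, H i (τ i) ≠ 0) ∧
      ∀ i j, j ≠ τ i → H i j = 0 := by
  have hq1 : q ≠ 1 := fun h => hq2 (by simp [h])
  choose τ hτ using hrow
  have hz : ∀ i j, j ≠ τ i → H i j = 0 := fun i j hj => by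
    by_contra h
    exact hj (hH.row_unique hq hq1 (hdiag i) h (hτ i))
  have hfix : ∀ i, τ i ≠ i := fun i h => hτ i (by rw [h]; exact hdiag i)
  refine ⟨τ, fun i => ?_, hfix, hτ, hz⟩
  by_contra hne
  have h1 : H (τ i) i = 0 := hz _ _ (Ne.symm hne)
  obtain ⟨u, hu, hu0, hA⟩ := (hH.and ((eventually_ne 0).and (ev_ne_zero (hτ i)))).exists
  obtain ⟨v, hv, hv0, hB, hvu, hvq⟩ := (hu.and ((eventually_ne 0).and
    ((ev_ne_zero (hτ (τ i))).and ((eventually_ne u).and (eventually_ne (-(q * u)⁻¹)))))).exists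
  -- If `τ (τ i) ≠ i`, the only surviving terms are the two with `A i (τ i) * B (τ i) (τ (τ i))`.
  -- Their weights differ by `(1 - x)(q - 1)(1 + q⁻¹ y)`, which is generically nonzero.
  have := hv i (τ i) (τ i) (τ (τ i))
  simp only [h1, hdiag, ev_zero, wt_self, ex_self, wt_of_ne q _ (hfix i).symm,
    wt_of_ne q _ (hfix (τ i)).symm, wt_of_ne q _ (Ne.symm hne)] at this
  have h2 : ((1 - u / v) * ((q - 1) * (1 + q⁻¹ * (u * v)⁻¹)))
      * (ev (H i (τ i)) u * ev (H (τ i) (τ (τ i))) v) = 0 := by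
    linear_combination (exp := 1) this +
      (1 - u / v) * (u * v)⁻¹ * ev (H i (τ i)) u * ev (H (τ i) (τ (τ i))) v
        * mul_inv_cancel₀ hq
  simp only [mul_eq_zero, hA, hB, or_false, sub_eq_zero, hq1, false_or] at h2
  rcases h2 with h2 | h2
  · exact hvu (by field_simp at h2; exact h2)
  · apply hvq
    field_simp at h2 ⊢
    linear_combination h2

/-- Generic proportionality up to a power of the variable. -/
def Rel (e : ℤ) (f g : ℂ → ℂ) : Prop :=
  ∃ c : ℂ, c ≠ 0 ∧ ∀ᶠ u in cofinite, g u = c * u ^ e * f u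

lemma Rel.symm {e : ℤ} {f g : ℂ → ℂ} (h : Rel e f g) : Rel (-e) g f := by
  obtain ⟨c, hc, h⟩ := h
  refine ⟨c⁻¹, inv_ne_zero hc, ?_⟩
  filter_upwards [h, eventually_ne 0] with u hu hu0
  have := zpow_ne_zero e hu0
  rw [hu, zpow_neg]
  field_simp

lemma Rel.trans {e e' : ℤ} {f g k : ℂ → ℂ} (h : Rel e f g) (h' : Rel e' g k) :
    Rel (e + e') f k := by
  obtain ⟨c, hc, h⟩ := h
  obtain ⟨c', hc', h'⟩ := h'
  refine ⟨c' * c, mul_ne_zero hc' hc, ?_⟩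
  filter_upwards [h, h', eventually_ne 0] with u h1 h2 hu0
  rw [h2, h1, zpow_add₀ hu0]
  ring

/-- The data of an invertible solution supported on an involution. -/
structure PairData (q : ℂ) (H : RatMatrix N) (τ : Fin N → Fin N) : Prop where
  sol : RatSol q H
  hq : q ≠ 0
  hq2 : q ^ 2 ≠ 1
  invol : ∀ i, τ (τ i) = i
  fix : ∀ i, τ i ≠ i
  ne_zero : ∀ i, H i (τ i) ≠ 0
  zero : ∀ i j, j ≠ τ i → H i j = 0

/-! ### Chord diagrams and the ratios of the entries attached to chords -/

namespace PairData
variable {q : ℂ} {H : RatMatrix N} {τ : Fin N → Fin N}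

lemma inj (D : PairData q H τ) {i j : Fin N} (h : τ i = τ j) : i = j := by
  rw [← D.invol i, h, D.invol]

/-- In the component `(i, j, τ j, τ i)` only exchange terms remain, and they say that the ratio of
the two entries is constant, or a constant times `u` when `τ` reverses the order of `i` and `j`. -/
lemma rel_of_lt (D : PairData q H τ) {i j : Fin N} (hij : i < j) (hj : j ≠ τ i) :
    Rel (if τ j < τ i then 1 else 0) (ev (H i (τ i))) (ev (H j (τ j))) := by
  have hz : ∀ i, ∀ᶠ u in cofinite, ev (H i (τ i)) u ≠ 0 := fun i => ev_ne_zero (D.ne_zero i)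
  have hκ := sub_inv_ne_zero D.hq D.hq2
  have hcm : ∀ᶠ u in cofinite, ∀ᶠ v in cofinite,
      ex q (u / v) i j * (ev (H j (τ j)) u * ev (H i (τ i)) v)
        = ex q (u / v) (τ i) (τ j) * (ev (H i (τ i)) u * ev (H j (τ j)) v) := by
    filter_upwards [D.sol, eventually_ne 0] with u hu hu0
    filter_upwards [hu, eventually_ne 0, eventually_ne u⁻¹] with v hv hv0 hv1
    have hy : 1 - (u * v)⁻¹ ≠ 0 := by
      intro h
      apply hv1
      field_simp at h ⊢
      linear_combination h
    have hi : i ≠ τ j := fun h => hj (by rw [h, D.invol])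
    have := hv i j (τ j) (τ i)
    simp only [D.zero i j hj, D.zero j i hi, D.zero i (τ j) fun h => hij.ne (D.inj h).symm,
      D.zero (τ i) (τ j) (by rw [D.invol]; exact hi.symm),
      D.zero (τ j) (τ i) (by rw [D.invol]; exact hj.symm), ev_zero, wt_of_ne q _ hi] at this
    apply mul_left_cancel₀ hy
    linear_combination this
  obtain ⟨u₀, h₀, hi, hj, n₀⟩ := (hcm.and ((hz i).and ((hz j).and (eventually_ne 0)))).exists
  by_cases h3 : τ j < τ i
  · refine ⟨ev (H j (τ j)) u₀ / ev (H i (τ i)) u₀ / u₀, by simp [hi, hj, n₀], ?_⟩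
    filter_upwards [h₀, eventually_ne 0] with v hv hv0
    simp only [ex, hij, h3, h3.not_gt, if_true, if_false] at hv
    have hv' := mul_left_cancel₀ hκ (hv.trans (mul_assoc _ _ _))
    simp only [h3, if_true, zpow_one]
    field_simp at hv' ⊢
    linear_combination -hv'
  · have h4 : τ i < τ j := lt_of_le_of_ne (not_lt.mp h3) fun h => hij.ne (D.inj h)
    refine ⟨ev (H j (τ j)) u₀ / ev (H i (τ i)) u₀, by simp [hi, hj], ?_⟩
    filter_upwards [h₀] with v hv
    simp only [ex, hij, h4, if_true] at hv
    have hv' := mul_left_cancel₀ hκ hv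
    simp only [h3, if_false, zpow_zero]
    field_simp
    linear_combination -hv'

lemma rel (D : PairData q H τ) {i j : Fin N} (hij : i ≠ j) (hj : j ≠ τ i) :
    Rel (if i < j then (if τ j < τ i then 1 else 0) else (if τ i < τ j then -1 else 0))
      (ev (H i (τ i))) (ev (H j (τ j))) := by
  rcases lt_or_gt_of_ne hij with h | h
  · rw [if_pos h]; exact D.rel_of_lt h hj
  · rw [if_neg h.not_gt]
    have := (D.rel_of_lt h (i := j) (j := i) fun h => hj (by rw [h, D.invol])).symm
    convert this using 1
    split_ifs <;> rfl

/-- The number of elements of the pair of `j` lying strictly between `i` and its partner. -/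
def between (τ : Fin N → Fin N) (i j : Fin N) : ℕ :=
  (if i < j ∧ j < τ i then 1 else 0) + (if i < τ j ∧ τ j < τ i then 1 else 0)

/-- Composing the ratios along `i → j → τ i` adds their exponents, and the sum counts the endpoints
of the chord of `j` that are enclosed by the chord of `i`. -/
lemma rel_partner (D : PairData q H τ) {i j : Fin N} (hi : i < τ i) (hij : j ≠ i)
    (hj : j ≠ τ i) : ∃ c : ℂ, c ≠ 0 ∧ ∀ᶠ u in cofinite,
      ev (H (τ i) i) u = c * u ^ between τ i j * ev (H i (τ i)) u := by
  have h1 := D.rel hij.symm hj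
  have h2 := D.rel hj (j := τ i) fun h => hij (D.inj h).symm
  obtain ⟨c, hc, h⟩ := h1.trans h2
  refine ⟨c, hc, ?_⟩
  rw [D.invol] at h
  filter_upwards [h] with u hu
  rw [hu, ← zpow_natCast]
  congr 3
  have n1 : (τ j : ℕ) ≠ i := fun h => hj (by rw [← D.invol j, Fin.ext h])
  have n2 : (τ j : ℕ) ≠ τ i := fun h => hij (D.inj (Fin.ext h))
  have n3 : (j : ℕ) ≠ i := fun h => hij (Fin.ext h)
  have n4 : (j : ℕ) ≠ τ i := fun h => hj (Fin.ext h)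
  have n5 : (j : ℕ) ≠ τ j := fun h => D.fix j (Fin.ext h.symm)
  simp only [between, Fin.lt_def] at hi ⊢
  split_ifs <;> first | rfl | omega

/-- The ratio of the two entries of one chord has a single exponent, whichever other chord computed
it. -/
lemma between_eq (D : PairData q H τ) {i j j' : Fin N} (hi : i < τ i) (hij : j ≠ i)
    (hj : j ≠ τ i) (hij' : j' ≠ i) (hj' : j' ≠ τ i) : between τ i j = between τ i j' := by
  obtain ⟨c, hc, h⟩ := D.rel_partner hi hij hj
  obtain ⟨c', hc', h'⟩ := D.rel_partner hi hij' hj'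
  refine pow_eq_const_mul_pow (b := c') hc ?_
  filter_upwards [h, h', ev_ne_zero (D.ne_zero i)] with u h1 h2 h3
  exact mul_right_cancel₀ h3 (h1.symm.trans h2)

/-- The equation for the two entries of a pair. -/
lemma self_eq (D : PairData q H τ) {i : Fin N} (hi : i < τ i) :
    ∀ᶠ u in cofinite, ∀ᶠ v in cofinite,
      (v - u) * (u * v * (ev (H i (τ i)) u * ev (H i (τ i)) v)
          - ev (H (τ i) i) u * ev (H (τ i) i) v)
        + (q * (u * v) - q⁻¹) * (v * (ev (H (τ i) i) u * ev (H i (τ i)) v)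
          - u * (ev (H i (τ i)) u * ev (H (τ i) i) v)) = 0 := by
  have hκ := sub_inv_ne_zero D.hq D.hq2
  filter_upwards [D.sol, eventually_ne 0] with u hu hu0
  filter_upwards [hu, eventually_ne 0] with v hv hv0
  have := hv i (τ i) i (τ i)
  simp only [D.zero i i (D.fix i).symm, D.zero (τ i) (τ i) (D.fix _).symm, ev_zero,
    wt_of_ne q _ hi.ne, wt_self, ex, hi, hi.not_gt, if_true, if_false, lt_self_iff_false] at this
  have h2 : (q - q⁻¹) * ((v - u) * (u * v * (ev (H i (τ i)) u * ev (H i (τ i)) v)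
          - ev (H (τ i) i) u * ev (H (τ i) i) v)
        + (q * (u * v) - q⁻¹) * (v * (ev (H (τ i) i) u * ev (H i (τ i)) v)
          - u * (ev (H i (τ i)) u * ev (H (τ i) i) v))) = 0 := by
    have hY : u * v * (u * v)⁻¹ = 1 := mul_inv_cancel₀ (mul_ne_zero hu0 hv0)
    obtain ⟨x, hx⟩ : ∃ x, x = u / v := ⟨_, rfl⟩
    rw [← hx] at this
    obtain rfl : u = x * v := by rw [hx]; field_simp
    linear_combination (exp := 1) (x * v ^ 3) * this + (q - q⁻¹) * v *
      (q⁻¹ * ev (H (τ i) i) (x * v) * ev (H i (τ i)) v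
        + (1 - x) * ev (H (τ i) i) (x * v) * ev (H (τ i) i) v
        - x * q⁻¹ * ev (H i (τ i)) (x * v) * ev (H (τ i) i) v) * hY
  exact (mul_eq_zero.mp h2).resolve_left hκ

end PairData

namespace PairData
variable {q : ℂ} {H : RatMatrix N} {τ : Fin N → Fin N}

/-- The ratio of the two entries of a pair, freed of the entries themselves. -/
lemma partner_eq (D : PairData q H τ) {i : Fin N} (hi : i < τ i) {c : ℂ} {e : ℕ}
    (h : ∀ᶠ u in cofinite, ev (H (τ i) i) u = c * u ^ e * ev (H i (τ i)) u) :
    ∃ u : ℂ, u ≠ 0 ∧ ∀ᶠ v in cofinite, v ≠ 0 ∧ v - u ≠ 0 ∧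
      (v - u) * (u * v - c * u ^ e * (c * v ^ e))
        + (q * (u * v) - q⁻¹) * (v * (c * u ^ e) - u * (c * v ^ e)) = 0 := by
  have hz := ev_ne_zero (D.ne_zero i)
  obtain ⟨u, hu, h1, h2, hu0⟩ := ((D.self_eq hi).and (h.and (hz.and (eventually_ne 0)))).exists
  refine ⟨u, hu0, ?_⟩
  filter_upwards [hu, h, hz, eventually_ne 0, eventually_ne u] with v hv h3 h4 hv0 hvu
  refine ⟨hv0, sub_ne_zero.mpr hvu, ?_⟩
  rw [h1, h3] at hv
  apply mul_left_cancel₀ (mul_ne_zero h2 h4)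
  linear_combination hv

/-- For exponents `0`, `1`, `2` in turn, `partner_eq` becomes, after removing `v - u` and nonzero
monomials, a polynomial of degree at most one in `v`; its coefficients give `c = -q⁻¹`, `c = ±1`, `c
= -q`. -/
lemma partner_const_zero (D : PairData q H τ) {i : Fin N} (hi : i < τ i) {c : ℂ} (hc : c ≠ 0)
    (h : ∀ᶠ u in cofinite, ev (H (τ i) i) u = c * u ^ 0 * ev (H i (τ i)) u) : c = -q⁻¹ := by
  have hq := D.hq
  obtain ⟨u, hu, hv⟩ := D.partner_eq hi h
  have : ∀ᶠ v in cofinite, (-(c * (c + q⁻¹))) + u * (1 + q * c) * v = 0 := by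
    filter_upwards [hv] with v ⟨hv0, hvu, hv⟩
    apply mul_left_cancel₀ hvu
    linear_combination hv
  have h1 := (linear_coeffs_zero this).1
  have h2 : c * (c + q⁻¹) = 0 := by linear_combination -h1
  have h3 := (mul_eq_zero.mp h2).resolve_left hc
  linear_combination h3

lemma partner_const_one (D : PairData q H τ) {i : Fin N} (hi : i < τ i) {c : ℂ}
    (h : ∀ᶠ u in cofinite, ev (H (τ i) i) u = c * u ^ 1 * ev (H i (τ i)) u) :
    c = 1 ∨ c = -1 := by
  obtain ⟨u, hu, hv⟩ := D.partner_eq hi h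
  obtain ⟨v, hv0, hvu, hv⟩ := hv.exists
  have h1 : (c - 1) * (c + 1) = 0 := by
    apply mul_left_cancel₀ (mul_ne_zero hvu (mul_ne_zero hu hv0))
    linear_combination -hv
  rcases mul_eq_zero.mp h1 with h1 | h1
  · exact Or.inl (by linear_combination h1)
  · exact Or.inr (by linear_combination h1)

lemma partner_const_two (D : PairData q H τ) {i : Fin N} (hi : i < τ i) {c : ℂ} 
    (h : ∀ᶠ u in cofinite, ev (H (τ i) i) u = c * u ^ 2 * ev (H i (τ i)) u) : c = -q := by
  have hq := D.hq
  obtain ⟨u, hu, hv⟩ := D.partner_eq hi h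
  have : ∀ᶠ v in cofinite, (1 + q⁻¹ * c) + (-(u * (c * (c + q)))) * v = 0 := by
    filter_upwards [hv] with v ⟨hv0, hvu, hv⟩
    apply mul_left_cancel₀ (mul_ne_zero hvu (mul_ne_zero hu hv0))
    linear_combination hv
  have h1 := (linear_coeffs_zero this).1
  field_simp at h1
  linear_combination h1

/-- Only the products `γ i * γ (τ' i)` matter for a matrix supported on chords, so the whole
constant of a chord can be placed at its smaller endpoint. -/
lemma matches_of_pairs (D : PairData q H τ) {σ : Equiv.Perm (Fin N)} {d : Fin N → ℕ}
    (hσ : IsRotation σ d) {τ' : Fin N → Fin N} (hτ' : ∀ i, σ (τ' i) = τ (σ i))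
    {g : RatFunc ℂ} (hg : g ≠ 0) {m : Fin N → Fin N → ℂ → ℂ}
    (hm : ∀ i j u, j ≠ τ' i → m i j u = 0) {c : Fin N → ℂ} (hc : ∀ i, c i ≠ 0)
    (hcs : ∀ i, c (τ' i) = c i)
    (h : ∀ i, ∀ᶠ u in cofinite, ev (H (σ i) (τ (σ i))) u
      = ev g u * (c i * (u ^ d (τ' i) * (u ^ d i)⁻¹)) * m i (τ' i) u) : Matches H m := by
  refine ⟨g, σ, d, fun i => if i < τ' i then c i else 1, hg, hσ, fun i => ?_, ?_⟩
  · beta_reduce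
    split_ifs
    · exact hc i
    · exact one_ne_zero
  have hinv : ∀ i, τ' (τ' i) = i := fun i => σ.injective (by rw [hτ', hτ', D.invol])
  have hne : ∀ i, τ' i ≠ i := fun i h => D.fix (σ i) (by rw [← hτ', h])
  filter_upwards [eventually_all.mpr h] with u hu i j
  by_cases hj : j = τ' i
  · subst hj
    rw [hτ', hu]
    congr 2
    rw [hinv]
    rcases lt_or_gt_of_ne (hne i) with h1 | h1
    · rw [if_neg h1.not_gt, if_pos h1, hcs]; ring
    · rw [if_pos h1, if_neg h1.not_gt]; ring
  · rw [D.zero _ _ (by rwa [← hτ', Ne, EmbeddingLike.apply_eq_iff_eq]), hm i j u hj]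
    simp

lemma const_of_lt (D : PairData q H τ) {i j : Fin N} (hij : i < j) (hτ : τ i < τ j)
    (hj : j ≠ τ i) : ∃ c : ℂ, c ≠ 0 ∧
      ∀ᶠ u in cofinite, ev (H j (τ j)) u = c * ev (H i (τ i)) u := by
  have := D.rel_of_lt hij hj
  simpa [hτ.not_gt, Rel] using this

/-- `between = 1` says that two chords cross, a symmetric relation. The chord of `i₀` crosses every
other chord by `between_eq`; hence each other chord crosses that one, and therefore, again by
`between_eq`, all chords. -/
lemma between_all_one (D : PairData q H τ) {i₀ j₀ : Fin N} (hi₀ : i₀ < τ i₀) (hij₀ : j₀ ≠ i₀)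
    (hj₀ : j₀ ≠ τ i₀) (hb : between τ i₀ j₀ = 1) {i j : Fin N} (hi : i < τ i) (hij : j ≠ i)
    (hj : j ≠ τ i) : between τ i j = 1 := by
  by_cases h : i = i₀
  · subst h
    rw [D.between_eq hi hij hj hij₀ hj₀, hb]
  · have h1 : i ≠ τ i₀ := by
      rintro rfl
      rw [D.invol] at hi
      exact hi.not_gt hi₀
    have h2 : i₀ ≠ τ i := fun h' => h1 (by rw [h', D.invol])
    have h3 := D.between_eq hi₀ h h1 hij₀ hj₀
    rw [hb] at h3
    rw [D.between_eq hi hij hj (Ne.symm h) h2]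
    have n1 : (i : ℕ) ≠ i₀ := fun h' => h (Fin.ext h')
    have n2 : (i : ℕ) ≠ τ i₀ := fun h' => h1 (Fin.ext h')
    have n3 : (i₀ : ℕ) ≠ τ i := fun h' => h2 (Fin.ext h')
    have n4 : (τ i₀ : ℕ) ≠ τ i := fun h' => h (D.inj (Fin.ext h')).symm
    clear hb
    simp only [between, Fin.lt_def] at *
    split_ifs at * <;> omega

lemma involutive (D : PairData q H τ) : Function.Involutive τ := D.invol

/-- When all chords cross, the order of two indices is reversed by `τ` exactly when one opens its
chord and the other closes its own. -/
lemma isRotation_of_between (D : PairData q H τ) (hb : ∀ i j, i < τ i → j ≠ i → j ≠ τ i →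
    between τ i j = 1) :
    IsRotation (Function.Involutive.toPerm τ D.involutive) (fun i => if τ i < i then 1 else 0) := by
  intro i j hij
  simp only [Function.Involutive.coe_toPerm]
  have fi : (τ i : ℕ) ≠ i := fun h => D.fix i (Fin.ext h)
  have fj : (τ j : ℕ) ≠ j := fun h => D.fix j (Fin.ext h)
  have fij : (τ i : ℕ) ≠ τ j := fun h => hij.ne (D.inj (Fin.ext h))
  by_cases hj : j = τ i
  · subst hj
    simp [D.invol, hij, hij.not_gt]
  · have hi : i ≠ τ j := fun h => hj (by rw [h, D.invol])
    have hj' : (j : ℕ) ≠ τ i := fun h => hj (Fin.ext h)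
    have hi' : (i : ℕ) ≠ τ j := fun h => hi (Fin.ext h)
    have h1 := hb i j
    have h2 := hb (τ i) j
    rw [D.invol] at h2
    simp only [between, D.invol, Fin.lt_def, Ne, Fin.ext_iff] at *
    split_ifs at * <;> omega

/-- Applying `IsRotation.val_eq` to `0` and to `τ 0` gives `N = 2 * τ 0`. -/
lemma eq_halfPartner (D : PairData q H τ) (hN : 0 < N) (hb : ∀ i j, i < τ i → j ≠ i → j ≠ τ i →
    between τ i j = 1) : ∃ h : Even N, τ = halfPartner h := by
  obtain ⟨c, hc⟩ := (D.isRotation_of_between hb).val_eq hN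
  simp only [Function.Involutive.coe_toPerm] at hc
  set z : Fin N := ⟨0, hN⟩ with hz
  have hz0 : (z : ℕ) = 0 := rfl
  have h0 := hc z
  have h1 := hc (τ z)
  have hfix : (τ z : ℕ) ≠ z := fun h => D.fix z (Fin.ext h)
  rw [D.invol] at h1
  simp only [Fin.lt_def] at hc h0 h1
  rw [if_neg (by omega)] at h0
  rw [if_pos (by omega)] at h1
  have hN2 : N = (τ z : ℕ) + τ z := by push_cast at h0 h1; omega
  have hE : Even N := ⟨_, hN2⟩
  refine ⟨hE, ?_⟩
  funext i
  ext
  rw [halfPartner_val]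
  have h2 := hc i
  have h3 := i.isLt
  have h4 := (τ i).isLt
  split_ifs at h2 ⊢ <;> push_cast at h2 h0 h1 <;> omega

lemma matches_half (D : PairData q H τ) (hN : 0 < N) (hb : ∀ i j, i < τ i → j ≠ i → j ≠ τ i →
    between τ i j = 1) (hN3 : 3 ≤ N) : ∃ h : Even N, ∃ ε : ℂ, (ε = 1 ∨ ε = -1) ∧
      Matches H (fun i j u => halfModel h i j (ε * u)) := by
  obtain ⟨hE, rfl⟩ := D.eq_halfPartner hN hb
  refine ⟨hE, ?_⟩
  set τ := halfPartner hE with hτd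
  have hv : ∀ i, (τ i : ℕ) = if (i : ℕ) < N / 2 then (i : ℕ) + N / 2 else i - N / 2 :=
    halfPartner_val hE
  have hN2 := Nat.div_add_mod N 2
  rw [Nat.even_iff.mp hE] at hN2
  have hlt : ∀ i : Fin N, (i : ℕ) < N / 2 → i < τ i := by
    intro i hi
    rw [Fin.lt_def, hv, if_pos hi]
    omega
  have hsign : ∀ i : Fin N, (i : ℕ) < N / 2 → ∃ ε : ℂ, (ε = 1 ∨ ε = -1) ∧
      ∀ᶠ u in cofinite, ev (H (τ i) i) u = ε * u ^ 1 * ev (H i (τ i)) u := by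
    intro i hi
    obtain ⟨j, hj, hj'⟩ : ∃ j, j ≠ i ∧ j ≠ τ i := by
      obtain ⟨j, hj⟩ := Finset.exists_mem_notMem_of_card_lt_card
        (s := {i, τ i}) (t := Finset.univ) (by
          rw [Finset.card_univ, Fintype.card_fin]
          exact lt_of_le_of_lt Finset.card_le_two (by omega))
      exact ⟨j, by simpa [not_or] using hj.2⟩
    obtain ⟨ε, -, h⟩ := D.rel_partner (hlt i hi) hj hj'
    rw [hb i j (hlt i hi) hj hj'] at h
    exact ⟨ε, D.partner_const_one (hlt i hi) h, h⟩
  set z : Fin N := ⟨0, hN⟩ with hz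
  have hz0 : (z : ℕ) < N / 2 := by simp only [hz]; omega
  have hconst : ∀ i : Fin N, (i : ℕ) < N / 2 → ∃ c : ℂ, c ≠ 0 ∧
      ∀ᶠ u in cofinite, ev (H i (τ i)) u = c * ev (H z (τ z)) u := by
    intro i hi
    by_cases hiz : i = z
    · exact ⟨1, one_ne_zero, by simp [hiz]⟩
    · have hi0 : (i : ℕ) ≠ 0 := fun h => hiz (Fin.ext h)
      have hzv : (z : ℕ) = 0 := rfl
      have h1 := hv i
      have h2 := hv z
      rw [if_pos hi] at h1
      rw [if_pos hz0] at h2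
      refine D.const_of_lt (show z < i from ?_) (show τ z < τ i from ?_) ?_
      · rw [Fin.lt_def]; omega
      · rw [Fin.lt_def]; omega
      · rw [Ne, Fin.ext_iff]; omega
  obtain ⟨ε, hε, hεz⟩ := hsign z hz0
  choose! c hc0 hc using hconst
  have hsame : ∀ i : Fin N, (i : ℕ) < N / 2 →
      ∀ᶠ u in cofinite, ev (H (τ i) i) u = ε * u * ev (H i (τ i)) u := by
    intro k hk
    by_cases hkz : k = z
    · subst hkz; simpa using hεz
    obtain ⟨ε', hε', hεk⟩ := hsign k hk
    suffices h : ε = ε' by rw [h]; simpa using hεk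
    have hk0 : (k : ℕ) ≠ 0 := fun h => hkz (Fin.ext h)
    have hzv : (z : ℕ) = 0 := rfl
    have h1 := hv k
    have h2 := hv z
    rw [if_pos hk] at h1
    rw [if_pos hz0] at h2
    have n1 : k ≠ τ z := by rw [Ne, Fin.ext_iff]; omega
    have hpz := ev_ne_zero (D.ne_zero z)
    obtain ⟨u, hu, hu0, a1, a2, a3, a4⟩ := (D.sol.and ((eventually_ne 0).and
      (hpz.and (hεz.and (hεk.and (hc k hk)))))).exists
    obtain ⟨v, hv, hv0, b1, b2, b3, b4, hvu⟩ := (hu.and ((eventually_ne 0).and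
      (hpz.and (hεz.and (hεk.and ((hc k hk).and (eventually_ne u))))))).exists
    -- Each chord has its own sign so far. The component mixing the chords of `z` and `k` reduces to
    -- `(v - u)(1 - ε ε') = 0`, so the signs agree.
    have e := hv z (τ z) k (τ k)
    have hκ := sub_inv_ne_zero D.hq D.hq2
    simp only [D.zero z k n1, D.zero (τ z) k (by rwa [D.invol]),
      D.zero z (τ k) (fun h => hkz (D.inj h)), ev_zero, wt_of_ne q _ (hlt z hz0).ne,
      wt_of_ne q _ (hlt k hk).ne, ex_of_lt q _ (show (k : ℕ) < τ z by omega),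
      ex_of_lt q _ (show (z : ℕ) < τ z by omega), ex_of_gt q _ (show (z : ℕ) < k by omega),
      ex_of_gt q _ (show (z : ℕ) < τ k by omega), ex_of_gt q _ (show (k : ℕ) < τ k by omega),
      a2, a3, a4, b2, b4] at e
    have hY : u * v * (u * v)⁻¹ = 1 := mul_inv_cancel₀ (mul_ne_zero hu0 hv0)
    have hX : u / v * v = u := div_mul_cancel₀ u hv0
    have hmain : (v - u) * (1 - ε * ε') = 0 := by
      apply mul_left_cancel₀ (mul_ne_zero (mul_ne_zero hκ (hc0 k hk)) (mul_ne_zero a1 b1))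
      generalize u / v = x at hX e
      subst hX
      generalize ev (H z (τ z)) (x * v) = p at e
      generalize ev (H z (τ z)) v = p' at e
      generalize ((x * v) * v)⁻¹ = Y at e hY
      linear_combination (exp := 1) v * e
        + v * (1 - x) * (q - q⁻¹) * c k * p * p' * ε * ε' * hY
    have h3 := (mul_eq_zero.mp hmain).resolve_left (sub_ne_zero.mpr hvu)
    rcases hε with rfl | rfl <;> rcases hε' with rfl | rfl <;> first | rfl | norm_num at h3
  have hε0 : ε ≠ 0 := by rcases hε with rfl | rfl <;> norm_num
  refine ⟨ε, hε, D.matches_of_pairs isRotation_one (τ' := τ) (fun i => rfl) (D.ne_zero z)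
    (fun i j u h => by simp [halfModel, ← hτd, h])
    (c := fun i => if (i : ℕ) < N / 2 then c i else c (τ i)) (fun i => ?_) (fun i => ?_)
    fun i => ?_⟩
  · split_ifs with h
    · exact hc0 i h
    · exact hc0 (τ i) (by rw [hv, if_neg h]; omega)
  · rw [D.invol]
    have h1 := hv i
    split_ifs at * <;> first | rfl | omega
  · simp only [Equiv.Perm.coe_one, id, halfModel, ← hτd, if_true, Pi.zero_apply, pow_zero]
    by_cases h : (i : ℕ) < N / 2
    · filter_upwards [hc i h] with u hu
      simp only [h, if_true, hu]; ring
    · have h' : (τ i : ℕ) < N / 2 := by rw [hv, if_neg h]; omega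
      have h2 := hsame (τ i) h'
      rw [D.invol] at h2
      have h3 := hc (τ i) h'
      rw [D.invol] at h3
      filter_upwards [h2, h3] with u h4 h5
      simp only [h, if_false, h4, h5]; ring

end PairData

/-! ### Chords between neighbours, and their rotation by one step -/

lemma finRotate_val (i : Fin N) :
    (finRotate N i : ℕ) = if (i : ℕ) + 1 = N then 0 else (i : ℕ) + 1 := by
  cases N with
  | zero => exact i.elim0
  | succ n =>
    rw [finRotate_apply, Fin.val_add_one]
    simp [Fin.ext_iff]

lemma isRotation_finRotate :
    IsRotation (finRotate N) (fun i => if (i : ℕ) + 1 = N then 1 else 0) := by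
  intro i j hij
  have hi := finRotate_val i
  have hj := finRotate_val j
  have := i.isLt
  have := j.isLt
  simp only [Fin.lt_def] at *
  split_ifs at * <;> omega

namespace PairData
variable {q : ℂ} {H : RatMatrix N} {τ : Fin N → Fin N}

lemma val_partner_of_between {i : Fin N} (hi : i < τ i)
    (hb : ∀ j, j ≠ i → j ≠ τ i → between τ i j = 0) : (τ i : ℕ) = i + 1 := by
  by_contra hne
  have hi' : (i : ℕ) < τ i := hi
  have := hb ⟨i + 1, by omega⟩ (by simp [Fin.ext_iff]) (by
    rw [Ne, Fin.ext_iff]; exact fun h => hne h.symm)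
  simp only [between, Fin.lt_def] at this
  split_ifs at this <;> omega

lemma partner_ratio (D : PairData q H τ) (hN : 3 ≤ N) {i : Fin N} (hi : i < τ i) {e : ℕ}
    (hb : ∀ j, j ≠ i → j ≠ τ i → between τ i j = e) :
    ∃ c : ℂ, c ≠ 0 ∧ ∀ᶠ u in cofinite, ev (H (τ i) i) u = c * u ^ e * ev (H i (τ i)) u := by
  obtain ⟨j, hj, hj'⟩ : ∃ j, j ≠ i ∧ j ≠ τ i := by
    obtain ⟨j, hj⟩ := Finset.exists_mem_notMem_of_card_lt_card
      (s := {i, τ i}) (t := Finset.univ) (by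
        rw [Finset.card_univ, Fintype.card_fin]
        exact lt_of_le_of_lt Finset.card_le_two (by omega))
    exact ⟨j, by simpa [not_or] using hj.2⟩
  have := D.rel_partner hi hj hj'
  rwa [hb j hj hj'] at this

lemma partner_of_between_zero (D : PairData q H τ) (hN : 3 ≤ N) {i : Fin N} (hi : i < τ i)
    (hb : ∀ j, j ≠ i → j ≠ τ i → between τ i j = 0) :
    ∀ᶠ u in cofinite, ev (H (τ i) i) u = -q⁻¹ * ev (H i (τ i)) u := by
  obtain ⟨c, hc, h⟩ := D.partner_ratio hN hi hb
  have := D.partner_const_zero hi hc h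
  simpa [this] using h

lemma eq_adjPartner (D : PairData q H τ) (hN : 3 ≤ N)
    (hb : ∀ i j, i < τ i → j ≠ i → j ≠ τ i → between τ i j = 0) :
    ∃ h : Even N, τ = adjPartner h := by
  have hval : ∀ i, i < τ i → (τ i : ℕ) = i + 1 := fun i hi =>
    val_partner_of_between hi fun j => hb i j hi
  -- If an even `n` closed its chord, its partner would be `n - 1`; but `n - 2` opens a chord by
  -- induction and is already joined to `n - 1`.
  have hopen : ∀ (n : ℕ) (i : Fin N), (i : ℕ) = n → n % 2 = 0 → i < τ i := by
    intro n
    induction n using Nat.strong_induction_on with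
    | _ n ih =>
      intro i hi hn
      by_contra hlt
      have hlt' : τ i < i := lt_of_le_of_ne (not_lt.mp hlt) (D.fix i)
      have h1 := hval (τ i) (by rwa [D.invol])
      rw [D.invol] at h1
      have h2 : (τ i : ℕ) < i := hlt'
      have h3 := i.isLt
      have h4 := hval ⟨n - 2, by omega⟩ (ih (n - 2) (by omega) ⟨n - 2, by omega⟩ rfl (by omega))
      have h5 : (⟨n - 2, by omega⟩ : Fin N) = i := D.inj (Fin.ext (by rw [h4]; simp; omega))
      have := congrArg Fin.val h5
      simp at this
      omega
  have hE : Even N := by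
    rw [Nat.even_iff]
    by_contra h
    have h1 := hval ⟨N - 1, by omega⟩ (hopen (N - 1) ⟨N - 1, by omega⟩ rfl (by omega))
    have h2 := (τ ⟨N - 1, by omega⟩).isLt
    simp only at h1
    omega
  refine ⟨hE, ?_⟩
  funext i
  ext
  rw [adjPartner_val]
  split_ifs with h
  · exact hval i (hopen i i rfl h)
  · have h0 := i.isLt
    have h1 := hval ⟨i - 1, by omega⟩ (hopen (i - 1) ⟨i - 1, by omega⟩ rfl (by omega))
    have h2 : τ ⟨i - 1, by omega⟩ = i := Fin.ext (by rw [h1]; simp; omega)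
    rw [← h2, D.invol, h2]

lemma ev_C_mul (c : ℂ) (f : RatFunc ℂ) : ∀ᶠ u in cofinite, ev (RatFunc.C c * f) u = c * ev f u := by
  filter_upwards [ev_mul (RatFunc.C c) f] with u hu
  rw [hu]; simp [ev]

lemma matches_paired (D : PairData q H τ) (hN : 3 ≤ N)
    (hb : ∀ i j, i < τ i → j ≠ i → j ≠ τ i → between τ i j = 0) :
    ∃ h : Even N, Matches H (pairedModel h q) := by
  obtain ⟨hE, rfl⟩ := D.eq_adjPartner hN hb
  refine ⟨hE, ?_⟩
  set τ := adjPartner hE with hτd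
  have hv : ∀ i, (τ i : ℕ) = if (i : ℕ) % 2 = 0 then (i : ℕ) + 1 else i - 1 := adjPartner_val hE
  have hlt : ∀ i : Fin N, (i : ℕ) % 2 = 0 → i < τ i := by
    intro i hi
    rw [Fin.lt_def, hv, if_pos hi]
    omega
  set z : Fin N := ⟨0, by omega⟩ with hz
  have hz0 : (z : ℕ) = 0 := rfl
  have hconst : ∀ i : Fin N, (i : ℕ) % 2 = 0 → ∃ c : ℂ, c ≠ 0 ∧
      ∀ᶠ u in cofinite, ev (H i (τ i)) u = c * ev (H z (τ z)) u := by
    intro i hi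
    by_cases hiz : i = z
    · exact ⟨1, one_ne_zero, by simp [hiz]⟩
    · have hi0 : (i : ℕ) ≠ 0 := fun h => hiz (Fin.ext h)
      have h1 := hv i
      have h2 := hv z
      rw [if_pos hi] at h1
      rw [if_pos (by omega)] at h2
      refine D.const_of_lt (show z < i from ?_) (show τ z < τ i from ?_) ?_
      · rw [Fin.lt_def]; omega
      · rw [Fin.lt_def]; omega
      · rw [Ne, Fin.ext_iff]; omega
  choose! c hc0 hc using hconst
  have hq := D.hq
  -- The model has entry `-q` at even rows and `1` at odd rows, so the common scalar is the entry in
  -- row `τ z`, which is `-q⁻¹` times the one in row `z`.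
  have hg : RatFunc.C (-q⁻¹) * H z (τ z) ≠ 0 := mul_ne_zero (by simp [hq]) (D.ne_zero z)
  have hge := ev_C_mul (-q⁻¹) (H z (τ z))
  have hodd : ∀ i : Fin N, ¬ (i : ℕ) % 2 = 0 → (τ i : ℕ) % 2 = 0 := fun i h => by
    rw [hv, if_neg h]; omega
  refine D.matches_of_pairs isRotation_one (τ' := τ) (fun i => rfl) hg
    (fun i j u h => by simp [pairedModel, ← hτd, h])
    (c := fun i => if (i : ℕ) % 2 = 0 then c i else c (τ i)) (fun i => ?_) (fun i => ?_)
    fun i => ?_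
  · split_ifs with h
    · exact hc0 i h
    · exact hc0 (τ i) (hodd i h)
  · rw [D.invol]
    have h1 := hv i
    split_ifs at * <;> first | rfl | omega
  · simp only [Equiv.Perm.coe_one, id, pairedModel, ← hτd, if_true, Pi.zero_apply, pow_zero]
    by_cases h : (i : ℕ) % 2 = 0
    · filter_upwards [hc i h, hge] with u hu hg
      simp only [h, if_true, hu, hg]; field_simp
    · have h' := hodd i h
      have h2 := D.partner_of_between_zero hN (hlt _ h') fun j => hb _ j (hlt _ h')
      rw [D.invol] at h2
      have h3 := hc (τ i) h'
      rw [D.invol] at h3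
      filter_upwards [h2, h3, hge] with u h4 h5 hg
      simp only [h, if_false, h4, h5, hg]; ring

/-- A chord enclosing both ends of every other chord must use the first and the last index. -/
lemma outer_pair (hN : 3 ≤ N) {i₀ : Fin N} (hi : i₀ < τ i₀)
    (hb : ∀ j, j ≠ i₀ → j ≠ τ i₀ → between τ i₀ j = 2) :
    (i₀ : ℕ) = 0 ∧ (τ i₀ : ℕ) = N - 1 := by
  have h1 : ∀ j : Fin N, j ≠ i₀ → j ≠ τ i₀ → i₀ < j ∧ j < τ i₀ := by
    intro j hj hj'
    have := hb j hj hj'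
    simp only [between] at this
    split_ifs at this with h2 h3 <;> first | exact h2 | omega
  have hi' : (i₀ : ℕ) < τ i₀ := hi
  have hlt := (τ i₀).isLt
  constructor
  · by_contra h
    have := h1 ⟨0, by omega⟩ (by rw [Ne, Fin.ext_iff]; exact Ne.symm h)
      (by rw [Ne, Fin.ext_iff]; simp; omega)
    exact absurd this.1 (by simp [Fin.lt_def])
  · by_contra h
    have := h1 ⟨N - 1, by omega⟩ (by rw [Ne, Fin.ext_iff]; simp; omega)
      (by rw [Ne, Fin.ext_iff]; exact Ne.symm h)
    have h2 := this.2
    rw [Fin.lt_def] at h2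
    simp only at h2
    omega

/-- With the outer chord removed, the indices `1, …, N - 2` are paired into neighbours by the same
induction as in `eq_adjPartner`, now with odd indices opening. The rotation carries the chord `{N -
2, N - 1}` to the outer one. -/
lemma rotated_partner (D : PairData q H τ) (hN : 3 ≤ N) {z l : Fin N} (hz : (z : ℕ) = 0)
    (hl : (l : ℕ) = N - 1) (hzl : τ z = l)
    (hb : ∀ i j, i < τ i → i ≠ z → j ≠ i → j ≠ τ i → between τ i j = 0) :
    ∃ h : Even N, ∀ i, finRotate N (adjPartner h i) = τ (finRotate N i) := by
  have hlz : τ l = z := by rw [← hzl, D.invol]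
  have hval : ∀ i, i < τ i → i ≠ z → (τ i : ℕ) = i + 1 := fun i hi hiz =>
    val_partner_of_between hi fun j => hb i j hi hiz
  have hopen : ∀ (n : ℕ) (i : Fin N), (i : ℕ) = n → n % 2 = 1 → n ≠ N - 1 → i < τ i := by
    intro n
    induction n using Nat.strong_induction_on with
    | _ n ih =>
      intro i hi hn hnl
      by_contra hlt
      have hlt' : τ i < i := lt_of_le_of_ne (not_lt.mp hlt) (D.fix i)
      have hiz : τ i ≠ z := by
        intro h
        have : i = l := by rw [← hzl, ← h, D.invol]
        exact hnl (by rw [← hi, this, hl])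
      have h1 := hval (τ i) (by rwa [D.invol]) hiz
      rw [D.invol] at h1
      have h2 : (τ i : ℕ) < i := hlt'
      have h3 := i.isLt
      have h6 : (τ i : ℕ) ≠ 0 := fun h => hiz (Fin.ext (by rw [h, hz]))
      have h4 := hval ⟨n - 2, by omega⟩ (ih (n - 2) (by omega) ⟨n - 2, by omega⟩ rfl (by omega)
        (by omega)) (by rw [Ne, Fin.ext_iff]; simp; omega)
      have h5 : (⟨n - 2, by omega⟩ : Fin N) = i := D.inj (Fin.ext (by rw [h4]; simp; omega))
      have := congrArg Fin.val h5
      simp at this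
      omega
  have hE : Even N := by
    rw [Nat.even_iff]
    by_contra h
    have h1 := hval ⟨N - 2, by omega⟩ (hopen (N - 2) ⟨N - 2, by omega⟩ rfl (by omega) (by omega))
      (by rw [Ne, Fin.ext_iff]; simp; omega)
    have h2 : (⟨N - 2, by omega⟩ : Fin N) = z := D.inj (Fin.ext (by rw [h1, hzl, hl]; simp; omega))
    have := congrArg Fin.val h2
    simp at this
    omega
  refine ⟨hE, fun i => ?_⟩
  rw [Nat.even_iff] at hE
  have hi := i.isLt
  have r1 := finRotate_val i
  have r2 := finRotate_val (adjPartner (Nat.even_iff.mpr hE) i)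
  have r3 := adjPartner_val (Nat.even_iff.mpr hE) i
  ext
  by_cases h : (i : ℕ) % 2 = 0
  · rw [if_pos h] at r3
    rw [if_neg (by omega)] at r1
    rw [r2]
    by_cases h1 : (i : ℕ) + 1 = N - 1
    · have : finRotate N i = l := Fin.ext (by rw [r1, hl, h1])
      rw [this, hlz, hz, if_pos (by omega)]
    · rw [if_neg (by omega), hval _ (hopen (i + 1) _ r1 (by omega) h1)
        (by rw [Ne, Fin.ext_iff]; omega)]
      omega
  · rw [if_neg h] at r3
    rw [r2, if_neg (by omega), r3]
    by_cases h1 : (i : ℕ) + 1 = N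
    · rw [if_pos h1] at r1
      have : finRotate N i = z := Fin.ext (by rw [r1, hz])
      rw [this, hzl, hl]; omega
    · rw [if_neg h1] at r1
      have h2 := hval i (hopen i i rfl (by omega) (by omega)) (by rw [Ne, Fin.ext_iff]; omega)
      have h3 : finRotate N i = τ i := Fin.ext (by rw [r1, h2])
      rw [h3, D.invol]; omega

/-- The outer chord has ratio `-q u²` instead of `-q⁻¹`. Read from row `N - 1`, this is the ratio
`-q⁻¹` of the model, corrected by the powers of `u` that a wrapped index receives. The value `-q *
c'` of the gauge on this chord is forced by `H l z = -q u² H z l` and `H z l = c' u⁻¹ H o (τ o)`. -/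
lemma matches_paired_rotated (D : PairData q H τ) (hN : 3 ≤ N) {z l : Fin N} (hz : (z : ℕ) = 0)
    (hl : (l : ℕ) = N - 1) (hzl : τ z = l)
    (hbz : ∀ j, j ≠ z → j ≠ τ z → between τ z j = 2)
    (hb : ∀ i j, i < τ i → i ≠ z → j ≠ i → j ≠ τ i → between τ i j = 0) :
    ∃ h : Even N, Matches H (pairedModel h q) := by
  obtain ⟨hE, hrot⟩ := D.rotated_partner hN hz hl hzl hb
  refine ⟨hE, ?_⟩
  have hlz : τ l = z := by rw [← hzl, D.invol]
  have hE' := Nat.even_iff.mp hE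
  have hav := adjPartner_val hE
  -- the partner of an odd index
  have hv : ∀ i : Fin N, (i : ℕ) % 2 = 1 → (i : ℕ) ≠ N - 1 → (τ i : ℕ) = i + 1 := by
    intro i hi hil
    have hi' := i.isLt
    have h1 := hrot ⟨i - 1, by omega⟩
    have h2 : finRotate N ⟨i - 1, by omega⟩ = i := by
      ext
      rw [finRotate_val, if_neg (by simp; omega)]
      simp; omega
    rw [h2] at h1
    have h3 := hav ⟨i - 1, by omega⟩
    rw [if_pos (by simp; omega)] at h3
    rw [← h1, finRotate_val, if_neg (by rw [h3]; simp; omega), h3]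
    simp; omega
  set o : Fin N := ⟨1, by omega⟩ with ho
  have ho1 : (o : ℕ) = 1 := rfl
  have hov := hv o (by omega) (by omega)
  have hlt : ∀ i : Fin N, (i : ℕ) % 2 = 1 → (i : ℕ) ≠ N - 1 → i < τ i := fun i hi hil => by
    rw [Fin.lt_def, hv i hi hil]; omega
  have hconst : ∀ i : Fin N, ((i : ℕ) % 2 = 1 ∧ (i : ℕ) ≠ N - 1) → ∃ c : ℂ, c ≠ 0 ∧
      ∀ᶠ u in cofinite, ev (H i (τ i)) u = c * ev (H o (τ o)) u := by
    rintro i ⟨hi, hil⟩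
    by_cases hio : i = o
    · exact ⟨1, one_ne_zero, by simp [hio]⟩
    · have hi0 : (i : ℕ) ≠ 1 := fun h => hio (Fin.ext h)
      have h1 := hv i hi hil
      refine D.const_of_lt (show o < i from ?_) (show τ o < τ i from ?_) ?_
      · rw [Fin.lt_def]; omega
      · rw [Fin.lt_def]; omega
      · rw [Ne, Fin.ext_iff]; omega
  choose! c hc0 hc using hconst
  have hq := D.hq
  obtain ⟨c', hc', hzo⟩ : ∃ c' : ℂ, c' ≠ 0 ∧
      ∀ᶠ u in cofinite, ev (H z l) u = c' * u⁻¹ * ev (H o (τ o)) u := by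
    have h1 := (D.rel_of_lt (i := z) (j := o) (by rw [Fin.lt_def]; omega)
      (by rw [hzl, Ne, Fin.ext_iff]; omega)).symm
    rw [if_pos (by rw [hzl, Fin.lt_def]; omega), hzl] at h1
    simpa [Rel] using h1
  have hlz' : ∀ᶠ u in cofinite, ev (H l z) u = -q * u ^ 2 * ev (H z l) u := by
    have hzlt : z < τ z := by rw [hzl, Fin.lt_def]; omega
    obtain ⟨c₂, -, h⟩ := D.partner_ratio hN hzlt hbz
    rw [D.partner_const_two hzlt h, hzl] at h
    exact h
  have hg : RatFunc.C (-q⁻¹) * H o (τ o) ≠ 0 := mul_ne_zero (by simp [hq]) (D.ne_zero o)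
  have hge := ev_C_mul (-q⁻¹) (H o (τ o))
  -- gauge factors attached to the pairs
  let γ : Fin N → ℂ := fun i => if (i : ℕ) + 2 = N then -q * c' else c (finRotate N i)
  have hγ : ∀ i : Fin N, (i : ℕ) % 2 = 0 → γ i ≠ 0 := by
    intro i hi
    have hil := i.isLt
    simp only [γ]
    split_ifs with h
    · simp [hq, hc']
    · refine hc0 _ ?_
      rw [finRotate_val, if_neg (by omega)]
      omega
  have hadj : ∀ i : Fin N, ¬ (i : ℕ) % 2 = 0 → (adjPartner hE i : ℕ) % 2 = 0 := fun i h => by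
    rw [hav, if_neg h]; omega
  refine D.matches_of_pairs isRotation_finRotate (τ' := adjPartner hE) hrot hg
    (fun i j u h => by simp [pairedModel, h])
    (c := fun i => if (i : ℕ) % 2 = 0 then γ i else γ (adjPartner hE i)) (fun i => ?_)
    (fun i => ?_) fun i => ?_
  · split_ifs with h
    · exact hγ i h
    · exact hγ _ (hadj i h)
  · rw [adjPartner_adjPartner]
    have h1 := hav i
    split_ifs at * <;> first | rfl | omega
  · simp only [pairedModel, if_true]
    have hil := i.isLt
    have h1 := hav i
    have r1 := finRotate_val i
    by_cases h : (i : ℕ) % 2 = 0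
    · rw [if_pos h] at h1
      rw [if_neg (by omega)] at r1
      rw [if_pos h, if_pos h, if_neg (show ¬ (i : ℕ) + 1 = N by omega)]
      by_cases h2 : (i : ℕ) + 2 = N
      · have h3 : finRotate N i = l := Fin.ext (by omega)
        rw [h3, hlz, if_pos (by omega)]
        filter_upwards [hlz', hzo, hge, eventually_ne 0] with u h4 h5 h6 h7
        rw [h4, h5, h6]
        simp only [γ, h2, if_true]
        field_simp
      · rw [if_neg (by omega)]
        filter_upwards [hc (finRotate N i) (by omega), hge] with u h4 h6
        rw [h4, h6]
        simp only [γ, h2, if_false]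
        field_simp
    · have h' := hadj i h
      rw [if_neg h] at h1
      rw [if_neg h, if_neg h, if_neg (show ¬ (adjPartner hE i : ℕ) + 1 = N by omega)]
      by_cases h2 : (i : ℕ) + 1 = N
      · rw [if_pos h2] at r1
        have h3 : finRotate N i = z := Fin.ext (by omega)
        rw [h3, hzl, if_pos h2]
        filter_upwards [hzo, hge, eventually_ne 0] with u h5 h6 h7
        rw [h5, h6]
        simp only [γ, show (adjPartner hE i : ℕ) + 2 = N by omega, if_true]
        field_simp
      · rw [if_neg h2] at r1
        have h3 : finRotate N (adjPartner hE i) = i := by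
          ext
          rw [finRotate_val, if_neg (by omega)]
          omega
        have h4 : finRotate N i = τ i := by
          have := hrot (adjPartner hE i)
          rwa [adjPartner_adjPartner, h3] at this
        rw [h4, D.invol, if_neg h2]
        have hii : i < τ i := hlt i (by omega) (by omega)
        have h5 := D.partner_of_between_zero hN hii fun j => hb i j hii (by
          rw [Ne, Fin.ext_iff]; omega)
        filter_upwards [h5, hc i (by omega), hge] with u h6 h7 h8
        rw [h6, h7, h8]
        simp only [γ, h3, show ¬ (adjPartner hE i : ℕ) + 2 = N by omega, if_false]
        ring

end PairData

/-- The classification of invertible solutions with vanishing diagonal. -/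
theorem RatSol.matches_of_diag_eq_zero {q : ℂ} (hq : q ≠ 0) (hq2 : q ^ 2 ≠ 1) {H : RatMatrix N}
    (hH : RatSol q H) (hrow : ∀ i, ∃ j, H i j ≠ 0) (hdiag : ∀ i, H i i = 0) (hN : 3 ≤ N) :
    ∃ h : Even N, Matches H (pairedModel h q) ∨ ∃ ε : ℂ, (ε = 1 ∨ ε = -1) ∧
      Matches H (fun i j u => halfModel h i j (ε * u)) := by
  obtain ⟨τ, hinv, hfix, hne, hz⟩ := hH.exists_involution hq hq2 hrow hdiag
  have D : PairData q H τ := ⟨hH, hq, hq2, hinv, hfix, hne, hz⟩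
  -- The value of `between` is `1` for crossing chords, `2` if the chord of `i` encloses that of
  -- `j`, and `0` otherwise. One crossing or one enclosure determines the whole diagram.
  by_cases h1 : ∃ i j, i < τ i ∧ j ≠ i ∧ j ≠ τ i ∧ PairData.between τ i j = 1
  · obtain ⟨i, j, hi, hij, hj, hb⟩ := h1
    obtain ⟨hE, ε, hε, hm⟩ := D.matches_half (by omega)
      (fun i' j' h h' h'' => D.between_all_one hi hij hj hb h h' h'') hN
    exact ⟨hE, Or.inr ⟨ε, hε, hm⟩⟩
  by_cases h2 : ∃ i j, i < τ i ∧ j ≠ i ∧ j ≠ τ i ∧ PairData.between τ i j = 2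
  · obtain ⟨z, j, hi, hij, hj, hb⟩ := h2
    have hbz : ∀ j, j ≠ z → j ≠ τ z → PairData.between τ z j = 2 := fun j' h h' => by
      rw [D.between_eq hi h h' hij hj, hb]
    obtain ⟨hz0, hl⟩ := PairData.outer_pair hN hi hbz
    obtain ⟨hE, hm⟩ := D.matches_paired_rotated hN hz0 hl rfl hbz (by
      intro i j' hii hiz hj' hj''
      have hzl : i ≠ τ z := by
        rintro rfl
        rw [D.invol] at hii
        exact hii.not_gt hi
      -- The outer chord has no endpoint strictly inside another chord, so the exponent of every
      -- other chord is `0`.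
      rw [D.between_eq hii hj' hj'' (Ne.symm hiz) fun h => hzl (by rw [h, D.invol])]
      simp only [PairData.between, Fin.lt_def]
      have := (τ i).isLt
      split_ifs <;> omega)
    exact ⟨hE, Or.inl hm⟩
  · obtain ⟨hE, hm⟩ := D.matches_paired hN (by
      intro i j hi hij hj
      have e1 : PairData.between τ i j ≠ 1 := fun h => h1 ⟨i, j, hi, hij, hj, h⟩
      have e2 : PairData.between τ i j ≠ 2 := fun h => h2 ⟨i, j, hi, hij, hj, h⟩
      simp only [PairData.between] at e1 e2 ⊢
      split_ifs at * <;> omega)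
    exact ⟨hE, Or.inl hm⟩

/-! ### Solutions with a nonvanishing diagonal entry -/


/-- A solution whose diagonal entries are constant. -/
structure DiagData (q : ℂ) (H : RatMatrix N) (d : Fin N → ℂ) : Prop where
  sol : RatSol q H
  hq : q ≠ 0
  hq2 : q ^ 2 ≠ 1
  hq4 : q ^ 2 ≠ -1
  diag : ∀ i u, ev (H i i) u = d i
  diag_eq : ∀ i, H i i = RatFunc.C (d i)

lemma eventually_inv_ne_one (u : ℂ) : ∀ᶠ v in cofinite, 1 - (u * v)⁻¹ ≠ 0 := by
  filter_upwards [eventually_ne u⁻¹] with v hv h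
  apply hv
  have h1 : u * v = 1 := inv_eq_one.mp (sub_eq_zero.mp h).symm
  exact eq_inv_of_mul_eq_one_right h1

lemma eventually_div_ne_one (u : ℂ) : ∀ᶠ v in cofinite, 1 - u / v ≠ 0 := by
  filter_upwards [eventually_ne u, eventually_ne 0] with v hv hv0 h
  apply hv
  field_simp at h
  linear_combination h

/-- No nonzero function has a moving pole. -/
lemma false_of_moving_pole {q : ℂ} (hq : q ≠ 0) {f w z : ℂ → ℂ}
    (hf : ∀ᶠ u in cofinite, f u ≠ 0) (hw : ∀ᶠ u in cofinite, w u ≠ 0)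
    (h : ∀ᶠ u in cofinite, ∀ᶠ v in cofinite, (q * v - q⁻¹ * u) * f v = w u * z v) : False := by
  -- Formally `f(v)` would have the factor `1/(q v - q⁻¹ u)` for every `u`. Eliminating `z(v)`
  -- between two values of `u` shows that these factors would have to be proportional.
  obtain ⟨u₀, h₀, w₀⟩ := (h.and hw).exists
  obtain ⟨u₁, h₁, w₁, hne⟩ := (h.and (hw.and (eventually_ne u₀))).exists
  have : ∀ᶠ v in cofinite, q⁻¹ * (w u₀ * u₁ - w u₁ * u₀) + q * (w u₁ - w u₀) * v = 0 := by
    filter_upwards [h₀, h₁, hf] with v e₀ e₁ f₀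
    apply mul_left_cancel₀ f₀
    linear_combination w u₁ * e₀ - w u₀ * e₁
  obtain ⟨h1, h2⟩ := linear_coeffs_zero this
  have h3 : w u₁ = w u₀ := by simpa [hq, sub_eq_zero] using h2
  have h4 : w u₀ * u₁ = w u₁ * u₀ := by simpa [hq, sub_eq_zero] using h1
  rw [h3] at h4
  exact hne (mul_left_cancel₀ w₀ h4)

/-- As a function of `v`, `f` would have a pole at `v = q⁻² u` unless the right-hand side vanishes
there, and vanishing there means `g(u) = q f(u)`. The proof compares the expressions for `f(v)`
obtained from two values of `u`. -/
lemma eq_of_moving_pole {q : ℂ} (hq : q ≠ 0) (hq2 : q ^ 2 ≠ 1) {f g : ℂ → ℂ}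
    (h : ∀ᶠ u in cofinite, ∀ᶠ v in cofinite,
      (q * v - q⁻¹ * u) * f v = (v - u) * g u + (q - q⁻¹) * u * f u) :
    ∀ᶠ u in cofinite, g u = q * f u := by
  have hκ := sub_inv_ne_zero hq hq2
  filter_upwards [h, eventually_ne 0] with u₀ h₀ n₀
  obtain ⟨u₁, h₁, n₁, hne⟩ := (h.and ((eventually_ne 0).and (eventually_ne u₀))).exists
  have : ∀ᶠ v in cofinite,
      (q⁻¹ * (u₀ * u₁ * ((q - q⁻¹) * (f u₁ - f u₀) - (g u₁ - g u₀)))) +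
      (q * (u₀ * ((q - q⁻¹) * f u₀ - g u₀) - u₁ * ((q - q⁻¹) * f u₁ - g u₁))
        + q⁻¹ * (u₀ * g u₁ - u₁ * g u₀)) * v +
      (q * (g u₀ - g u₁)) * v ^ 2 + 0 * v ^ 3 + 0 * v ^ 4 = 0 := by
    filter_upwards [h₀, h₁] with v e₀ e₁
    linear_combination (q * v - q⁻¹ * u₀) * e₁ - (q * v - q⁻¹ * u₁) * e₀
  obtain ⟨c0, c1, c2, -, -⟩ := quartic_coeffs_zero this
  have h2 : g u₀ = g u₁ := by simpa [hq, sub_eq_zero] using c2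
  have h1 : f u₁ = f u₀ := by simpa [hq, sub_eq_zero, n₀, n₁, h2, hκ] using c0
  rw [← h2, h1] at c1
  have h3 : (u₀ - u₁) * (q * ((q - q⁻¹) * f u₀ - g u₀) + q⁻¹ * g u₀) = 0 := by
    linear_combination c1
  have h4 := (mul_eq_zero.mp h3).resolve_left (sub_ne_zero.mpr hne.symm)
  apply mul_left_cancel₀ hκ
  linear_combination -h4

/-! ### Constant diagonal: how zeros off the diagonal propagate -/

namespace DiagData
variable {q : ℂ} {H : RatMatrix N} {d : Fin N → ℂ}

lemma ne_one (D : DiagData q H d) : q ≠ 1 := fun h => D.hq2 (by simp [h])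

/-- In the component `(i, i, i, l)` the only term left is `(1 - x) ex(y) H_{li}(u) d_i`. -/
lemma transpose_eq_zero (D : DiagData q H d) {i l : Fin N} (hi : d i ≠ 0) (hil : i ≠ l)
    (h : H i l = 0) : H l i = 0 := by
  have hκ := sub_inv_ne_zero D.hq D.hq2
  by_contra hne
  obtain ⟨u, ⟨hu, hu0⟩, hr⟩ := ((D.sol.and (eventually_ne 0)).and (ev_ne_zero hne)).exists
  obtain ⟨v, hv, hv0, hx⟩ := (hu.and ((eventually_ne 0).and (eventually_div_ne_one u))).exists
  have := hv i i i l
  simp only [h, ev_zero, D.diag, wt_self, ex_self, wt_of_ne q _ hil, zero_mul, mul_zero, add_zero,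
    zero_add] at this
  have hy : ex q (u * v)⁻¹ l i ≠ 0 := by
    unfold ex
    split_ifs with h1 h2
    · exact hκ
    · simp [hκ, hu0, hv0]
    · exact absurd (le_antisymm (not_lt.mp h1) (not_lt.mp h2)) hil
  have h0 := this.symm
  exact mul_ne_zero hx (mul_ne_zero hy (mul_ne_zero hr hi)) h0

/-- The component `(l, i, i, i)` becomes `(q - q⁻¹ x) f(v) = ex(x) f(u)` for `f = H i l`, which
gives `f` a moving pole. -/
lemma eq_zero_of_transpose (D : DiagData q H d) {i l : Fin N} (hi : d i ≠ 0) (hil : i ≠ l)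
    (h : H l i = 0) : H i l = 0 := by
  have hκ := sub_inv_ne_zero D.hq D.hq2
  by_contra hne
  have key : ∀ᶠ u in cofinite, ∀ᶠ v in cofinite,
      (q - q⁻¹ * (u / v)) * ev (H i l) v = ex q (u / v) l i * ev (H i l) u := by
    filter_upwards [D.sol, eventually_ne 0] with u hu hu0
    filter_upwards [hu, eventually_ne 0] with v hv hv0
    have := hv l i i i
    simp only [h, ev_zero, D.diag, wt_self, ex_self, zero_mul, mul_zero, add_zero,
      zero_add] at this
    have hy : ex q (u * v)⁻¹ i l ≠ 0 := by
      unfold ex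
      split_ifs with h1 h2
      · exact hκ
      · simp [hκ, hu0, hv0]
      · exact absurd (le_antisymm (not_lt.mp h2) (not_lt.mp h1)) hil
    apply mul_left_cancel₀ (mul_ne_zero hy hi)
    linear_combination -this
  rcases lt_or_gt_of_ne hil with hlt | hlt
  · refine false_of_moving_pole D.hq (ev_ne_zero hne)
      (w := fun u => (q - q⁻¹) * u * ev (H i l) u) (z := fun _ => 1) ?_ ?_
    · filter_upwards [ev_ne_zero hne, eventually_ne 0] with u h1 h2
      simp [hκ, h1, h2]
    · filter_upwards [key, eventually_ne 0] with u hu hu0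
      filter_upwards [hu, eventually_ne 0] with v hv hv0
      simp only [ex, hlt, hlt.not_gt, if_true, if_false] at hv
      have : v * v⁻¹ = 1 := mul_inv_cancel₀ hv0
      linear_combination v * hv + (q⁻¹ * u * ev (H i l) v + (q - q⁻¹) * u * ev (H i l) u) * this
  · refine false_of_moving_pole D.hq (ev_ne_zero hne)
      (w := fun u => (q - q⁻¹) * ev (H i l) u) (z := fun v => v) ?_ ?_
    · filter_upwards [ev_ne_zero hne] with u h1
      simp [hκ, h1]
    · filter_upwards [key, eventually_ne 0] with u hu hu0
      filter_upwards [hu, eventually_ne 0] with v hv hv0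
      simp only [ex, hlt, if_true] at hv
      have : v * v⁻¹ = 1 := mul_inv_cancel₀ hv0
      linear_combination v * hv + (q⁻¹ * u * ev (H i l) v) * this

/-- The equation with a repeated first index. -/
lemma three_eq (D : DiagData q H d) {i k l : Fin N} (hik : i ≠ k) (hil : i ≠ l) (hkl : k ≠ l) :
    ∀ᶠ u in cofinite, ∀ᶠ v in cofinite,
      (q - q⁻¹ * (u / v)) * ((1 - (u * v)⁻¹) * (ev (H i k) u * ev (H i l) v)
          + ex q (u * v)⁻¹ k i * (d i * ev (H k l) v))
        = (1 - u / v) * ((1 - (u * v)⁻¹) * (ev (H i k) u * ev (H i l) v)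
          + ex q (u * v)⁻¹ l i * (ev (H l k) u * d i))
        + ex q (u / v) l k * ((1 - (u * v)⁻¹) * (ev (H i l) u * ev (H i k) v)
          + ex q (u * v)⁻¹ k i * (ev (H k l) u * d i)) := by
  filter_upwards [D.sol] with u hu
  filter_upwards [hu] with v hv
  have := hv i i k l
  simp only [D.diag, wt_self, ex_self, wt_of_ne q _ hil, wt_of_ne q _ hik, wt_of_ne q _ hkl,
    zero_mul, add_zero] at this
  exact this

/-- Inserting the ratio into the component `(k, l, k, l)` leaves a product of `H k l` at `u` and at
`v` with a factor containing `1 + q²` or `1 + q⁻²`. This is the point where `q² ≠ -1` enters. -/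
lemma ratio_eq_zero (D : DiagData q H d) {k l : Fin N} (hkl : k < l)
    (h : (∀ᶠ u in cofinite, ev (H l k) u = q * ev (H k l) u) ∨
      ∀ᶠ u in cofinite, u ^ 2 * ev (H k l) u = q * ev (H l k) u) :
    H k l = 0 ∧ H l k = 0 := by
  have hκ := sub_inv_ne_zero D.hq D.hq2
  have hz : H k l = 0 → H k l = 0 ∧ H l k = 0 := fun h0 => by
    refine ⟨h0, ratFunc_ext ?_⟩
    rcases h with h | h
    · filter_upwards [h] with u hu
      rw [hu, h0]; simp
    · filter_upwards [h] with u hu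
      rw [h0] at hu
      simpa [D.hq] using hu.symm
  apply hz
  by_contra hne
  have hq' : 1 + q ^ 2 ≠ 0 := fun h => D.hq4 (by linear_combination h)
  have hqq := mul_inv_cancel₀ D.hq
  rcases h with h | h
  · obtain ⟨u, hu, hu0, h0, h1⟩ :=
      (D.sol.and ((eventually_ne 0).and ((ev_ne_zero hne).and h))).exists
    obtain ⟨v, hv, hv0, h0', h1', hx, hy⟩ := (hu.and ((eventually_ne 0).and ((ev_ne_zero hne).and
      (h.and ((eventually_div_ne_one u).and (eventually_inv_ne_one u)))))).exists
    have := hv k l k l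
    simp only [D.diag, wt_self, ex_self, wt_of_ne q _ hkl.ne, wt_of_ne q _ hkl.ne',
      ex_of_lt q _ hkl, ex_of_gt q _ hkl, h1,
      h1'] at this
    have h2 : (q - q⁻¹) * ((1 + q ^ 2) * ((1 - u / v) * (1 - (u * v)⁻¹))) *
        (ev (H k l) u * ev (H k l) v) = 0 := by
      linear_combination (exp := 1) this + (q - q⁻¹) * (u * v)⁻¹ * (1 - u / v) *
        (ev (H k l) u * ev (H k l) v) * hqq
    exact mul_ne_zero (mul_ne_zero hκ (mul_ne_zero hq' (mul_ne_zero hx hy)))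
      (mul_ne_zero h0 h0') h2
  · obtain ⟨u, hu, hu0, h0, h1⟩ :=
      (D.sol.and ((eventually_ne 0).and ((ev_ne_zero hne).and h))).exists
    obtain ⟨v, hv, hv0, h0', h1', hx, hy⟩ := (hu.and ((eventually_ne 0).and ((ev_ne_zero hne).and
      (h.and ((eventually_div_ne_one u).and (eventually_inv_ne_one u)))))).exists
    have := hv k l k l
    have e1 : ev (H l k) u = q⁻¹ * u ^ 2 * ev (H k l) u := by
      have := D.hq
      field_simp
      linear_combination -h1
    have e2 : ev (H l k) v = q⁻¹ * v ^ 2 * ev (H k l) v := by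
      have := D.hq
      field_simp
      linear_combination -h1'
    simp only [D.diag, wt_self, ex_self, wt_of_ne q _ hkl.ne, wt_of_ne q _ hkl.ne',
      ex_of_lt q _ hkl, ex_of_gt q _ hkl, e1,
      e2] at this
    have hY : u * v * (u * v)⁻¹ = 1 := mul_inv_cancel₀ (mul_ne_zero hu0 hv0)
    obtain ⟨y, hy'⟩ : ∃ y, y = (u * v)⁻¹ := ⟨_, rfl⟩
    rw [← hy'] at this hY hy
    obtain ⟨x, hx'⟩ : ∃ x, x = u / v := ⟨_, rfl⟩
    rw [← hx'] at this hx
    have hu' : u = x * v := by rw [hx']; field_simp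
    have h2 : (q - q⁻¹) * ((1 + q⁻¹ ^ 2) * ((1 - x) * (1 - u * v))) *
        (ev (H k l) u * ev (H k l) v) = 0 := by
      generalize ev (H k l) u = f at this ⊢
      subst hu'
      linear_combination (exp := 1) this + (q - q⁻¹) * (1 - x) * (f * ev (H k l) v) *
        (q⁻¹ ^ 2 * (x * v * v - 1) * hY + x * v * v * hqq)
    have h3 : 1 + q⁻¹ ^ 2 ≠ 0 := fun h => hq' (by linear_combination q ^ 2 * h
      - (q * q⁻¹ + 1) * hqq)
    have h4 : 1 - u * v ≠ 0 := fun h => hy (by linear_combination -hY - y * h)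
    exact mul_ne_zero (mul_ne_zero hκ (mul_ne_zero h3 (mul_ne_zero hx h4)))
      (mul_ne_zero h0 h0') h2

/-- A zero in row `i` removes the quadratic terms of `three_eq`, and the rest has the shape of
`eq_of_moving_pole`. If `i` is not between `k` and `l`, the two weights in `y` coincide and cancel.
Otherwise they differ by a factor `y = 1/(uv)`, and the lemma applies to `u⁻¹ H_{lk}` and `u
H_{kl}`. Either way the ratio is one excluded by `ratio_eq_zero`. -/
lemma pair_eq_zero_of_lt (D : DiagData q H d) {i k l : Fin N} (hi : d i ≠ 0) (hik : i ≠ k)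
    (hil : i ≠ l) (hkl : k < l) (h : H i k = 0 ∨ H i l = 0) : H k l = 0 ∧ H l k = 0 := by
  have hκ := sub_inv_ne_zero D.hq D.hq2
  have h0 : ∀ u v, ev (H i k) u * ev (H i l) v = 0 := fun u v => by
    rcases h with h | h <;> simp [h]
  have h1 : ∀ u v, ev (H i l) u * ev (H i k) v = 0 := fun u v => by
    rcases h with h | h <;> simp [h]
  by_cases hb : k < i ∧ i < l
  · have e := D.three_eq hil hik hkl.ne'
    simp only [h0, h1, mul_zero, zero_add, ex_of_gt q _ hb.2, ex_of_lt q _ hb.1,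
      ex_of_lt q _ hkl] at e
    refine D.ratio_eq_zero hkl (Or.inr ?_)
    have := eq_of_moving_pole D.hq D.hq2 (f := fun u => u⁻¹ * ev (H l k) u)
      (g := fun u => u * ev (H k l) u) ?_
    · filter_upwards [this, eventually_ne 0] with u hu hu0
      field_simp at hu
      exact hu
    · filter_upwards [e, eventually_ne 0] with u hu hu0
      filter_upwards [hu, eventually_ne 0] with v hv hv0
      have hκd := mul_ne_zero hκ hi
      apply mul_left_cancel₀ hκd
      have hU : u * u⁻¹ = 1 := mul_inv_cancel₀ hu0
      have hV : v * v⁻¹ = 1 := mul_inv_cancel₀ hv0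
      have hY : u * v * (u * v)⁻¹ = 1 := mul_inv_cancel₀ (mul_ne_zero hu0 hv0)
      rw [div_eq_mul_inv] at hv
      generalize (u * v)⁻¹ = y at hv hY
      linear_combination (exp := 1) u * v * hv + (q - q⁻¹) * d i *
        ((q * hV - (q - q⁻¹ * (u * v⁻¹)) * hY) * ev (H l k) v - u ^ 2 * ev (H k l) u * hV
          - (q - q⁻¹) * ev (H l k) u * (hU - hY))
  · have e := D.three_eq hik hil hkl.ne
    simp only [h0, h1, mul_zero, zero_add, ex_of_gt q _ hkl] at e
    refine D.ratio_eq_zero hkl (Or.inl ?_)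
    refine eq_of_moving_pole D.hq D.hq2 ?_
    filter_upwards [e, eventually_ne 0] with u hu hu0
    filter_upwards [hu, eventually_ne 0] with v hv hv0
    have hV : v * v⁻¹ = 1 := mul_inv_cancel₀ hv0
    obtain ⟨E, hE, h2, h3⟩ : ∃ E, E ≠ 0 ∧ ex q (u * v)⁻¹ k i = E ∧ ex q (u * v)⁻¹ l i = E := by
      rcases lt_or_gt_of_ne hik with h4 | h4
      · exact ⟨(q - q⁻¹) * (u * v)⁻¹, by simp [hκ, hu0, hv0], ex_of_gt q _ h4,
          ex_of_gt q _ (h4.trans hkl)⟩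
      · have h5 : l < i := lt_of_le_of_ne (not_lt.mp fun h => hb ⟨h4, h⟩) hil.symm
        exact ⟨q - q⁻¹, hκ, ex_of_lt q _ h4, ex_of_lt q _ h5⟩
    rw [h2, h3, div_eq_mul_inv] at hv
    apply mul_left_cancel₀ (mul_ne_zero hE hi)
    linear_combination (exp := 1) v * hv + E * d i * u * hV *
      (q⁻¹ * ev (H k l) v - ev (H l k) u + (q - q⁻¹) * ev (H k l) u)

lemma pair_eq_zero (D : DiagData q H d) {i k l : Fin N} (hi : d i ≠ 0) (hik : i ≠ k)
    (hil : i ≠ l) (hkl : k ≠ l) (h : H i k = 0) : H k l = 0 ∧ H l k = 0 := by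
  rcases lt_or_gt_of_ne hkl with h1 | h1
  · exact D.pair_eq_zero_of_lt hi hik hil h1 (Or.inl h)
  · exact (D.pair_eq_zero_of_lt hi hil hik h1 (Or.inr h)).symm

/-- One zero `H i k` empties row `k` off the diagonal. As the row is nonzero, `d k ≠ 0`, and row `k`
can now play the role of row `i` for every pair of indices. -/
lemma offdiag_eq_zero (D : DiagData q H d) (hrow : ∀ i, ∃ j, H i j ≠ 0) {i k : Fin N}
    (hi : d i ≠ 0) (hik : i ≠ k) (h : H i k = 0) : ∀ l m, l ≠ m → H l m = 0 := by
  have hk : ∀ l, k ≠ l → H k l = 0 := fun l hkl => by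
    by_cases hil : i = l
    · rw [← hil]; exact D.transpose_eq_zero hi hik h
    · exact (D.pair_eq_zero hi hik hil hkl h).1
  have hdk : d k ≠ 0 := by
    obtain ⟨j, hj⟩ := hrow k
    have : j = k := by
      by_contra hne
      exact hj (hk j (Ne.symm hne))
    rintro h0
    apply hj
    rw [this, D.diag_eq, h0, map_zero]
  intro l m hlm
  by_cases hkl : k = l
  · rw [← hkl]; exact hk m (hkl ▸ hlm)
  by_cases hkm : k = m
  · rw [← hkm]; exact D.transpose_eq_zero hdk hkl (hk l hkl)
  exact (D.pair_eq_zero hdk hkl hkm hlm (hk l hkl)).1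

/-- If `d l = 0`, row and column `l` have their only nonzero entries at `i`. For a third index `k`,
which exists since `N ≥ 3`, `three_eq` then becomes the relation excluded by `not_both_ne_zero` for
`H i k` and `H i l`. -/
lemma all_ne_zero (D : DiagData q H d) (hN : 3 ≤ N) {i : Fin N} (hi : d i ≠ 0)
    (h : ∀ k, k ≠ i → H i k ≠ 0) (l : Fin N) : d l ≠ 0 := by
  intro h0
  have hl : i ≠ l := by rintro rfl; exact hi h0
  obtain ⟨k, hk⟩ : ∃ k, k ∉ ({i, l} : Finset (Fin N)) := by
    by_contra! hc
    have := Finset.card_le_card (Finset.subset_iff.mpr fun x (_ : x ∈ Finset.univ) => hc x)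
    have h2 := Finset.card_le_two (a := i) (b := l)
    simp only [Finset.card_univ, Fintype.card_fin] at this
    omega
  simp only [Finset.mem_insert, Finset.mem_singleton, not_or] at hk
  have hll : H l l = 0 := by rw [D.diag_eq, h0, map_zero]
  have hil := h l hl.symm
  have hli : H l i ≠ 0 := fun hz => hil (D.eq_zero_of_transpose hi hl hz)
  have hlk : H l k = 0 := by
    by_contra hne
    exact hk.1 (D.sol.row_unique D.hq D.ne_one hll hne hli)
  have hkl : H k l = 0 := by
    by_contra hne
    exact hk.1 (D.sol.col_unique D.hq D.ne_one hll hne hil)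
  refine not_both_ne_zero D.hq D.ne_one hk.2 (ev_ne_zero (h k hk.1)) (ev_ne_zero hil) ?_
  filter_upwards [D.three_eq (Ne.symm hk.1) hl hk.2] with u hu
  filter_upwards [hu, eventually_inv_ne_one u] with v hv hy
  simp only [hlk, hkl, ev_zero, zero_mul, mul_zero, add_zero] at hv
  apply mul_left_cancel₀ hy
  linear_combination hv

lemma matches_diag (D : DiagData q H d) (hd : ∀ i, d i ≠ 0) (h : ∀ l m, l ≠ m → H l m = 0) :
    Matches H diagModel := by
  choose γ hγ using fun i => IsAlgClosed.exists_pow_nat_eq (d i) (n := 2) two_pos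
  refine ⟨1, 1, 0, γ, one_ne_zero, isRotation_one, fun i h0 => hd i ?_, ?_⟩
  · rw [← hγ, h0]; simp
  · filter_upwards [eventually_ne 0] with u _ i j
    by_cases hij : i = j
    · subst hij
      simp [diagModel, D.diag, ← hγ i, ev, sq]
    · simp [diagModel, hij, h i j hij]

end DiagData

/-! ### Unit diagonal without zero entries: the dense family -/

namespace DiagData
variable {q : ℂ} {H : RatMatrix N}

/-- For fixed `u` the component `(i, i, i, l)` expresses `(q²v² - 1) H_{il}(v)` as an affine
function of `v`. Its coefficients cannot depend on `u`, and read as functions of `u` they determine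
`H_{li}` as well. -/
lemma exists_pair_form (D : DiagData q H 1) {i l : Fin N} (hil : i < l) :
    ∃ a b : ℂ, ∀ᶠ u in cofinite, (q ^ 2 * u ^ 2 - 1) * ev (H i l) u = a * u + b ∧
      q * ((q ^ 2 * u ^ 2 - 1) * ev (H l i) u) = -u * (b * q ^ 2 * u + a) := by
  have hκ := sub_inv_ne_zero D.hq D.hq2
  have hqq := mul_inv_cancel₀ D.hq
  have key : ∀ᶠ u in cofinite, ∀ᶠ v in cofinite, (q ^ 2 * v ^ 2 - 1) * ev (H i l) v
      = (q * (u⁻¹ * ev (H l i) u) + q ^ 2 * u * ev (H i l) u) * v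
        + -(q * ev (H l i) u + ev (H i l) u) := by
    filter_upwards [D.sol, eventually_ne 0] with u hu hu0
    filter_upwards [hu, eventually_ne 0] with v hv hv0
    have := hv i i i l
    simp only [D.diag, wt_self, ex_self, wt_of_ne q _ hil.ne, ex_of_gt q _ hil, Pi.one_apply]
      at this
    have hU : u * u⁻¹ = 1 := mul_inv_cancel₀ hu0
    have hV : v * v⁻¹ = 1 := mul_inv_cancel₀ hv0
    rw [mul_inv, div_eq_mul_inv] at this
    have h2 : (q - q⁻¹) * (q - q⁻¹ * v⁻¹ ^ 2) * ev (H i l) v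
        = (q - q⁻¹) * ((1 - u * v⁻¹) * (u⁻¹ * v⁻¹) * ev (H l i) u
          + u * v⁻¹ * (q - q⁻¹ * (u⁻¹ * v⁻¹)) * ev (H i l) u) := by
      linear_combination (exp := 1) this + ev (H i l) v * ((u * v⁻¹ + u⁻¹ * v⁻¹ - v⁻¹ ^ 2 - 1) * hqq
        + (1 - q⁻¹ ^ 2) * v⁻¹ ^ 2 * hU)
    rw [mul_assoc] at h2
    have h3 := mul_left_cancel₀ hκ h2
    have hq := D.hq
    field_simp at h3 ⊢
    linear_combination h3
  obtain ⟨u₀, h₀⟩ := key.exists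
  refine ⟨q * (u₀⁻¹ * ev (H l i) u₀) + q ^ 2 * u₀ * ev (H i l) u₀,
    -(q * ev (H l i) u₀ + ev (H i l) u₀), (h₀.and (key.and (eventually_ne 0))).mono ?_⟩
  rintro u ⟨h1, hu, hu0⟩
  obtain ⟨h2, h3⟩ := linear_coeffs_zero (b := (q * (u₀⁻¹ * ev (H l i) u₀) + q ^ 2 * u₀ * ev (H i l) u₀)
    - (q * (u⁻¹ * ev (H l i) u) + q ^ 2 * u * ev (H i l) u))
    (a := -(q * ev (H l i) u₀ + ev (H i l) u₀) + (q * ev (H l i) u + ev (H i l) u)) <| by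
      filter_upwards [h₀, hu] with v e₀ e₁
      linear_combination e₁ - e₀
  refine ⟨h1, ?_⟩
  generalize q * (u₀⁻¹ * ev (H l i) u₀) + q ^ 2 * u₀ * ev (H i l) u₀ = a at *
  generalize -(q * ev (H l i) u₀ + ev (H i l) u₀) = b at *
  linear_combination (q ^ 2 * u ^ 2 - 1) * h2 - h1

lemma triple_relations (D : DiagData q H 1) {i k l : Fin N} (hik : i < k) (hkl : k < l)
    {a b a' b' a'' b'' : ℂ}
    (h₁ : ∀ᶠ u in cofinite, (q ^ 2 * u ^ 2 - 1) * ev (H i k) u = a * u + b)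
    (h₂ : ∀ᶠ u in cofinite, (q ^ 2 * u ^ 2 - 1) * ev (H i l) u = a' * u + b')
    (h₃ : ∀ᶠ u in cofinite, (q ^ 2 * u ^ 2 - 1) * ev (H k l) u = a'' * u + b'' ∧
      q * ((q ^ 2 * u ^ 2 - 1) * ev (H l k) u) = -u * (b'' * q ^ 2 * u + a'')) :
    a * a' = q ^ 2 * (b * b') ∧ a' * b = a * b' ∧ a' * b = -(q + 1) * a'' ∧
      b * b' = -(q + 1) * b'' := by
  have hκ := sub_inv_ne_zero D.hq D.hq2
  have hqq := mul_inv_cancel₀ D.hq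
  have hq1 : q - 1 ≠ 0 := sub_ne_zero.mpr D.ne_one
  have key : ∀ᶠ u in cofinite, ∀ᶠ v in cofinite,
      (q * v + u) * (a * u + b) * (a' * v + b') - (q + 1) * u * (a' * u + b') * (a * v + b)
        = (q + 1) * q * (u - v) * (a'' * (u + v) + b'' * (1 + q ^ 2 * u * v)) := by
    filter_upwards [D.three_eq hik.ne (hik.trans hkl).ne hkl.ne, h₁, h₂, h₃, eventually_ne 0]
      with u hu e1 e2 e3 hu0
    filter_upwards [hu, h₁, h₂, h₃, eventually_ne 0, eventually_ne u⁻¹]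
      with v hv f1 f2 f3 hv0 hv1
    obtain ⟨e3, e4⟩ := e3
    obtain ⟨f3, -⟩ := f3
    simp only [ex_of_gt q _ hik, ex_of_gt q _ (hik.trans hkl), ex_of_gt q _ hkl,
      Pi.one_apply, one_mul, mul_one] at hv
    have hv' : q * (q * v + u) * (u * v - 1) * (ev (H i k) u * ev (H i l) v)
        + (q + 1) * (q ^ 2 * v - u) * ev (H k l) v
        = (q + 1) * q * (v - u) * ev (H l k) u
          + (q + 1) * q * u * (u * v - 1) * (ev (H i l) u * ev (H i k) v)
          + (q + 1) * (q ^ 2 - 1) * u * ev (H k l) u := by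
      apply mul_left_cancel₀ hq1
      have hq := D.hq
      field_simp at hv
      linear_combination hv
    have huv : u * v - 1 ≠ 0 := by
      rw [sub_ne_zero]
      exact fun h => hv1 (eq_inv_of_mul_eq_one_right h)
    apply mul_left_cancel₀ (mul_ne_zero D.hq huv)
    linear_combination (exp := 1) (q ^ 2 * u ^ 2 - 1) * (q ^ 2 * v ^ 2 - 1) * hv'
      - q * (q * v + u) * (u * v - 1) * (e1 * ((q ^ 2 * v ^ 2 - 1) * ev (H i l) v)
        + (a * u + b) * f2)
      - (q + 1) * (q ^ 2 * v - u) * (q ^ 2 * u ^ 2 - 1) * f3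
      + (q + 1) * (v - u) * (q ^ 2 * v ^ 2 - 1) * e4
      + (q + 1) * q * u * (u * v - 1) * (e2 * ((q ^ 2 * v ^ 2 - 1) * ev (H i k) v)
        + (a' * u + b') * f1)
      + (q + 1) * (q ^ 2 - 1) * u * (q ^ 2 * v ^ 2 - 1) * e3
  -- The denominators and the common factor `u v - 1` are gone. The coefficients of `v⁰` and `v²`,
  -- each affine in `u` up to a monomial factor, already contain all four relations.
  have hc : ∀ᶠ u in cofinite,
      (b' * b - (q + 1) * b * b' - (q + 1) * q * b'')
        + (b' * a - (q + 1) * b * a' - (q + 1) * q * a'') * u = 0 ∧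
      (a' * b + (q + 1) * a'') + (a' * a + (q + 1) * q ^ 2 * b'') * u = 0 := by
    filter_upwards [key, eventually_ne 0] with u hu hu0
    obtain ⟨c0, -, c2, -⟩ := quartic_coeffs_zero (d := 0) (e := 0)
      (a := u * (b' * (a * u + b) - (q + 1) * b * (a' * u + b')
        - (q + 1) * q * (a'' * u + b'')))
      (b := q * b' * (a * u + b) + u * a' * (a * u + b) - (q + 1) * u * a * (a' * u + b')
        - (q + 1) * q * (b'' * q ^ 2 * u ^ 2 - b''))
      (c := q * (a' * (a * u + b) + (q + 1) * (a'' + b'' * q ^ 2 * u))) <| by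
        filter_upwards [hu] with v hv
        linear_combination hv
    have c0' := (mul_eq_zero.mp c0).resolve_left hu0
    have c2' := (mul_eq_zero.mp c2).resolve_left D.hq
    exact ⟨by linear_combination c0', by linear_combination c2'⟩
  obtain ⟨r1, r2⟩ := linear_coeffs_zero (hc.mono fun _ h => h.1)
  obtain ⟨r3, r4⟩ := linear_coeffs_zero (hc.mono fun _ h => h.2)
  have s1 : b * b' = -(q + 1) * b'' := by
    apply mul_left_cancel₀ D.hq
    linear_combination -r1
  refine ⟨by linear_combination r4 - q ^ 2 * s1, ?_, by linear_combination r3, s1⟩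
  linear_combination -r2 - q * r3

/-- The entries attached to a pair of indices agree with the dense model. -/
def IsDensePair (q : ℂ) (H : RatMatrix N) (δ : ℂ) (i l : Fin N) (γ : ℂ) : Prop :=
  ∀ᶠ u in cofinite, (1 + q * (δ * u)) * ev (H i l) u = (1 + q) * γ ∧
    (1 + q * (δ * u)) * ev (H l i) u = (1 + q) * γ * (δ * u)

lemma one_add_ne_zero (D : DiagData q H 1) : 1 + q ≠ 0 := fun h => D.hq2 (by
  linear_combination (q - 1) * h)

/-- Here `a u + b = -b (δ q u - 1)`, which cancels one factor of `q²u² - 1 = (δ q u - 1)(δ q u +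
1)`. -/
lemma isDensePair_of_form (D : DiagData q H 1) {i l : Fin N} {a b δ : ℂ} (hδ : δ ^ 2 = 1)
    (ha : a = -δ * q * b)
    (h : ∀ᶠ u in cofinite, (q ^ 2 * u ^ 2 - 1) * ev (H i l) u = a * u + b ∧
      q * ((q ^ 2 * u ^ 2 - 1) * ev (H l i) u) = -u * (b * q ^ 2 * u + a)) :
    IsDensePair q H δ i l (-b / (1 + q)) := by
  have hc := D.one_add_ne_zero
  have hδ0 : δ ≠ 0 := by rintro rfl; simp at hδ
  filter_upwards [h, eventually_ne (δ * q)⁻¹] with u hu hu1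
  have hn : δ * q * u - 1 ≠ 0 := by
    rw [sub_ne_zero]
    exact fun h => hu1 (eq_inv_of_mul_eq_one_right h)
  have e : (1 + q) * (-b / (1 + q)) = -b := by field_simp
  rw [e]
  subst ha
  constructor
  · apply mul_left_cancel₀ hn
    linear_combination hu.1 + q ^ 2 * u ^ 2 * ev (H i l) u * hδ
  · apply mul_left_cancel₀ (mul_ne_zero D.hq hn)
    linear_combination hu.2 + q * (q ^ 2 * u ^ 2 * ev (H l i) u + b * q * u ^ 2) * hδ

/-- These are `three_eq` with `k` and with `l` as the repeated index; `triple_relations` treats the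
smallest index `i`, which gives `γ'' = γ γ'`. Together they force `γ² = γ'² = 1`. -/
lemma dense_cyclic (D : DiagData q H 1) {i k l : Fin N} (hik : i < k) (hkl : k < l)
    {δ γ γ' γ'' : ℂ} (hδ : δ ^ 2 = 1) (h₁ : IsDensePair q H δ i k γ)
    (h₂ : IsDensePair q H δ i l γ') (h₃ : IsDensePair q H δ k l γ'') :
    γ * γ'' = γ' ∧ γ' * γ'' = γ := by
  have hκ := sub_inv_ne_zero D.hq D.hq2
  have hq := D.hq
  have hc := D.one_add_ne_zero
  have hq1 : q - 1 ≠ 0 := sub_ne_zero.mpr D.ne_one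
  have hδ0 : δ ≠ 0 := by rintro rfl; simp at hδ
  have hil := hik.trans hkl
  obtain ⟨u, hu, hu', e1, e2, e3, hu0⟩ := ((D.three_eq hik.ne' hkl.ne hil.ne).and
    ((D.three_eq hil.ne' hkl.ne' hik.ne).and (h₁.and (h₂.and (h₃.and (eventually_ne 0)))))).exists
  obtain ⟨v, hv, hv', f1, f2, f3, hv0, hvu, hv1⟩ := (hu.and (hu'.and (h₁.and (h₂.and (h₃.and
    ((eventually_ne 0).and ((eventually_ne u).and (eventually_ne u⁻¹)))))))).exists
  have huv : u * v - 1 ≠ 0 := by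
    rw [sub_ne_zero]
    exact fun h => hv1 (eq_inv_of_mul_eq_one_right h)
  have hvu' := sub_ne_zero.mpr hvu
  simp only [ex_of_gt q _ hik, ex_of_gt q _ hil, ex_of_gt q _ hkl, ex_of_lt q _ hik,
    ex_of_lt q _ hil, ex_of_lt q _ hkl, Pi.one_apply, one_mul, mul_one] at hv hv'
  have p : q * (u * v - 1) * (q * v + u) * (ev (H k i) u * ev (H k l) v)
      + (q + 1) * (q ^ 2 * v - u) * (u * v) * ev (H i l) v
      = (q + 1) * q * (v - u) * ev (H l i) u + u * (q + 1) *
        (q * (u * v - 1) * (ev (H k l) u * ev (H k i) v)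
          + (q ^ 2 - 1) * (u * v) * ev (H i l) u) := by
    apply mul_left_cancel₀ hq1
    field_simp at hv
    linear_combination hv
  have p' : q * (u * v - 1) * (q * v + u) * (ev (H l i) u * ev (H l k) v)
      + (q + 1) * (q ^ 2 * v - u) * (u * v) * ev (H i k) v
      = (q + 1) * q * (v - u) * (u * v) * ev (H k i) u + u * (q + 1) *
        (q * (u * v - 1) * (ev (H l k) u * ev (H l i) v)
          + (q ^ 2 - 1) * (u * v) * ev (H i k) u) := by
    apply mul_left_cancel₀ hq1
    field_simp at hv'
    linear_combination hv'
  clear hv hv' hu hu' h₁ h₂ h₃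
  constructor
  · have hn : q * (1 + q) ^ 2 * δ * u * (u * v - 1) * (v - u) ≠ 0 := by
      simp [hq, hc, hδ0, hu0, huv, hvu']
    apply mul_left_cancel₀ hn
    linear_combination (exp := 1) -(1 + q * (δ * u)) * (1 + q * (δ * v)) * p
      + q * (u * v - 1) * (q * v + u) * (e1.2 * ((1 + q * (δ * v)) * ev (H k l) v)
        + (1 + q) * γ * (δ * u) * f3.1)
      + (q + 1) * (q ^ 2 * v - u) * (u * v) * (1 + q * (δ * u)) * f2.1
      - (q + 1) * q * (v - u) * (1 + q * (δ * v)) * e2.2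
      - u * (q + 1) * (q * (u * v - 1) * (e3.1 * ((1 + q * (δ * v)) * ev (H k i) v)
          + (1 + q) * γ'' * f1.2)
        + (q ^ 2 - 1) * (u * v) * (1 + q * (δ * v)) * e2.1)
      - γ' * (1 + q) ^ 2 * q ^ 2 * (u * v) * (v - u) * hδ
  · have hn : q ^ 2 * (1 + q) ^ 2 * (u * v) * (u * v - 1) * (v - u) ≠ 0 := by
      simp [hq, hc, hu0, hv0, huv, hvu']
    apply mul_left_cancel₀ hn
    linear_combination (exp := 1) (1 + q * (δ * u)) * (1 + q * (δ * v)) * p'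
      - q * (u * v - 1) * (q * v + u) * (e2.2 * ((1 + q * (δ * v)) * ev (H l k) v)
        + (1 + q) * γ' * (δ * u) * f3.2)
      - (q + 1) * (q ^ 2 * v - u) * (u * v) * (1 + q * (δ * u)) * f1.1
      + (q + 1) * q * (v - u) * (u * v) * (1 + q * (δ * v)) * e1.2
      + u * (q + 1) * (q * (u * v - 1) * (e3.2 * ((1 + q * (δ * v)) * ev (H l i) v)
          + (1 + q) * γ'' * (δ * u) * f2.2)
        + (q ^ 2 - 1) * (u * v) * (1 + q * (δ * v)) * e1.1)
      + q ^ 2 * (1 + q) ^ 2 * (u * v) * (v - u) * (γ' * γ'' * (1 - u * v) + γ * (u * v)) * hδ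

lemma matches_dense (D : DiagData q H 1) (hN : 3 ≤ N) (hne : ∀ i k, i ≠ k → H i k ≠ 0) :
    ∃ δ : ℂ, (δ = 1 ∨ δ = -1) ∧ Matches H fun i j u => denseModel q i j (δ * u) := by
  have hq := D.hq
  have hc := D.one_add_ne_zero
  choose! a b hab using fun i l (h : i < l) => D.exists_pair_form (i := i) (l := l) h
  have hnz : ∀ {i l}, i < l → a i l = 0 → b i l ≠ 0 := fun {i l} hil ha hb => by
    refine hne i l hil.ne (ratFunc_ext ?_)
    filter_upwards [hab i l hil, eventually_ne (q)⁻¹, eventually_ne (-q⁻¹)] with u hu h1 h2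
    have h3 : q ^ 2 * u ^ 2 - 1 ≠ 0 := by
      have e : q ^ 2 * u ^ 2 - 1 = (q * u - 1) * (q * u + 1) := by ring
      rw [e]
      refine mul_ne_zero (fun h => h1 ?_) fun h => h2 ?_
      · exact eq_inv_of_mul_eq_one_right (sub_eq_zero.mp h)
      · field_simp
        linear_combination h
    have h4 := hu.1
    rw [ha, hb] at h4
    simpa [h3] using h4
  have htr : ∀ {i k l}, i < k → k < l → _ := fun {i k l} hik hkl =>
    D.triple_relations hik hkl ((hab i k hik).mono fun _ h => h.1)
      ((hab i l (hik.trans hkl)).mono fun _ h => h.1) (hab k l hkl)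
  have hbb : ∀ {i k l}, i < k → k < l → b i k ≠ 0 ∧ b i l ≠ 0 := fun {i k l} hik hkl => by
    obtain ⟨h1, h2, -, -⟩ := htr hik hkl
    have h3 := hnz hik
    have h4 := hnz (hik.trans hkl)
    have hb : b i k ≠ 0 := fun h => by
      rw [h, zero_mul, mul_zero] at h1
      rw [h, mul_zero] at h2
      have ha : a i k ≠ 0 := fun h' => h3 h' h
      exact h4 ((mul_eq_zero.mp h1).resolve_left ha) ((mul_eq_zero.mp h2.symm).resolve_left ha)
    refine ⟨hb, fun h => ?_⟩
    rw [h, mul_zero] at h2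
    exact h4 ((mul_eq_zero.mp h2).resolve_right hb) h
  set z : Fin N := ⟨0, by omega⟩ with hz
  set o : Fin N := ⟨1, by omega⟩ with ho
  have hzo : z < o := by simp [hz, ho]
  have hpos : ∀ k, k ≠ z → z < k := fun k hk => by
    rw [Fin.lt_def]
    exact Nat.pos_of_ne_zero fun h => hk (Fin.ext h)
  -- The relations `a a' = q² b b'` and `a' b = a b'` give `a² = q² b²`, so `a = -δ q b` with a sign
  -- `δ`; the relations for triples starting at `0` carry this sign to all other pairs.
  obtain ⟨δ, hδ, hδo⟩ : ∃ δ : ℂ, δ ^ 2 = 1 ∧ a z o = -δ * q * b z o := by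
    have hot : o < ⟨2, by omega⟩ := by simp [ho]
    obtain ⟨h1, h2, -, -⟩ := htr hzo hot
    obtain ⟨hb, hb'⟩ := hbb hzo hot
    refine ⟨-(a z o / (q * b z o)), ?_, by field_simp⟩
    have : a z o ^ 2 = q ^ 2 * b z o ^ 2 := by
      apply mul_right_cancel₀ hb'
      linear_combination b z o * h1 - a z o * h2
    field_simp
    linear_combination this
  have hδz : ∀ k, z < k → a z k = -δ * q * b z k := fun k hk => by
    by_cases hko : k = o
    · rw [hko, hδo]
    · have hok : o < k := by
        rw [Fin.lt_def] at hk ⊢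
        have : (k : ℕ) ≠ 1 := fun h => hko (Fin.ext h)
        simp only [hz, ho] at hk ⊢
        omega
      obtain ⟨-, h2, -, -⟩ := htr hzo hok
      apply mul_right_cancel₀ (hbb hzo hok).1
      rw [h2, hδo]
      ring
  have hδk : ∀ k l, k < l → a k l = -δ * q * b k l := fun k l hkl => by
    by_cases hk : k = z
    · rw [hk]; exact hδz l (hk ▸ hkl)
    · have hzk := hpos k hk
      obtain ⟨-, h2, h3, h4⟩ := htr hzk hkl
      apply mul_left_cancel₀ hc
      linear_combination h3 - b z k * hδz l (hzk.trans hkl) + δ * q * h4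
  let γ : Fin N → Fin N → ℂ := fun k l => -b k l / (1 + q)
  have hγ : ∀ k l, k < l → IsDensePair q H δ k l (γ k l) := fun k l hkl =>
    D.isDensePair_of_form hδ (hδk k l hkl) (hab k l hkl)
  have hγ3 : ∀ k l, z < k → k < l → γ k l = γ z k * γ z l := fun k l hzk hkl => by
    obtain ⟨-, -, -, h4⟩ := htr hzk hkl
    simp only [γ]
    field_simp
    linear_combination -h4
  have hcyc : ∀ k l, z < k → k < l → γ z k ^ 2 = 1 ∧ γ z l ^ 2 = 1 := fun k l hzk hkl => by
    obtain ⟨h1, h2⟩ := D.dense_cyclic hzk hkl hδ (hγ z k hzk) (hγ z l (hzk.trans hkl)) (hγ k l hkl)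
    obtain ⟨hb, hb'⟩ := hbb hzk hkl
    have n1 : γ z k ≠ 0 := by simp [γ, hb, hc]
    have n2 : γ z l ≠ 0 := by simp [γ, hb', hc]
    rw [hγ3 k l hzk hkl] at h1 h2
    constructor
    · apply mul_left_cancel₀ n2
      linear_combination h1
    · apply mul_left_cancel₀ n1
      linear_combination h2
  -- The constants factor as `γ k l = c k * c l` with base point `0`. Since `c k ^ 2 = 1`, this
  -- gauge preserves the unit diagonal.
  let c : Fin N → ℂ := fun k => if k = z then 1 else γ z k
  have hc1 : ∀ k, c k ^ 2 = 1 := fun k => by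
    simp only [c]
    split_ifs with hk
    · simp
    · have hzk := hpos k hk
      by_cases hko : k = o
      · exact (hcyc k ⟨2, by omega⟩ hzk (by rw [hko]; simp [ho])).1
      · refine (hcyc o k hzo ?_).2
        rw [Fin.lt_def] at hzk ⊢
        have : (k : ℕ) ≠ 1 := fun h => hko (Fin.ext h)
        simp only [hz, ho] at hzk ⊢
        omega
  have hγc : ∀ k l, k < l → γ k l = c k * c l := fun k l hkl => by
    by_cases hk : k = z
    · have hl : l ≠ z := by rintro rfl; rw [hk] at hkl; exact lt_irrefl _ hkl
      simp [c, hk, hl]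
    · have hl : l ≠ z := by
        rintro rfl
        exact (lt_irrefl _ ((hpos k hk).trans hkl))
      simp only [c, hk, hl, if_false]
      exact hγ3 k l (hpos k hk) hkl
  have hδ0 : δ ≠ 0 := by rintro rfl; simp at hδ
  have hg : ∀ᶠ u in cofinite, ev (RatFunc.C 1 + RatFunc.C (q * δ) * RatFunc.X) u
      = 1 + q * (δ * u) := by
    filter_upwards [ev_add (RatFunc.C 1) (RatFunc.C (q * δ) * RatFunc.X),
      ev_mul (RatFunc.C (q * δ)) RatFunc.X] with u h1 h2
    rw [h1, h2]
    simp only [ev, RatFunc.eval_C, RatFunc.eval_X, RingHom.id_apply]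
    ring
  have hn : ∀ᶠ u in cofinite, 1 + q * (δ * u) ≠ 0 := by
    filter_upwards [eventually_ne (-(q * δ)⁻¹)] with u hu h
    apply hu
    field_simp
    linear_combination h
  refine ⟨δ, mul_self_eq_one_iff.mp ((sq δ).symm.trans hδ), (RatFunc.C 1 + RatFunc.C (q * δ) * RatFunc.X)⁻¹, 1, 0, c,
    ?_, isRotation_one, fun i h => ?_, ?_⟩
  · apply inv_ne_zero
    intro h
    obtain ⟨u, hu, hu'⟩ := (hg.and hn).exists
    rw [h, ev_zero] at hu
    exact hu' hu.symm
  · have := hc1 i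
    rw [h] at this
    simp at this
  · have hγ' : ∀ᶠ u in cofinite, ∀ k l, k < l → _ := eventually_all.mpr fun k =>
      eventually_all.mpr fun l => eventually_imp_distrib_left.mpr fun h => hγ k l h
    filter_upwards [hγ', hg, hn, ev_inv (RatFunc.C 1 + RatFunc.C (q * δ) * RatFunc.X)]
      with u h1 h2 h3 h4 i j
    rw [h4, h2]
    simp only [Equiv.Perm.coe_one, id_eq, Pi.zero_apply, pow_zero, inv_one, mul_one]
    rw [← div_eq_inv_mul, div_mul_eq_mul_div, eq_div_iff h3]
    rcases lt_trichotomy i j with h | h | h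
    · rw [mul_comm, (h1 i j h).1, hγc i j h]
      simp only [denseModel, h.ne, h, if_true, if_false]
      ring
    · subst h
      simp only [denseModel, if_true, D.diag, Pi.one_apply]
      linear_combination -(1 + q * (δ * u)) * hc1 i
    · rw [mul_comm, (h1 j i h).2, hγc j i h]
      simp only [denseModel, h.ne', h.not_gt, if_false]
      ring

end DiagData
-- Normalising the diagonal
lemma ev_gauge (f : RatFunc ℂ) (δ : Fin N → ℂ) (H : RatMatrix N) : ∀ᶠ u in cofinite, ∀ k l,
    ev (RatFunc.C (δ k * δ l) * (f * H k l)) u = ev f u * (δ k * δ l) * ev (H k l) u := by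
  refine eventually_all.mpr fun k => eventually_all.mpr fun l => ?_
  filter_upwards [ev_mul (RatFunc.C (δ k * δ l)) (f * H k l), ev_mul f (H k l)] with u h1 h2
  rw [h1, h2]
  simp only [ev, RatFunc.eval_C, RingHom.id_apply]
  ring

lemma RatSol.gauge {q : ℂ} {H : RatMatrix N} (hH : RatSol q H) (f : RatFunc ℂ) (δ : Fin N → ℂ) :
    RatSol q fun k l => RatFunc.C (δ k * δ l) * (f * H k l) :=
  TwistedSol.gauge hH δ (ev f) (ev_gauge f δ H)

lemma Matches.of_gauge {H : RatMatrix N} {m : Fin N → Fin N → ℂ → ℂ} {f : RatFunc ℂ}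
    {δ : Fin N → ℂ} (hf : f ≠ 0) (hδ : ∀ i, δ i ≠ 0)
    (h : Matches (fun k l => RatFunc.C (δ k * δ l) * (f * H k l)) m) : Matches H m := by
  obtain ⟨g, σ, d, γ, hg, hσ, hγ, h⟩ := h
  refine ⟨g * f⁻¹, σ, d, fun i => γ i / δ (σ i), mul_ne_zero hg (inv_ne_zero hf), hσ,
    fun i => div_ne_zero (hγ i) (hδ _), ?_⟩
  filter_upwards [h, ev_gauge f δ H, ev_mul g f⁻¹, ev_inv f, ev_ne_zero hf]
    with u h1 h2 h3 h4 h5 i j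
  have h6 := h1 i j
  rw [h2] at h6
  rw [h3, h4]
  have hi := hδ (σ i)
  have hj := hδ (σ j)
  generalize u ^ d j * (u ^ d i)⁻¹ = w at *
  field_simp
  linear_combination h6

/-- In the component `(i, i, k, k)` a common weight cancels, leaving `H_{ii}(u) H_{kk}(v) =
H_{kk}(u) H_{ii}(v)`. -/
lemma RatSol.diag_eq_const_mul {q : ℂ} (hq : q ≠ 0) (hq2 : q ^ 2 ≠ 1) {H : RatMatrix N}
    (hH : RatSol q H) {i : Fin N} (hi : H i i ≠ 0) (k : Fin N) :
    ∃ c : ℂ, H k k = RatFunc.C c * H i i := by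
  by_cases hik : i = k
  · exact ⟨1, by simp [hik]⟩
  have hκ := sub_inv_ne_zero hq hq2
  obtain ⟨u, hu, h0, hu0⟩ := (hH.and ((ev_ne_zero hi).and (eventually_ne 0))).exists
  refine ⟨ev (H k k) u / ev (H i i) u, ratFunc_ext ?_⟩
  filter_upwards [hu, eventually_ne 0, eventually_ne (q⁻¹ ^ 2 * u),
    ev_mul (RatFunc.C (ev (H k k) u / ev (H i i) u)) (H i i)] with v hv hv0 hvu hm
  have := hv i i k k
  simp only [wt_self, ex_self, wt_of_ne q _ hik, zero_mul, add_zero] at this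
  have ha : q - q⁻¹ * (u / v) ≠ 0 := fun h => hvu (by
    field_simp at h ⊢
    linear_combination h)
  have he : ex q (u * v)⁻¹ k i ≠ 0 := by
    unfold ex
    split_ifs with h1 h2
    · exact hκ
    · simp [hκ, hu0, hv0]
    · exact absurd (le_antisymm (not_lt.mp h1) (not_lt.mp h2)) hik
  have h2 : ev (H i i) u * ev (H k k) v = ev (H k k) u * ev (H i i) v := by
    apply mul_left_cancel₀ (mul_ne_zero ha he)
    linear_combination this
  rw [hm]
  simp only [ev, RatFunc.eval_C, RingHom.id_apply] at h2 h0 ⊢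
  field_simp
  linear_combination h2

theorem RatSol.matches_of_diag_ne_zero {q : ℂ} (hq : q ≠ 0) (hq2 : q ^ 2 ≠ 1) (hq4 : q ^ 2 ≠ -1)
    {H : RatMatrix N} (hH : RatSol q H) (hN : 3 ≤ N) (hrow : ∀ i, ∃ j, H i j ≠ 0) {i : Fin N}
    (hi : H i i ≠ 0) : Matches H diagModel ∨
      ∃ δ : ℂ, (δ = 1 ∨ δ = -1) ∧ Matches H fun i j u => denseModel q i j (δ * u) := by
  choose d hd using hH.diag_eq_const_mul hq hq2 hi
  have hinv := inv_ne_zero hi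
  have hmk : ∀ (γ : Fin N → ℂ) {d' : Fin N → ℂ}, (∀ k, γ k ^ 2 * d k = d' k) →
      DiagData q (fun k l => RatFunc.C (γ k * γ l) * ((H i i)⁻¹ * H k l)) d' := fun γ d' h => by
    have e : ∀ k, RatFunc.C (γ k * γ k) * ((H i i)⁻¹ * H k k) = RatFunc.C (d' k) := fun k => by
      rw [hd k, ← h k, mul_left_comm _ _ (H i i), inv_mul_cancel₀ hi, mul_one, ← map_mul, sq]
    exact ⟨hH.gauge _ γ, hq, hq2, hq4, fun k u => by rw [e k]; simp [ev], e⟩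
  have D := hmk 1 (d' := d) (by simp)
  have hz : ∀ k l, RatFunc.C ((1 : Fin N → ℂ) k * (1 : Fin N → ℂ) l) * ((H i i)⁻¹ * H k l) = 0 ↔
      H k l = 0 := fun k l => by simp [hi]
  have hdi : d i ≠ 0 := fun h => hi (by simpa [h] using hd i)
  by_cases hex : ∃ j k, d j ≠ 0 ∧ j ≠ k ∧ H j k = 0
  · obtain ⟨j, k, hj, hjk, h⟩ := hex
    have hoff := D.offdiag_eq_zero (fun a => (hrow a).imp fun b hb => (hz a b).not.mpr hb) hj hjk
      ((hz j k).mpr h)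
    refine Or.inl ((D.matches_diag (fun a ha => ?_) hoff).of_gauge hinv (by simp))
    obtain ⟨b, hb⟩ := hrow a
    by_cases hab : a = b
    · subst hab
      exact hb (by rw [hd a, ha]; simp)
    · exact hb ((hz a b).mp (hoff a b hab))
  · push Not at hex
    have hall := D.all_ne_zero hN hdi fun k hk => (hz i k).not.mpr (hex i k hdi hk.symm)
    -- A gauge multiplies the `k`-th diagonal entry by `γ k ^ 2`, so a square root of `(d k)⁻¹`
    -- makes it `1`.
    choose γ hγ using fun k => IsAlgClosed.exists_pow_nat_eq (d k)⁻¹ (n := 2) two_pos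
    have hγ0 : ∀ k, γ k ≠ 0 := fun k h => hall k (by
      have := hγ k
      rw [h] at this
      simpa using this.symm)
    have D' := hmk γ (d' := 1) fun k => by rw [hγ k]; exact inv_mul_cancel₀ (hall k)
    obtain ⟨δ, hδ, h⟩ := D'.matches_dense hN fun k l hkl => by
      simp [hi, hγ0, hex k l (hall k) hkl]
    exact Or.inr ⟨δ, hδ, h.of_gauge hinv hγ0⟩

/-! ### Lifting the classification to the transformations -/


/-- `M` is the matrix attached to the model `m`, up to a scalar and a diagonal gauge. -/
def Realizes (s : ℂ) (M : RatMatrix N) (m : Fin N → Fin N → ℂ → ℂ) : Prop :=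
  ∃ (g : RatFunc ℂ) (μ : Fin N → ℂ), g ≠ 0 ∧ (∀ i, μ i ≠ 0) ∧
    ∀ᶠ u in cofinite, ∀ i j, hfun s M i j u = ev g u * (μ i * μ j) * m i j u

lemma Realizes.solvesCtRE {s : ℂ} (hs : s ≠ 0) {M : RatMatrix N} {m : Fin N → Fin N → ℂ → ℂ}
    (h : Realizes s M m) (hm : TwistedSol (qOf s) m) : SolvesCtRE s M := by
  obtain ⟨g, μ, -, -, h⟩ := h
  rw [solvesCtRE_iff hs]
  exact hm.gauge μ (ev g) h

lemma ev_neg_X : ∀ᶠ u in cofinite, ev (-RatFunc.X : RatFunc ℂ) u = -u := by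
  filter_upwards [ev_neg RatFunc.X] with u hu
  rw [hu]; simp [ev]

lemma eval_C_ne_zero {x g : RatFunc ℂ} {c : ℂ} (hc : c ≠ 0)
    (hx : ∀ᶠ u in cofinite, ev x u = c * u) (hg : g ≠ 0) :
    RatFunc.eval RatFunc.C x g ≠ 0 := by
  intro h
  obtain ⟨u, h1, h2, h3⟩ :=
    ((ev_comp x g).and (hx.and (eventually_comp_mul (ev_ne_zero hg) hc))).exists
  rw [h, ev_zero, h2] at h1
  exact h3 h1.symm

lemma Realizes.negate {s : ℂ} (hs : s ≠ 0) {M : RatMatrix N} {m : Fin N → Fin N → ℂ → ℂ}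
    (h : Realizes s M m) :
    Realizes s (substitute (-RatFunc.X) M) fun i j u => m i j (-u) := by
  obtain ⟨g, μ, hg, hμ, h⟩ := h
  have hx : ∀ᶠ u in cofinite, ev (-RatFunc.X : RatFunc ℂ) u = -1 * u := by
    filter_upwards [ev_neg_X] with u hu
    rw [hu, neg_one_mul]
  refine ⟨RatFunc.eval RatFunc.C (-RatFunc.X) g, μ, eval_C_ne_zero (by simp) hx hg, hμ, ?_⟩
  filter_upwards [eventually_comp_mul h (neg_ne_zero.mpr one_ne_zero), ev_comp (-RatFunc.X) g, hx,
    eventually_comp_mul (ev_substitute hx M) (qTilde_ne_zero (N := N) hs)] with u h1 h2 h3 h4 i j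
  have h5 := h1 i j
  rw [h2, h3, ← neg_one_mul u, ← h5, hfun, hfun, h4]
  ring_nf

/-- The entries of `K` in the coordinates of the twisted reflection equation. -/
def hmat (s : ℂ) (K : RatMatrix N) : RatMatrix N := fun i j =>
  RatFunc.C ((-qOf s) ^ ((i.rev : ℕ) + 1)) *
    RatFunc.eval RatFunc.C (RatFunc.C (qTilde N s) * RatFunc.X) (K i.rev j)

lemma ev_hmat (s : ℂ) (K : RatMatrix N) :
    ∀ᶠ u in cofinite, ∀ i j, ev (hmat s K i j) u = hfun s K i j u := by
  refine eventually_all.mpr fun i => eventually_all.mpr fun j => ?_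
  filter_upwards [ev_mul (RatFunc.C ((-qOf s) ^ ((i.rev : ℕ) + 1)))
      (RatFunc.eval RatFunc.C (RatFunc.C (qTilde N s) * RatFunc.X) (K i.rev j)),
    ev_comp (RatFunc.C (qTilde N s) * RatFunc.X) (K i.rev j), ev_C_mul_X (qTilde N s)]
    with u h1 h2 h3
  rw [hmat, h1, h2, h3, hfun]
  simp only [ev, RatFunc.eval_C, RingHom.id_apply]

lemma ratSol_hmat {s : ℂ} (hs : s ≠ 0) {K : RatMatrix N} (h : SolvesCtRE s K) :
    RatSol (qOf s) (hmat s K) := by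
  rw [solvesCtRE_iff hs] at h
  refine h.gauge 1 1 ?_
  filter_upwards [ev_hmat s K] with u hu i j
  simp [hu]

lemma hmat_row_ne_zero {s : ℂ} (hs : s ≠ 0) {K : RatMatrix N} (hK : K.det ≠ 0) (i : Fin N) :
    ∃ j, hmat s K i j ≠ 0 := by
  obtain ⟨j, hj⟩ := exists_ne_zero_of_det_ne_zero hK i.rev
  refine ⟨j, mul_ne_zero ?_ (eval_C_ne_zero (qTilde_ne_zero (N := N) hs) (ev_C_mul_X _) hj)⟩
  simp [qOf_ne_zero hs]

/-- The agreement of `hmat s K` with the model of `M` is undone by one dressing with a rotation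
matrix, taken at `η = 1`, and one rescaling. -/
lemma Realizes.equivalentTo {s : ℂ} (hs : s ≠ 0) (hN : 0 < N) {K M : RatMatrix N}
    {m : Fin N → Fin N → ℂ → ℂ} (hM : Realizes s M m) (hK : Matches (hmat s K) m) :
    EquivalentTo s K M := by
  obtain ⟨g₀, μ, hg₀, hμ, hM⟩ := hM
  obtain ⟨g, σ, d, γ, hg, hσ, hγ, hK⟩ := hK
  obtain ⟨e, hrev⟩ := hσ.neg_qOf_pow_rev hN hs
  have ht := qTilde_ne_zero (N := N) hs
  have hq := neg_ne_zero.mpr (qOf_ne_zero hs)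
  -- The factor `q̃^{-d i}` absorbs the powers of `q̃` produced by `C` under the rotation and by `u
  -- ↦ q̃ u`. The leftover constant `(-q)^e` is removed by `G`.
  let c : Fin N → ℂ := fun i => γ i / μ i * ((qTilde N s) ^ d i)⁻¹
  have hc : ∀ i, c i ≠ 0 := fun i =>
    mul_ne_zero (div_ne_zero (hγ i) (hμ i)) (inv_ne_zero (pow_ne_zero _ ht))
  let G : RatFunc ℂ := RatFunc.C (((-qOf s) ^ e)⁻¹) *
    RatFunc.eval RatFunc.C (RatFunc.C (qTilde N s)⁻¹ * RatFunc.X) (g * g₀⁻¹)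
  have hG : G ≠ 0 := by
    refine mul_ne_zero ?_ (eval_C_ne_zero (inv_ne_zero ht) (ev_C_mul_X _)
      (mul_ne_zero hg (inv_ne_zero hg₀)))
    exact (map_ne_zero RatFunc.C).mpr (inv_ne_zero (zpow_ne_zero e hq))
  have hGe : ∀ᶠ u in cofinite, ev G u = ((-qOf s) ^ e)⁻¹ *
      (ev g ((qTilde N s)⁻¹ * u) * (ev g₀ ((qTilde N s)⁻¹ * u))⁻¹) := by
    filter_upwards [ev_mul (RatFunc.C (((-qOf s) ^ e)⁻¹))
        (RatFunc.eval RatFunc.C (RatFunc.C (qTilde N s)⁻¹ * RatFunc.X) (g * g₀⁻¹)),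
      ev_comp (RatFunc.C (qTilde N s)⁻¹ * RatFunc.X) (g * g₀⁻¹), ev_C_mul_X (qTilde N s)⁻¹,
      eventually_comp_mul ((ev_mul g g₀⁻¹).and (ev_inv g₀)) (inv_ne_zero ht)]
      with u h1 h2 h3 h4
    rw [h1, h2, h3, h4.1, h4.2]
    simp only [ev, RatFunc.eval_C, RingHom.id_apply]
  have hZ : ∀ᶠ u in cofinite, ∀ i j, ev (rotationMatrix σ d c i j) u
      = if j = σ i then c i * u ^ d i * 1 else 0 := by
    simpa only [mul_one] using ev_rotationMatrix σ d c
  have hD := ev_dress hZ M one_ne_zero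
  have htr := Transformation.dress s M 1 one_ne_zero _ (hσ.isSymmetry (qOf_ne_zero hs) hc)
  generalize antiTranspose (substitute (RatFunc.C 1 * RatFunc.X⁻¹) (rotationMatrix σ d c)) * M
    * substitute (RatFunc.C 1 * RatFunc.X) (rotationMatrix σ d c) = D at hD htr
  suffices h : K = G • D by
    rw [h]
    exact (Relation.ReflTransGen.single htr).tail (Transformation.scale s D G hG)
  have key : ∀ i j, K (σ i).rev (σ j) = G * D (σ i).rev (σ j) := by
    intro i j
    refine ratFunc_ext ?_
    have h0 := hM.and (hK.and ((ev_hmat s K).and (ev_ne_zero hg₀)))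
    filter_upwards [eventually_comp_mul h0 (inv_ne_zero ht), hD, hGe,
      ev_mul G (D (σ i).rev (σ j)), eventually_ne 0] with u h1 h2 h3 h4 hu0
    obtain ⟨h5, h6, h7, h8⟩ := h1
    have h5 := h5 i j
    have h6 := h6 i j
    rw [h4, h2, h3]
    rw [h7] at h6
    simp only [hfun, mul_inv_cancel_left₀ ht, hrev] at h5 h6
    have n1 := hμ i
    have n2 := hμ j
    have n3 := pow_ne_zero ((i.rev : ℕ) + 1) hq
    have n4 := zpow_ne_zero e hq
    have n5 := pow_ne_zero (d i) ht
    have n6 := pow_ne_zero (d j) ht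
    have n7 := pow_ne_zero (d i) hu0
    have n8 := pow_ne_zero (d j) hu0
    simp only [c, one_mul, mul_pow, inv_pow] at h6 ⊢
    generalize (-qOf s) ^ ((i.rev : ℕ) + 1) = Q at *
    generalize (-qOf s) ^ e = Q' at *
    rw [← pow_mul, mul_comm 2, pow_mul] at h6
    generalize qTilde N s ^ d i = t at *
    generalize qTilde N s ^ d j = t' at *
    generalize u ^ d i = w at *
    generalize u ^ d j = w' at *
    generalize ev (K (σ i).rev (σ j)) u = k at *
    generalize ev (M i.rev j) u = k' at *
    generalize ev g₀ ((qTilde N s)⁻¹ * u) = a at *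
    generalize ev g ((qTilde N s)⁻¹ * u) = b at *
    generalize m i j ((qTilde N s)⁻¹ * u) = x at *
    field_simp at h5 h6 ⊢
    apply mul_left_cancel₀ n3
    linear_combination a * μ i * μ j * h6 - b * γ i * γ j * w' * h5
  ext1 i j
  have := key (σ.symm i.rev) (σ.symm j)
  simpa using this

lemma Realizes.equivalentTo_of_sign {s : ℂ} (hs : s ≠ 0) (hN : 0 < N) {K M : RatMatrix N}
    {m : Fin N → Fin N → ℂ → ℂ} (hM : Realizes s M m) {δ : ℂ} (hδ : δ = 1 ∨ δ = -1)
    (hK : Matches (hmat s K) fun i j u => m i j (δ * u)) : EquivalentTo s K M := by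
  rcases hδ with rfl | rfl
  · exact hM.equivalentTo hs hN (by simpa only [one_mul] using hK)
  · have := (hM.negate hs).equivalentTo (K := K) hs hN (by simpa only [neg_one_mul] using hK)
    exact Relation.ReflTransGen.head (Transformation.negate s M) this

/-! ### The four families -/


/-- Multiplication by `C` is one-sided, while a gauge acts on both sides. Splitting `(-q)^n = s^n *
s^n` and moving one half to the column index gives the gauge `s^{rev i + 1}`. -/
lemma realizes_of_entries {s : ℂ} (hs : s ≠ 0) {M : RatMatrix N} {m : Fin N → Fin N → ℂ → ℂ}
    {g : RatFunc ℂ} (hg : g ≠ 0) (h : ∀ᶠ u in cofinite, ∀ i j,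
      s ^ ((i.rev : ℕ) + 1) * ev (M i.rev j) (qTilde N s * u)
        = ev g u * s ^ ((j.rev : ℕ) + 1) * m i j u) : Realizes s M m := by
  refine ⟨g, fun i => s ^ ((i.rev : ℕ) + 1), hg, fun i => pow_ne_zero _ hs, ?_⟩
  filter_upwards [h] with u hu i j
  have e : (-qOf s) ^ ((i.rev : ℕ) + 1) = s ^ ((i.rev : ℕ) + 1) * s ^ ((i.rev : ℕ) + 1) := by
    rw [qOf, neg_neg, ← mul_pow, sq]
  rw [hfun, e]
  linear_combination s ^ ((i.rev : ℕ) + 1) * hu i j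

lemma antidiagonalK_apply (i j : Fin N) : antidiagonalK N i.rev j = if i = j then 1 else 0 := by
  simp [antidiagonalK, Matrix.sum_apply, Matrix.single_apply, Fin.rev_eq_iff, ite_and]

lemma realizes_antidiagonalK {s : ℂ} (hs : s ≠ 0) : Realizes s (antidiagonalK N) diagModel := by
  refine realizes_of_entries hs (g := 1) one_ne_zero (Eventually.of_forall fun u i j => ?_)
  rw [antidiagonalK_apply]
  by_cases h : i = j
  · subst h; simp [diagModel, ev]
  · simp [h, diagModel]

lemma pairedK_apply (h : Even N) (i j : Fin N) :
    pairedK N i.rev j = if j = adjPartner h i then 1 else 0 := by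
  have h1 := adjPartner_val h i
  have h2 := Nat.even_iff.mp h
  have hi := i.isLt
  have hj := j.isLt
  simp only [pairedK, Matrix.sum_apply, Matrix.add_apply, Matrix.single_apply, Fin.ext_iff,
    Fin.val_rev]
  split_ifs with hji
  · rw [Finset.sum_eq_single ⟨(N - (i + 1)) / 2, by omega⟩ (fun b _ hb => ?_) (by simp)]
    · dsimp only at *
      split_ifs at * <;> first | omega | simp
    · rw [Ne, Fin.ext_iff] at hb
      simp only at hb
      split_ifs at * <;> first | omega | simp
  · refine Finset.sum_eq_zero fun b _ => ?_
    split_ifs at * <;> first | omega | simp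

lemma realizes_pairedK (h : Even N) {s : ℂ} (hs : s ≠ 0) :
    Realizes s (pairedK N) (pairedModel h (qOf s)) := by
  -- Partners differ by one, so the powers of `s` differ by one factor `s`. With `g = s⁻¹` the two
  -- entries become `s² = -q` and `1`.
  refine realizes_of_entries hs (g := RatFunc.C s⁻¹) (by simpa using hs)
    (Eventually.of_forall fun u i j => ?_)
  rw [pairedK_apply h]
  by_cases hj : j = adjPartner h i
  · have h1 := adjPartner_val h i
    rw [← hj] at h1
    have := i.isLt
    have := j.isLt
    have h2 := Nat.even_iff.mp h
    have h3 : i.rev = (i.rev : ℕ) := rfl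
    simp only [pairedModel, hj.symm, if_true, ev, RatFunc.eval_C, RatFunc.eval_one,
      RingHom.id_apply, qOf, Fin.val_rev]
    by_cases hi : (i : ℕ) % 2 = 0
    · rw [if_pos hi] at h1 ⊢
      have e : N - (i + 1) + 1 = (N - (j + 1) + 1) + 1 := by omega
      rw [e]
      field_simp
      ring
    · rw [if_neg hi] at h1 ⊢
      have e : N - (j + 1) + 1 = (N - (i + 1) + 1) + 1 := by omega
      rw [e]
      field_simp
      try ring
  · simp [hj, pairedModel]

lemma halfShiftK_apply (h : Even N) (i j : Fin N) : halfShiftK N i.rev j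
    = if j = halfPartner h i then (if (i : ℕ) < N / 2 then 1 else RatFunc.X) else 0 := by
  have h1 := halfPartner_val h i
  have h2 := Nat.even_iff.mp h
  have hi := i.isLt
  have hj := j.isLt
  simp only [halfShiftK, Matrix.sum_apply, Matrix.add_apply, Matrix.smul_apply,
    Matrix.single_apply, Fin.ext_iff, Fin.val_rev]
  split_ifs with hji hin
  · rw [if_pos hin] at h1
    rw [Finset.sum_eq_single ⟨N - (j + 1), by omega⟩ (fun b _ hb => ?_) (by simp)]
    · dsimp only at *
      split_ifs at * <;> first | omega | simp
    · rw [Ne, Fin.ext_iff] at hb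
      simp only at hb
      split_ifs at * <;> first | omega | simp
  · rw [if_neg hin] at h1
    rw [Finset.sum_eq_single ⟨N - (i + 1), by omega⟩ (fun b _ hb => ?_) (by simp)]
    · dsimp only at *
      split_ifs at * <;> first | omega | simp
    · rw [Ne, Fin.ext_iff] at hb
      simp only at hb
      split_ifs at * <;> first | omega | simp
  · refine Finset.sum_eq_zero fun b _ => ?_
    split_ifs at * <;> first | omega | simp

lemma realizes_halfShiftK (h : Even N) {s : ℂ} (hs : s ≠ 0) :
    Realizes s (halfShiftK N) (halfModel h) := by
  -- The shift by `N / 2` contributes `s^{N/2}` in the first half and `s^{-N/2}` in the second,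
  -- where the entry `q̃ u = s^N u` restores the difference.
  refine realizes_of_entries hs (g := RatFunc.C (s ^ (N / 2))) (by simp [hs])
    (Eventually.of_forall fun u i j => ?_)
  rw [halfShiftK_apply h]
  by_cases hj : j = halfPartner h i
  · have h1 := halfPartner_val h i
    rw [← hj] at h1
    have := i.isLt
    have := j.isLt
    have h2 := Nat.even_iff.mp h
    simp only [halfModel, hj.symm, if_true, ev, RatFunc.eval_C, RingHom.id_apply, Fin.val_rev,
      qTilde]
    by_cases hi : (i : ℕ) < N / 2
    · rw [if_pos hi] at h1
      simp only [if_pos hi, RatFunc.eval_one, mul_one]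
      rw [← pow_add]
      congr 1
      omega
    · rw [if_neg hi] at h1
      simp only [if_neg hi, RatFunc.eval_X]
      rw [← mul_assoc, ← pow_add, ← pow_add]
      congr 2
      omega
  · simp [hj, halfModel]

lemma denseK_apply (s : ℂ) (i j : Fin N) : denseK N s i.rev j = if i = j then 1 else
    RatFunc.C (1 + qOf s) / (RatFunc.C (qTilde N s) + RatFunc.C (qOf s) * RatFunc.X) *
      if i < j then RatFunc.C (s ^ (((j.rev : ℕ) : ℤ) - ((i.rev : ℕ) : ℤ)) * qTilde N s)
      else RatFunc.C (s ^ (((j.rev : ℕ) : ℤ) - ((i.rev : ℕ) : ℤ))) * RatFunc.X := by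
  have hterm : ∀ (p : Prop) [Decidable p] (c x y : RatFunc ℂ) (k l : Fin N),
      (if p then c • (x • E k l.rev + y • E l k.rev) else 0 : RatMatrix N) i.rev j
      = (if k = i.rev then (if l = j.rev then (if p then c * x else 0) else 0) else 0)
        + (if l = i.rev then (if k = j.rev then (if p then c * y else 0) else 0) else 0) := by
    intro p _ c x y k l
    have e : ∀ a b : Fin N, (a.rev = b) = (a = b.rev) := fun a b => propext Fin.rev_eq_iff
    by_cases hp : p
    · simp only [hp, if_true, Matrix.smul_apply, Matrix.add_apply, Matrix.single_apply,
        smul_eq_mul, e, ite_and, mul_add, mul_ite, mul_one, mul_zero]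
    · simp [hp]
  have hdiag : (∑ k : Fin N, E k k.rev : RatMatrix N) i.rev j = if i = j then 1 else 0 :=
    antidiagonalK_apply i j
  rw [denseK, Matrix.add_apply, hdiag, Matrix.sum_apply]
  simp only [Matrix.sum_apply, hterm, Finset.sum_add_distrib, Finset.sum_ite_irrel,
    Finset.sum_const_zero, Finset.sum_ite_eq', Finset.mem_univ, if_true, Fin.rev_lt_rev]
  rcases lt_trichotomy i j with h | h | h
  · simp [h, h.not_gt, h.ne]
  · simp [h]
  · simp [h, h.not_gt, h.ne']

lemma realizes_denseK {s : ℂ} (hs : s ≠ 0) : Realizes s (denseK N s) (denseModel (qOf s)) := by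
  have hq := qOf_ne_zero hs
  have ht := qTilde_ne_zero (N := N) hs
  have hX : ∀ᶠ u in cofinite, ev (RatFunc.C 1 + RatFunc.C (qOf s) * RatFunc.X) u
      = 1 + qOf s * u := by
    filter_upwards [ev_add (RatFunc.C 1) (RatFunc.C (qOf s) * RatFunc.X), ev_C_mul_X (qOf s)]
      with u h1 h2
    rw [h1, h2]
    simp only [ev, RatFunc.eval_C, RingHom.id_apply]
  have hn : ∀ᶠ u in cofinite, 1 + qOf s * u ≠ 0 := by
    filter_upwards [eventually_ne (-(qOf s)⁻¹)] with u hu h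
    apply hu
    field_simp
    linear_combination h
  have hne : RatFunc.C 1 + RatFunc.C (qOf s) * RatFunc.X ≠ 0 := by
    intro h
    obtain ⟨u, h1, h2⟩ := (hX.and hn).exists
    rw [h, ev_zero] at h1
    exact h2 h1.symm
  let r : RatFunc ℂ := RatFunc.C (1 + qOf s) /
    (RatFunc.C (qTilde N s) + RatFunc.C (qOf s) * RatFunc.X)
  have hr : ∀ᶠ u in cofinite, ev r u = (1 + qOf s) / (qTilde N s + qOf s * u) := by
    filter_upwards [ev_div (RatFunc.C (1 + qOf s))
        (RatFunc.C (qTilde N s) + RatFunc.C (qOf s) * RatFunc.X),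
      ev_add (RatFunc.C (qTilde N s)) (RatFunc.C (qOf s) * RatFunc.X), ev_C_mul_X (qOf s)]
      with u h1 h2 h3
    rw [h1, h2, h3]
    simp only [ev, RatFunc.eval_C, RingHom.id_apply]
  have hm : ∀ᶠ u in cofinite, ∀ i j : Fin N, ev (denseK N s i.rev j) u = if i = j then 1 else
      (1 + qOf s) / (qTilde N s + qOf s * u) * (s ^ (((j.rev : ℕ) : ℤ) - ((i.rev : ℕ) : ℤ)) *
        if i < j then qTilde N s else u) := by
    refine eventually_all.mpr fun i => eventually_all.mpr fun j => ?_
    filter_upwards [hr, ev_mul r (RatFunc.C (s ^ (((j.rev : ℕ) : ℤ) - ((i.rev : ℕ) : ℤ))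
        * qTilde N s)), ev_mul r (RatFunc.C (s ^ (((j.rev : ℕ) : ℤ) - ((i.rev : ℕ) : ℤ)))
        * RatFunc.X), ev_C_mul_X (s ^ (((j.rev : ℕ) : ℤ) - ((i.rev : ℕ) : ℤ)))] with u h1 h2 h3 h4
    rw [denseK_apply]
    split_ifs
    · simp [ev]
    · rw [h2, h1]
      simp only [ev, RatFunc.eval_C, RingHom.id_apply]
    · rw [h3, h1, h4]
  refine realizes_of_entries hs (inv_ne_zero hne) ?_
  filter_upwards [eventually_comp_mul hm ht, hX, hn,
    ev_inv (RatFunc.C 1 + RatFunc.C (qOf s) * RatFunc.X)] with u h1 h2 h3 h4 i j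
  rw [h1, h4, h2]
  have h5 : qTilde N s + qOf s * (qTilde N s * u) = qTilde N s * (1 + qOf s * u) := by ring
  have h6 : s ^ ((j.rev : ℕ) + 1) = s ^ ((i.rev : ℕ) + 1) *
      s ^ (((j.rev : ℕ) : ℤ) - ((i.rev : ℕ) : ℤ)) := by
    rw [← zpow_natCast, ← zpow_natCast, ← zpow_add₀ hs]
    congr 1
    push_cast
    ring
  rw [h5]
  by_cases hij : i = j
  · subst hij
    simp only [denseModel, if_true]
    field_simp
  · simp only [denseModel, hij, if_false]
    rw [h6]
    have h7 : s ^ (((j.rev : ℕ) : ℤ) - ((i.rev : ℕ) : ℤ)) ≠ 0 := zpow_ne_zero _ hs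
    generalize s ^ (((j.rev : ℕ) : ℤ) - ((i.rev : ℕ) : ℤ)) = z at *
    split_ifs <;> field_simp

theorem solvesCtRE_iff_equivalentTo (hN : 3 ≤ N) {s : ℂ} (hq : qOf s ≠ 0) (hq2 : qOf s ^ 2 ≠ 1)
    (hq4 : qOf s ^ 2 ≠ -1) {K : RatMatrix N} (hK : K.det ≠ 0) : SolvesCtRE s K ↔
      EquivalentTo s K (denseK N s) ∨ EquivalentTo s K (antidiagonalK N) ∨
      (Even N ∧ EquivalentTo s K (pairedK N)) ∨ (Even N ∧ EquivalentTo s K (halfShiftK N)) := by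
  have hs0 : s ≠ 0 := by
    rintro rfl
    simp [qOf] at hq
  have hN0 : 0 < N := by omega
  constructor
  · intro h
    have hH := ratSol_hmat hs0 h
    have hrow := hmat_row_ne_zero hs0 hK
    by_cases hdiag : ∀ i, hmat s K i i = 0
    · obtain ⟨hE, hm | ⟨δ, hδ, hm⟩⟩ := hH.matches_of_diag_eq_zero hq hq2 hrow hdiag hN
      · exact Or.inr (Or.inr (Or.inl ⟨hE, (realizes_pairedK hE hs0).equivalentTo hs0 hN0 hm⟩))
      · exact Or.inr (Or.inr (Or.inr
          ⟨hE, (realizes_halfShiftK hE hs0).equivalentTo_of_sign hs0 hN0 hδ hm⟩))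
    · push Not at hdiag
      obtain ⟨i, hi⟩ := hdiag
      obtain hm | ⟨δ, hδ, hm⟩ := hH.matches_of_diag_ne_zero hq hq2 hq4 hN hrow hi
      · exact Or.inr (Or.inl ((realizes_antidiagonalK hs0).equivalentTo hs0 hN0 hm))
      · exact Or.inl ((realizes_denseK hs0).equivalentTo_of_sign hs0 hN0 hδ hm)
  · rintro (h | h | ⟨hE, h⟩ | ⟨hE, h⟩)
    · exact ((realizes_denseK hs0).solvesCtRE hs0 (denseModel_sol hq)).equivalentTo hs0 hq2 hN0 h
    · exact ((realizes_antidiagonalK hs0).solvesCtRE hs0 (diagModel_sol _)).equivalentTo hs0 hq2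
        hN0 h
    · exact ((realizes_pairedK hE hs0).solvesCtRE hs0 (pairedModel_sol hE hq)).equivalentTo hs0
        hq2 hN0 h
    · exact ((realizes_halfShiftK hE hs0).solvesCtRE hs0 (halfModel_sol hE hq)).equivalentTo hs0
        hq2 hN0 h

end ReflectionEquation

end

theorem theorem3p10 (N : ℕ) (hN : 3 ≤ N) (q s : ℂ) (hq : q ≠ 0)
    (hroot : ∀ n : ℕ, 0 < n → q ^ n ≠ 1) (hs : s ^ 2 = -q)
    (K : ReflectionEquation.RatMatrix N) (hK : K.det ≠ 0) :
    ReflectionEquation.SolvesCtRE s K ↔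
      ReflectionEquation.EquivalentTo s K (ReflectionEquation.denseK N s) ∨
      ReflectionEquation.EquivalentTo s K (ReflectionEquation.antidiagonalK N) ∨
      (Even N ∧ ReflectionEquation.EquivalentTo s K (ReflectionEquation.pairedK N)) ∨
      (Even N ∧ ReflectionEquation.EquivalentTo s K (ReflectionEquation.halfShiftK N)) := by
  open ReflectionEquation in
  obtain rfl : q = qOf s := by rw [qOf, hs, neg_neg]
  open ReflectionEquation in
  -- Only `q² ≠ ±1` is required, and `q² = -1` would give `q⁴ = 1`.
  exact solvesCtRE_iff_equivalentTo hN hq (hroot 2 two_pos) (fun h => hroot 4 (by norm_num) (by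
    linear_combination (qOf s ^ 2 - 1) * h)) hK
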